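/- For positive integers $n,p$ and a matrix $X \in \mathbb{R}^{p \times n}$ let $\hat\Sigma = n^{-1}XX^T$, and for a function $k:\mathbb{R}\to\mathbb{R}$ define $K(X) \in \mathbb{R}^{p\times p}$ by $$K(X)_{ii'} = \begin{cases} \frac{1}{\sqrt n}\, k\big(\sqrt n\,\hat\Sigma_{ii'}\big) & i \neq i',\\ 0 & i = i'.\end{cases}$$ Write $\|M\|$ for the spectral norm of a matrix $M$ (its operator norm with respect to the Euclidean norm). **Theorem.** Let $A,\beta,\alpha>0$. There exist constants $C,C'>0$, depending only on $A$, $\beta$ and $\alpha$, such that the following holds. Let $k:\mathbb{R}\to\mathbb{R}$ be odd and locally absolutely continuous (that is, absolutely continuous on every compact interval; in particular $k$ is continuous, differentiable almost everywhere, and the integral of its derivative), with $|k'(x)| \le A e^{\beta|x|}$ for almost every $x \in \mathbb{R}$. Let $n,p \ge 1$ and let $X \in \mathbb{R}^{p\times n}$ be a random matrix whose entries are independent $\mathcal{N}(0,1)$ random variables. Then $$\mathbb{P}\left[\|K(X)\| > C\max\left(\frac pn, \sqrt{\frac pn}\right)\right] \le C'\left(p^{-\alpha} + p\,e^{-\alpha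 n}\right).$$ -/

import Mathlib

open MeasureTheory ProbabilityTheory

noncomputable section

/-- The sample covariance matrix `n⁻¹ X Xᵀ` of a `p × n` data matrix `X`. -/
def sampleCovariance {p n : ℕ} (X : Matrix (Fin p) (Fin n) ℝ) : Matrix (Fin p) (Fin p) ℝ :=
  (n : ℝ)⁻¹ • (X * X.transpose)

/-- The inner-product kernel matrix `K(X)`: off the diagonal, its `(i, i')` entry is
`n^{-1/2} k(n^{1/2} Σ̂_{ii'})` with `Σ̂` the sample covariance of `X`; its diagonal is zero. -/
def kernelMatrix (k : ℝ → ℝ) {p n : ℕ} (X : Matrix (Fin p) (Fin n) ℝ) :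
    Matrix (Fin p) (Fin p) ℝ :=
  Matrix.of fun i i' =>
    if i = i' then 0 else 1 / √(n : ℝ) * k (√(n : ℝ) * sampleCovariance X i i')

/-- The spectral norm of a real square matrix: its operator norm with respect to the Euclidean
norm on `ℝᵖ`. -/
def matrixSpectralNorm {p : ℕ} (M : Matrix (Fin p) (Fin p) ℝ) : ℝ :=
  ‖Matrix.toEuclideanCLM (n := Fin p) (𝕜 := ℝ) M‖

/-- A function on `ℝ` is locally absolutely continuous if it is absolutely continuous on every
compact interval. Such a function is continuous, differentiable almost everywhere, and is the
integral of its derivative. -/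
def LocallyAbsolutelyContinuous (f : ℝ → ℝ) : Prop :=
  ∀ a b : ℝ, AbsolutelyContinuousOnInterval f a b

/-- The entries of the random matrix `X` are independent standard normal random variables. -/
def HasIIDStandardGaussianEntries {Ω : Type*} [MeasurableSpace Ω] {p n : ℕ}
    (X : Ω → Matrix (Fin p) (Fin n) ℝ) (P : Measure Ω) : Prop :=
  iIndepFun (fun (ij : Fin p × Fin n) (ω : Ω) => X ω ij.1 ij.2) P ∧
    ∀ (i : Fin p) (j : Fin n), HasLaw (fun ω => X ω i j) (gaussianReal 0 1) P

end

/-!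
The kernel matrix is written as a mean of random bilinear forms which are conditionally Gaussian,
and the spectral norm of the mean is bounded by Chernoff bounds on nets.

Let `x` be the configuration of the rows of `X`, let `y` be an independent copy of it, and write
`g i j = ⟨xᵢ, xⱼ⟩ / √n` for the overlaps (`overlap`). The function `k` is the primitive of an even
density `h` with `|h t| ≤ A exp (β |t|)` (`exists_even_density`). When the row `i` is rotated from
`xᵢ` to `-xᵢ` through `yᵢ`, the overlap goes from `g i j` to `-g i j`, so the integral of `h` along
the path is `-2 k (g i j)`. Rotating the rows of a uniformly random subset of the indices separates
a given pair of rows with probability `1 / 4`. Hence the kernel matrix is, up to a constant, the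
mean over a random subset and a random angle of the matrices `h (g i j) ⟨yᵢ, xⱼ⟩ / n`, restricted
to the separated pairs and evaluated at the rotated pair `(x, y)` (`halfTurnMean_overlap`).
Rotations preserve the law of `(x, y)`, and for fixed `x` the form is linear in the Gaussian `y`;
so by Jensen's inequality a bilinear form `uᵀ K v` is sub-Gaussian, with the variance proxy of a
single matrix (`lintegral_exp_halfTurnMean_le`). No concentration inequality for the
non-Lipschitz map `X ↦ K(X)` is needed.

The variance is controlled on regular configurations (`regularSet`): the operator norm of `x` is of
the order `√(n + p)`, and in each row the mean of `exp (γ |g i j|)` is bounded for a large `γ`. The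
entries with `|g i j|` in `[l, l + 1)` are treated separately for each `l`. The weight `h` is at
most `A exp (β (l + 1))` there, but in every row and column only a fraction `exp (-γ l)` of the
entries is concerned. If one of `u`, `v` is flat, the variance decreases exponentially in `l` and
pays for nets of cardinality `exp (O(p))`; if both are sparse, it does not, but the nets are
smaller. Splitting vectors into flat and sparse parts gives a norm `O(exp (-l))` times
`√(p (n + p)) / n` for the level `l` (`measure_not_level_bilin_le_le`), which is summable and of
the order of `max (p / n) √(p / n)`.

Irregular configurations are rare (`measure_compl_regularSet_le`). Their contribution to the mean
is estimated by the first moment of the entries (`lintegral_abs_halfTurnMean_le`), after `h` has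
been cut off at a height which no overlap of a regular configuration exceeds and at which it is
polynomial in `p`.
-/

/-! ### Nets for flat and sparse vectors -/

/-- `N` is a half-net of `C`: it lies in `C`, and every `u ∈ C` is a point of `N` up to an error
that lies in `C / 2`. Measuring the error by `C` itself, and not by the Euclidean norm, is what
makes suprema of linear forms over `C` comparable to suprema over `N`. -/
def IsHalfNet {ι : Type*} (N C : Set (ι → ℝ)) : Prop :=
  N ⊆ C ∧ ∀ u ∈ C, ∃ w ∈ N, (2 : ℝ) • (u - w) ∈ C

/-- The vectors of the Euclidean unit ball all of whose coordinates are at most `δ`. -/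
def flatBall (ι : Type*) [Fintype ι] (δ : ℝ) : Set (ι → ℝ) :=
  {u | ∑ i, u i ^ 2 ≤ 1 ∧ ∀ i, |u i| ≤ δ}

lemma mem_flatBall_one {ι : Type*} [Fintype ι] {u : ι → ℝ} :
    u ∈ flatBall ι 1 ↔ ∑ i, u i ^ 2 ≤ 1 :=
  ⟨fun h => h.1, fun h => ⟨h, fun _ => (sq_le_one_iff_abs_le_one _).1
    ((Finset.single_le_sum (f := fun i => u i ^ 2) (fun _ _ => sq_nonneg _)
      (Finset.mem_univ _)).trans h)⟩⟩

lemma one_div_sqrt_card_le_one (ι : Type*) [Fintype ι] [Nonempty ι] :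
    1 / √(Fintype.card ι : ℝ) ≤ 1 := by
  have : (1 : ℝ) ≤ Fintype.card ι := by exact_mod_cast Fintype.card_pos
  rw [div_le_one (by positivity)]
  exact Real.one_le_sqrt.2 this

/-- The vectors of the Euclidean unit ball with at most `s` nonzero coordinates, `s` real. -/
def sparseBall (ι : Type*) [Fintype ι] (s : ℝ) : Set (ι → ℝ) :=
  {u | ∑ i, u i ^ 2 ≤ 1 ∧ ((Finset.univ.filter fun i => u i ≠ 0).card : ℝ) ≤ s}

/-- The points of the unit ball on the grid of mesh `1 / (2 √m)`. -/
def gridNet (ι : Type*) [Fintype ι] (m : ℝ) : Set (ι → ℝ) :=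
  {w | ∃ z : ι → ℤ, ∑ i, (z i : ℝ) ^ 2 ≤ 4 * m ∧ w = fun i => (z i : ℝ) / (2 * √m)}

lemma exists_int_abs_le_abs (x : ℝ) : ∃ z : ℤ, |(z : ℝ)| ≤ |x| ∧ |x - z| ≤ 1 := by
  rcases le_total 0 x with h | h
  · refine ⟨⌊x⌋, ?_, ?_⟩
    · rw [abs_of_nonneg h, abs_of_nonneg (by exact_mod_cast Int.floor_nonneg.2 h)]
      exact Int.floor_le x
    · rw [abs_le]
      constructor <;> linarith [Int.floor_le x, Int.lt_floor_add_one x]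
  · refine ⟨⌈x⌉, ?_, ?_⟩
    · have h2 : (⌈x⌉ : ℝ) ≤ 0 := by exact_mod_cast Int.ceil_le.2 (by simpa using h)
      rw [abs_of_nonpos h, abs_of_nonpos h2]
      linarith [Int.le_ceil x]
    · rw [abs_le]
      constructor <;> linarith [Int.le_ceil x, Int.ceil_lt_add_one x]

/-- Rounding towards zero: the grid point never exceeds the vector, coordinate by coordinate. -/
lemma exists_gridNet_round {ι : Type*} [Fintype ι] {m : ℝ} (hm : 0 < m) {u : ι → ℝ}
    (hu : ∑ i, u i ^ 2 ≤ 1) :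
    ∃ w ∈ gridNet ι m, ∀ i, |w i| ≤ |u i| ∧ |2 * (u i - w i)| ≤ 1 / √m := by
  have hs : 0 < √m := Real.sqrt_pos.2 hm
  choose z hz1 hz2 using fun i => exists_int_abs_le_abs (2 * √m * u i)
  refine ⟨fun i => (z i : ℝ) / (2 * √m), ⟨z, ?_, rfl⟩, fun i => ⟨?_, ?_⟩⟩
  · calc ∑ i, (z i : ℝ) ^ 2 ≤ ∑ i, 4 * m * u i ^ 2 := by
          refine Finset.sum_le_sum fun i _ => ?_
          have := sq_le_sq.2 (hz1 i)
          calc (z i : ℝ) ^ 2 ≤ _ := this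
            _ = 4 * (√m) ^ 2 * u i ^ 2 := by ring
            _ = _ := by rw [Real.sq_sqrt hm.le]
      _ = 4 * m * ∑ i, u i ^ 2 := by rw [Finset.mul_sum]
      _ ≤ 4 * m * 1 := by gcongr
      _ = 4 * m := by ring
  · rw [abs_div, abs_of_pos (by positivity : 0 < 2 * √m), div_le_iff₀ (by positivity)]
    calc _ ≤ _ := hz1 i
      _ = _ := by rw [abs_mul, abs_of_pos (by positivity : 0 < 2 * √m)]; ring
  · have : 2 * (u i - z i / (2 * √m)) = (2 * √m * u i - z i) / √m := by field_simp
    rw [this, abs_div, abs_of_pos hs]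
    gcongr
    exact hz2 i

/-- Rounding towards zero keeps the coordinates below `δ`, and at mesh `1 / (2 √card ι)` twice the
rounding error has coordinates at most `1 / √card ι ≤ δ`, hence norm at most `1`. -/
lemma isHalfNet_flatBall (ι : Type*) [Fintype ι] [Nonempty ι] {δ : ℝ}
    (hδ : 1 / √(Fintype.card ι) ≤ δ) :
    IsHalfNet (gridNet ι (Fintype.card ι) ∩ flatBall ι δ) (flatBall ι δ) := by
  have hc : (0 : ℝ) < Fintype.card ι := by exact_mod_cast Fintype.card_pos
  refine ⟨Set.inter_subset_right, fun u hu => ?_⟩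
  obtain ⟨w, hw, h⟩ := exists_gridNet_round hc hu.1
  refine ⟨w, ⟨hw, ?_, fun i => (h i).1.trans (hu.2 i)⟩, ?_, fun i => ?_⟩
  · exact (Finset.sum_le_sum fun i _ => sq_le_sq.2 (h i).1).trans hu.1
  · calc ∑ i, (((2 : ℝ) • (u - w)) i) ^ 2 ≤ ∑ i : ι, 1 / (Fintype.card ι : ℝ) := by
          refine Finset.sum_le_sum fun i _ => ?_
          have := sq_le_sq' (neg_le_of_abs_le (h i).2) (le_of_abs_le (h i).2)
          simpa [div_pow, Real.sq_sqrt hc.le] using this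
      _ = 1 := by simp [hc.ne']
  · exact (h i).2.trans hδ

/-- Rounding towards zero does not enlarge the support, so that the mesh may be as coarse as
`1 / (2 √s)`. -/
lemma isHalfNet_sparseBall (ι : Type*) [Fintype ι] {s : ℝ} (hs : 0 < s) :
    IsHalfNet (gridNet ι s ∩ sparseBall ι s) (sparseBall ι s) := by
  refine ⟨Set.inter_subset_right, fun u hu => ?_⟩
  obtain ⟨w, hw, h⟩ := exists_gridNet_round hs hu.1
  have hw0 : ∀ i, u i = 0 → w i = 0 := fun i hi => by simpa [hi] using (h i).1
  have hd0 : ∀ i, u i = 0 → ((2 : ℝ) • (u - w)) i = 0 := fun i hi => by simp [hi, hw0 i hi]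
  have hcard : ∀ v : ι → ℝ, (∀ i, u i = 0 → v i = 0) →
      ((Finset.univ.filter fun i => v i ≠ 0).card : ℝ) ≤ s := fun v hv => by
    refine le_trans ?_ hu.2
    exact_mod_cast Finset.card_le_card fun i => by
      simpa using fun hi h0 => hi (hv i h0)
  refine ⟨w, ⟨hw, (Finset.sum_le_sum fun i _ => sq_le_sq.2 (h i).1).trans hu.1, hcard w hw0⟩, ?_,
    hcard _ hd0⟩
  calc ∑ i, (((2 : ℝ) • (u - w)) i) ^ 2
      ≤ ∑ i, if u i ≠ 0 then 1 / s else 0 := by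
        refine Finset.sum_le_sum fun i _ => ?_
        by_cases hi : u i = 0
        · simp [hi, hw0 i hi]
        · have := sq_le_sq' (neg_le_of_abs_le (h i).2) (le_of_abs_le (h i).2)
          simpa [hi, div_pow, Real.sq_sqrt hs.le] using this
    _ = (Finset.univ.filter fun i => u i ≠ 0).card * (1 / s) := by
        rw [← Finset.sum_filter]; simp
    _ ≤ s * (1 / s) := by gcongr; exact hu.2
    _ = 1 := by field_simp

/-- Exponential-moment count of the lattice points in a ball: weighting a point `z` by
`r ^ ‖z‖²` with `r = m / (2 card ι)` makes the total weight a product of one-dimensional sums. -/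
lemma gridNet_finite_and_ncard_le (ι : Type*) [Fintype ι] {m : ℝ} (hm : 0 < m)
    (hmc : m ≤ Fintype.card ι) :
    (gridNet ι m).Finite ∧
      ((gridNet ι m).ncard : ℝ) ≤
        Real.exp (m * (2 + 4 * Real.log (2 * Fintype.card ι / m))) := by
  classical
  set R : ℕ := ⌈4 * m⌉₊
  have hc : (0 : ℝ) < Fintype.card ι := hm.trans_le hmc
  set r : ℝ := m / (2 * Fintype.card ι) with hr
  have hr0 : 0 < r := by positivity
  have hr2 : r ≤ 1 / 2 := by rw [hr, div_le_div_iff₀ (by positivity) (by norm_num)]; linarith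
  set S : Finset (ι → ℤ) :=
    (Fintype.piFinset fun _ : ι => Finset.Icc (-(R : ℤ)) R).filter
      fun z => ∑ i, (z i : ℝ) ^ 2 ≤ 4 * m with hS
  have hsub : gridNet ι m ⊆ (fun z : ι → ℤ => fun i => (z i : ℝ) / (2 * √m)) '' (S : Set _) := by
    rintro w ⟨z, hz, rfl⟩
    refine ⟨z, ?_, rfl⟩
    simp only [hS, Finset.coe_filter, Fintype.mem_piFinset, Finset.mem_Icc, Set.mem_ofPred_eq]
    refine ⟨fun i => ?_, hz⟩
    have h1 : (z i : ℝ) ^ 2 ≤ R :=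
      ((Finset.single_le_sum (f := fun i => (z i : ℝ) ^ 2) (fun i _ => sq_nonneg _)
        (Finset.mem_univ i)).trans hz).trans (Nat.le_ceil _)
    have h2 : (z i) ^ 2 ≤ (R : ℤ) := by exact_mod_cast h1
    constructor <;> nlinarith [sq_nonneg (z i - 1), sq_nonneg (z i + 1)]
  have hfin : (gridNet ι m).Finite := (S.finite_toSet.image _).subset hsub
  refine ⟨hfin, ?_⟩
  have h1 : ((gridNet ι m).ncard : ℝ) ≤ S.card := by
    have := (Set.ncard_le_ncard hsub (S.finite_toSet.image _)).trans
      (Set.ncard_image_le S.finite_toSet)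
    rw [Set.ncard_coe_finset] at this
    exact_mod_cast this
  have hlin : ∑ z ∈ Finset.Icc (-(R : ℤ)) R, r ^ (z.natAbs ^ 2) ≤ 1 + 4 * r := by
    have hgeom : ∀ N : ℕ, ∑ k ∈ Finset.range N, r ^ (k + 1) ≤ 2 * r := fun N => by
      have hg : ∑ k ∈ Finset.range N, r ^ k ≤ 2 := by
        rw [geom_sum_eq (by linarith)]
        have h3 : (r ^ N - 1) / (r - 1) = (1 - r ^ N) / (1 - r) := by
          rw [← neg_sub 1 (r ^ N), ← neg_sub 1 r, neg_div_neg_eq]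
        rw [h3, div_le_iff₀ (by linarith)]
        have := pow_pos hr0 N
        linarith
      calc _ = r * ∑ k ∈ Finset.range N, r ^ k := by
            rw [Finset.mul_sum]; exact Finset.sum_congr rfl fun k _ => by ring
        _ ≤ r * 2 := by gcongr
        _ = _ := by ring
    have hind : ∀ N : ℕ, ∑ z ∈ Finset.Icc (-(N : ℤ)) N, r ^ (z.natAbs ^ 2) ≤
        1 + 2 * ∑ k ∈ Finset.range N, r ^ (k + 1) := by
      intro N
      induction N with
      | zero => simp
      | succ N ih =>
        have hsplit : Finset.Icc (-((N + 1 : ℕ) : ℤ)) ((N + 1 : ℕ) : ℤ) ⊆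
            insert (-((N + 1 : ℕ) : ℤ)) (insert ((N + 1 : ℕ) : ℤ) (Finset.Icc (-(N : ℤ)) N)) := by
          intro z hz
          simp only [Finset.mem_Icc, Finset.mem_insert] at hz ⊢
          omega
        have hpow : r ^ ((N + 1) ^ 2) ≤ r ^ (N + 1) :=
          pow_le_pow_of_le_one hr0.le (by linarith) (by nlinarith)
        refine (Finset.sum_le_sum_of_subset_of_nonneg hsplit fun _ _ _ => by positivity).trans ?_
        rw [Finset.sum_insert (by simp; omega), Finset.sum_insert (by simp), Finset.sum_range_succ]
        simp only [Int.natAbs_neg, Int.natAbs_natCast]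
        linarith
    linarith [hind R, hgeom R]
  have h2 : (S.card : ℝ) * r ^ (4 * m) ≤ (1 + 4 * r) ^ Fintype.card ι := by
    calc (S.card : ℝ) * r ^ (4 * m) = ∑ z ∈ S, r ^ (4 * m) := by simp
      _ ≤ ∑ z ∈ S, ∏ i, r ^ ((z i).natAbs ^ 2) := by
          refine Finset.sum_le_sum fun z hz => ?_
          have hz' := (Finset.mem_filter.1 hz).2
          rw [Finset.prod_pow_eq_pow_sum, ← Real.rpow_natCast]
          refine Real.rpow_le_rpow_of_exponent_ge hr0 (by linarith) ?_
          push_cast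
          simpa using hz'
      _ ≤ ∑ z ∈ Fintype.piFinset fun _ : ι => Finset.Icc (-(R : ℤ)) R,
            ∏ i, r ^ ((z i).natAbs ^ 2) :=
          Finset.sum_le_sum_of_subset_of_nonneg (Finset.filter_subset _ _)
            fun _ _ _ => by positivity
      _ = (∑ z ∈ Finset.Icc (-(R : ℤ)) R, r ^ (z.natAbs ^ 2)) ^ Fintype.card ι := by
          rw [Finset.sum_prod_piFinset (Finset.Icc (-(R : ℤ)) R)
            (fun (_ : ι) z => r ^ (z.natAbs ^ 2))]
          simp
      _ ≤ _ := by gcongr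
  have h3 : (1 + 4 * r) ^ Fintype.card ι ≤ Real.exp (2 * m) := by
    calc (1 + 4 * r) ^ Fintype.card ι ≤ Real.exp (4 * r) ^ Fintype.card ι := by
          gcongr; linarith [Real.add_one_le_exp (4 * r)]
      _ = Real.exp (2 * m) := by
          rw [← Real.exp_nat_mul, hr]; congr 1; field_simp; ring
  have h4 : r ^ (4 * m) = Real.exp (-(4 * m * Real.log (2 * Fintype.card ι / m))) := by
    rw [Real.rpow_def_of_pos hr0, hr, ← inv_div, Real.log_inv]; congr 1; ring
  rw [h4] at h2
  calc ((gridNet ι m).ncard : ℝ) ≤ S.card := h1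
    _ = S.card * Real.exp (-(4 * m * Real.log (2 * Fintype.card ι / m))) *
        Real.exp (4 * m * Real.log (2 * Fintype.card ι / m)) := by
        rw [mul_assoc, ← Real.exp_add]; simp
    _ ≤ Real.exp (2 * m) * Real.exp (4 * m * Real.log (2 * Fintype.card ι / m)) := by
        gcongr; exact h2.trans h3
    _ = _ := by rw [← Real.exp_add]; congr 1; ring

/-- At full mesh the grid has at most `exp (5 card ι)` points, as `2 + 4 log 2 ≤ 5`. -/
lemma gridNet_card_ncard_le (ι : Type*) [Fintype ι] [Nonempty ι] :
    ((gridNet ι (Fintype.card ι)).ncard : ℝ) ≤ Real.exp (5 * Fintype.card ι) := by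
  have hc : (0 : ℝ) < Fintype.card ι := by exact_mod_cast Fintype.card_pos
  refine (gridNet_finite_and_ncard_le ι hc le_rfl).2.trans (Real.exp_le_exp.2 ?_)
  rw [mul_div_assoc, div_self hc.ne', mul_one]
  nlinarith [Real.log_two_lt_d9]

open Matrix in
/-- The supremum `S` of a linear form over `C` satisfies `S ≤ t + S / 2`. -/
lemma dotProduct_le_of_isHalfNet {ι : Type*} [Fintype ι] {N C : Set (ι → ℝ)} (hN : IsHalfNet N C)
    (hC : ∀ u ∈ C, ∑ i, u i ^ 2 ≤ 1) {a : ι → ℝ} {t : ℝ} (h : ∀ w ∈ N, w ⬝ᵥ a ≤ t) :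
    ∀ u ∈ C, u ⬝ᵥ a ≤ 2 * t := by
  intro u hu
  set S := sSup ((fun u => u ⬝ᵥ a) '' C)
  have hbdd : BddAbove ((fun u => u ⬝ᵥ a) '' C) := by
    refine ⟨∑ i, |a i|, ?_⟩
    rintro _ ⟨v, hv, rfl⟩
    refine Finset.sum_le_sum fun i _ => ?_
    have h1 : v i ^ 2 ≤ 1 := (Finset.single_le_sum (f := fun i => v i ^ 2)
      (fun i _ => sq_nonneg _) (Finset.mem_univ i)).trans (hC v hv)
    calc v i * a i ≤ |v i * a i| := le_abs_self _
      _ = |v i| * |a i| := abs_mul _ _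
      _ ≤ 1 * |a i| := by gcongr; exact (sq_le_one_iff_abs_le_one _).1 h1
      _ = _ := one_mul _
  have hle : ∀ v ∈ C, v ⬝ᵥ a ≤ t + S / 2 := fun v hv => by
    obtain ⟨w, hw, hvw⟩ := hN.2 v hv
    have h1 := h w hw
    have h2 : ((2 : ℝ) • (v - w)) ⬝ᵥ a ≤ S := le_csSup hbdd ⟨_, hvw, rfl⟩
    rw [smul_dotProduct, sub_dotProduct, smul_eq_mul] at h2
    linarith
  have hS2 : S ≤ t + S / 2 := csSup_le ⟨_, u, hu, rfl⟩ (by rintro _ ⟨v, hv, rfl⟩; exact hle v hv)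
  linarith [hle u hu]

open Matrix in
/-- A bilinear form bounded by `t` on a product of half-nets is bounded by `4 t` on the product of
the sets. -/
lemma bilin_le_of_isHalfNet {ι κ : Type*} [Fintype ι] [Fintype κ] {N C : Set (ι → ℝ)}
    {N' C' : Set (κ → ℝ)} (hN : IsHalfNet N C) (hN' : IsHalfNet N' C')
    (hC : ∀ u ∈ C, ∑ i, u i ^ 2 ≤ 1) (hC' : ∀ u ∈ C', ∑ i, u i ^ 2 ≤ 1) {M : Matrix ι κ ℝ}
    {t : ℝ} (h : ∀ u ∈ N, ∀ v ∈ N', u ⬝ᵥ M *ᵥ v ≤ t) :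
    ∀ u ∈ C, ∀ v ∈ C', u ⬝ᵥ M *ᵥ v ≤ 4 * t := by
  intro u hu v hv
  have h1 : ∀ v ∈ N', v ⬝ᵥ u ᵥ* M ≤ 2 * t := fun v hv => by
    rw [dotProduct_comm, ← dotProduct_mulVec]
    exact dotProduct_le_of_isHalfNet hN hC (fun w hw => h w hw v hv) u hu
  have := dotProduct_le_of_isHalfNet hN' hC' h1 v hv
  rw [dotProduct_comm, ← dotProduct_mulVec] at this
  linarith

/-! ### Gaussian exponential moments, tails and rotations -/

lemma lintegral_pi_prod {ι : Type*} [Fintype ι] {E : ι → Type*} [∀ i, MeasurableSpace (E i)]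
    (μ : ∀ i, Measure (E i)) [∀ i, IsProbabilityMeasure (μ i)] {f : ∀ i, E i → ENNReal}
    (hf : ∀ i, Measurable (f i)) :
    ∫⁻ x, ∏ i, f i (x i) ∂(Measure.pi μ) = ∏ i, ∫⁻ y, f i y ∂(μ i) := by
  refine (lintegral_prod_eq_prod_lintegral_of_indepFun Finset.univ
    (fun i (x : ∀ i, E i) => f i (x i)) (iIndepFun_pi fun i => (hf i).aemeasurable)
    fun i => (hf i).comp (measurable_pi_apply i)).trans ?_
  exact Finset.prod_congr rfl fun i _ => (measurePreserving_eval μ i).lintegral_comp (hf i)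

/-- Chernoff bound from a sub-Gaussian moment generating function with variance proxy `σ`. -/
lemma measure_ge_le_of_lintegral_exp_le {Ω : Type*} [MeasurableSpace Ω] {μ : Measure Ω}
    {f : Ω → ℝ} {σ t : ℝ} (hσ : 0 < σ) (ht : 0 < t)
    (h : ∀ l : ℝ, 0 < l →
      ∫⁻ ω, ENNReal.ofReal (Real.exp (l * f ω)) ∂μ ≤ ENNReal.ofReal (Real.exp (l ^ 2 * σ / 2)))
    (hf : AEMeasurable f μ) :
    μ {ω | t ≤ f ω} ≤ ENNReal.ofReal (Real.exp (-(t ^ 2 / (2 * σ)))) := by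
  have hl : 0 < t / σ := by positivity
  have h1 := mul_meas_ge_le_lintegral₀
    (f := fun ω => ENNReal.ofReal (Real.exp (t / σ * f ω)))
    ((Real.measurable_exp.comp_aemeasurable (hf.const_mul _)).ennreal_ofReal)
    (ENNReal.ofReal (Real.exp (t / σ * t)))
  have hsub : {ω | t ≤ f ω} ⊆ {ω | ENNReal.ofReal (Real.exp (t / σ * t)) ≤
      ENNReal.ofReal (Real.exp (t / σ * f ω))} := fun ω hω => by
    have hω' : t ≤ f ω := hω
    exact ENNReal.ofReal_le_ofReal (Real.exp_le_exp.2 (by gcongr))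
  have h2 := (mul_le_mul_right (measure_mono hsub)
    (ENNReal.ofReal (Real.exp (t / σ * t)))).trans (h1.trans (h _ hl))
  have h3 : ENNReal.ofReal (Real.exp (-(t / σ * t))) *
      (ENNReal.ofReal (Real.exp (t / σ * t)) * μ {ω | t ≤ f ω}) = μ {ω | t ≤ f ω} := by
    rw [← mul_assoc, ← ENNReal.ofReal_mul (Real.exp_pos _).le, ← Real.exp_add]
    simp
  rw [← h3]
  refine (mul_le_mul_right h2 _).trans ?_
  rw [← ENNReal.ofReal_mul (Real.exp_pos _).le, ← Real.exp_add]
  refine ENNReal.ofReal_le_ofReal (Real.exp_le_exp.2 (le_of_eq ?_))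
  field_simp
  ring

section Gaussian

variable {κ ι : Type*} [Fintype κ]

lemma map_inner_stdGaussian (c : EuclideanSpace ℝ κ) :
    (stdGaussian (EuclideanSpace ℝ κ)).map (fun y => inner ℝ c y) =
      gaussianReal 0 (‖c‖ ^ 2).toNNReal := by
  have h := IsGaussian.map_eq_gaussianReal (μ := stdGaussian (EuclideanSpace ℝ κ))
    (innerSL ℝ c)
  rw [integral_strongDual_stdGaussian, variance_dual_stdGaussian, innerSL_apply_norm] at h
  exact h

lemma lintegral_exp_inner (c : EuclideanSpace ℝ κ) :
    ∫⁻ y, ENNReal.ofReal (Real.exp (inner ℝ c y)) ∂(stdGaussian (EuclideanSpace ℝ κ)) =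
      ENNReal.ofReal (Real.exp (‖c‖ ^ 2 / 2)) := by
  have hm : Measurable fun y : EuclideanSpace ℝ κ => inner ℝ c y := by fun_prop
  have h1 : ∫⁻ y, ENNReal.ofReal (Real.exp (inner ℝ c y)) ∂(stdGaussian (EuclideanSpace ℝ κ)) =
      ∫⁻ x, ENNReal.ofReal (Real.exp (1 * x)) ∂(gaussianReal 0 (‖c‖ ^ 2).toNNReal) := by
    rw [← map_inner_stdGaussian, lintegral_map (by fun_prop) hm]
    simp
  rw [h1, ← ofReal_integral_eq_lintegral_ofReal (integrable_exp_mul_gaussianReal 1)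
    (Filter.Eventually.of_forall fun x => (Real.exp_pos _).le)]
  have h2 := congrFun (mgf_fun_id_gaussianReal (μ := 0) (v := (‖c‖ ^ 2).toNNReal)) 1
  rw [mgf] at h2
  rw [h2]
  simp

lemma lintegral_exp_sum_inner [Fintype ι] (c : ι → EuclideanSpace ℝ κ) :
    ∫⁻ Y, ENNReal.ofReal (Real.exp (∑ i, inner ℝ (c i) (Y i)))
        ∂(Measure.pi fun _ : ι => stdGaussian (EuclideanSpace ℝ κ)) =
      ENNReal.ofReal (Real.exp ((∑ i, ‖c i‖ ^ 2) / 2)) := by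
  simp_rw [Real.exp_sum, ENNReal.ofReal_prod_of_nonneg fun _ _ => (Real.exp_pos _).le]
  rw [lintegral_pi_prod (fun _ : ι => stdGaussian (EuclideanSpace ℝ κ))
    (f := fun i y => ENNReal.ofReal (Real.exp (inner ℝ (c i) y))) fun i => by fun_prop]
  simp_rw [lintegral_exp_inner]
  rw [← ENNReal.ofReal_prod_of_nonneg fun _ _ => (Real.exp_pos _).le, ← Real.exp_sum,
    Finset.sum_div]

lemma stdGaussian_inner_ge_le {c : EuclideanSpace ℝ κ} (hc : ‖c‖ ≤ 1) {t : ℝ} (ht : 0 < t) :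
    stdGaussian (EuclideanSpace ℝ κ) {y | t ≤ inner ℝ c y} ≤
      ENNReal.ofReal (Real.exp (-(t ^ 2 / 2))) := by
  have h := measure_ge_le_of_lintegral_exp_le (μ := stdGaussian (EuclideanSpace ℝ κ))
    (f := fun y => inner ℝ c y) zero_lt_one ht (fun l hl => by
      simp_rw [← real_inner_smul_left]
      rw [lintegral_exp_inner, norm_smul, mul_pow, Real.norm_eq_abs, sq_abs]
      gcongr
      nlinarith [norm_nonneg c]) (by fun_prop)
  simpa using h

lemma pi_stdGaussian_sum_inner_ge_le [Fintype ι] {c : ι → EuclideanSpace ℝ κ}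
    (hc : ∑ i, ‖c i‖ ^ 2 ≤ 1) {t : ℝ} (ht : 0 < t) :
    (Measure.pi fun _ : ι => stdGaussian (EuclideanSpace ℝ κ))
      {Y | t ≤ ∑ i, inner ℝ (c i) (Y i)} ≤ ENNReal.ofReal (Real.exp (-(t ^ 2 / 2))) := by
  have h := measure_ge_le_of_lintegral_exp_le
    (μ := Measure.pi fun _ : ι => stdGaussian (EuclideanSpace ℝ κ))
    (f := fun Y => ∑ i, inner ℝ (c i) (Y i)) zero_lt_one ht (fun l hl => by
      simp_rw [Finset.mul_sum, ← real_inner_smul_left]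
      rw [lintegral_exp_sum_inner]
      simp_rw [norm_smul, mul_pow, Real.norm_eq_abs, sq_abs, ← Finset.mul_sum]
      gcongr) (Finset.aemeasurable_fun_sum _ fun i _ => by
        exact Measurable.aemeasurable (by fun_prop))
  simpa using h

/-- Two-sided exponential moment of a one-dimensional marginal. -/
lemma lintegral_exp_mul_abs_inner_le (c : EuclideanSpace ℝ κ) (b : ℝ) :
    ∫⁻ y, ENNReal.ofReal (Real.exp (b * |inner ℝ c y|)) ∂(stdGaussian (EuclideanSpace ℝ κ)) ≤
      ENNReal.ofReal (2 * Real.exp (b ^ 2 * ‖c‖ ^ 2 / 2)) := by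
  calc _ ≤ ∫⁻ y, (ENNReal.ofReal (Real.exp (inner ℝ (b • c) y)) +
        ENNReal.ofReal (Real.exp (inner ℝ ((-b) • c) y)))
          ∂(stdGaussian (EuclideanSpace ℝ κ)) := by
        refine lintegral_mono fun y => ?_
        simp only [real_inner_smul_left]
        rcases abs_cases (inner ℝ c y) with h | h <;> rw [h.1]
        · exact le_self_add
        · rw [mul_neg, ← neg_mul]; exact le_add_self
    _ = _ := by
        rw [lintegral_add_left (by fun_prop), lintegral_exp_inner, lintegral_exp_inner,
          ← ENNReal.ofReal_add (Real.exp_pos _).le (Real.exp_pos _).le, norm_smul, norm_smul,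
          norm_neg, mul_pow, Real.norm_eq_abs, sq_abs, two_mul]

lemma lintegral_inner_sq (c : EuclideanSpace ℝ κ) :
    ∫⁻ y, ENNReal.ofReal (inner ℝ c y ^ 2) ∂(stdGaussian (EuclideanSpace ℝ κ)) =
      ENNReal.ofReal (‖c‖ ^ 2) := by
  have hm : Measurable fun y : EuclideanSpace ℝ κ => inner ℝ c y := by fun_prop
  have h1 : ∫⁻ y, ENNReal.ofReal (inner ℝ c y ^ 2) ∂(stdGaussian (EuclideanSpace ℝ κ)) =
      ∫⁻ x, ENNReal.ofReal (x ^ 2) ∂(gaussianReal 0 (‖c‖ ^ 2).toNNReal) := by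
    rw [← map_inner_stdGaussian, lintegral_map (by fun_prop) hm]
  have h2 : Integrable (fun x : ℝ => x ^ 2) (gaussianReal 0 (‖c‖ ^ 2).toNNReal) :=
    (memLp_id_gaussianReal' 2 (by simp)).integrable_sq
  have h3 := variance_id_gaussianReal (μ := 0) (v := (‖c‖ ^ 2).toNNReal)
  rw [variance_eq_integral (by fun_prop)] at h3
  simp only [id_eq, integral_id_gaussianReal, sub_zero] at h3
  rw [h1, ← ofReal_integral_eq_lintegral_ofReal h2
    (Filter.Eventually.of_forall fun x => sq_nonneg x), h3]
  simp

/-- Rotation of each pair `(x i, y i)` of a pair of configurations by the angle `φ i`. -/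
noncomputable def rowRotation (φ : ι → ℝ)
    (Z : (ι → EuclideanSpace ℝ κ) × (ι → EuclideanSpace ℝ κ)) :
    (ι → EuclideanSpace ℝ κ) × (ι → EuclideanSpace ℝ κ) :=
  (fun i => Real.cos (φ i) • Z.1 i + Real.sin (φ i) • Z.2 i,
    fun i => -Real.sin (φ i) • Z.1 i + Real.cos (φ i) • Z.2 i)

lemma measurePreserving_rowRotation [Fintype ι] (φ : ι → ℝ) :
    MeasurePreserving (rowRotation (κ := κ) φ)
      ((Measure.pi fun _ : ι => stdGaussian (EuclideanSpace ℝ κ)).prod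
        (Measure.pi fun _ : ι => stdGaussian (EuclideanSpace ℝ κ)))
      ((Measure.pi fun _ : ι => stdGaussian (EuclideanSpace ℝ κ)).prod
        (Measure.pi fun _ : ι => stdGaussian (EuclideanSpace ℝ κ))) := by
  set γ := stdGaussian (EuclideanSpace ℝ κ)
  have h1 := measurePreserving_arrowProdEquivProdArrow (EuclideanSpace ℝ κ) (EuclideanSpace ℝ κ) ι
    (fun _ => γ) (fun _ => γ)
  have h2 : MeasurePreserving
      (fun (a : ι → EuclideanSpace ℝ κ × EuclideanSpace ℝ κ) i =>
        ContinuousLinearMap.rotation (φ i) (a i))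
      (Measure.pi fun _ => γ.prod γ) (Measure.pi fun _ => γ.prod γ) :=
    measurePreserving_pi _ _ fun i =>
      ⟨(ContinuousLinearMap.rotation (φ i)).continuous.measurable,
        IsGaussian.map_rotation_eq_self (by simp [γ]) (φ i)⟩
  exact (h1.comp h2).comp (MeasurePreserving.symm _ h1)

end Gaussian

/-! ### Regular configurations of Gaussian rows -/

section Regular

variable {κ ι : Type*} [Fintype κ]

/-- The normalized inner product `⟨xᵢ, xⱼ⟩ / √n`, where `n` is the dimension of the rows. -/
noncomputable def overlap (X : ι → EuclideanSpace ℝ κ) (i j : ι) : ℝ :=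
  inner ℝ (X i) (X j) / √(Fintype.card κ)

open Classical in
/-- Configurations whose operator norm is of the order `√(n + p)`, and such that for every row `i`
the average over `j ≠ i` of `exp (γ |overlap i j|)` is bounded. The second condition bounds, by
Markov's inequality, the number of large overlaps in every row at all levels simultaneously. -/
def regularSet (κ ι : Type*) [Fintype κ] [Fintype ι] (C₁ C₂ γ : ℝ) :
    Set (ι → EuclideanSpace ℝ κ) :=
  {X | (∀ c : ι → ℝ, ‖∑ j, c j • X j‖ ^ 2 ≤
      C₁ * (Fintype.card κ + Fintype.card ι) * ∑ j, c j ^ 2) ∧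
    ∀ i, ∑ j ∈ Finset.univ.erase i, Real.exp (γ * |overlap X i j|) ≤ C₂ * Fintype.card ι}

lemma continuous_overlap (i j : ι) :
    Continuous fun X : ι → EuclideanSpace ℝ κ => overlap X i j := by
  unfold overlap
  fun_prop

lemma measurableSet_regularSet [Fintype ι] (C₁ C₂ γ : ℝ) :
    MeasurableSet (regularSet κ ι C₁ C₂ γ) := by
  apply IsClosed.measurableSet
  simp only [regularSet, Set.ofPred_and, Set.ofPred_forall]
  refine (isClosed_iInter fun c => isClosed_le (by fun_prop) (by fun_prop)).inter
    (isClosed_iInter fun i => isClosed_le ?_ (by fun_prop))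
  have := continuous_overlap (κ := κ) (ι := ι)
  fun_prop

open Matrix in
/-- The operator norm of `c ↦ ∑ j, c j • X j` is at most four times the supremum of the form
`(u, v) ↦ ∑ j, u j ⟨v, X j⟩` over the nets, a factor two for each of the two vectors. -/
lemma norm_sum_smul_le_of_net [Nonempty κ] [Fintype ι] [Nonempty ι]
    {X : ι → EuclideanSpace ℝ κ} {t : ℝ}
    (h : ∀ u ∈ gridNet ι (Fintype.card ι) ∩ flatBall ι 1,
      ∀ v ∈ gridNet κ (Fintype.card κ) ∩ flatBall κ 1,
        ∑ j, inner ℝ (u j • WithLp.toLp 2 v) (X j) ≤ t) (c : ι → ℝ) :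
    ‖∑ j, c j • X j‖ ^ 2 ≤ 16 * t ^ 2 * ∑ j, c j ^ 2 := by
  have hform : ∀ (u : ι → ℝ) (v : κ → ℝ), u ⬝ᵥ (Matrix.of fun j a => X j a) *ᵥ v =
      ∑ j, inner ℝ (u j • WithLp.toLp 2 v) (X j) := by
    intro u v
    refine Finset.sum_congr rfl fun j _ => ?_
    rw [real_inner_smul_left, PiLp.inner_apply]
    rfl
  have hmain := bilin_le_of_isHalfNet (M := Matrix.of fun j a => X j a) (t := t)
    (isHalfNet_flatBall ι (one_div_sqrt_card_le_one ι))
    (isHalfNet_flatBall κ (one_div_sqrt_card_le_one κ)) (fun u hu => hu.1) (fun u hu => hu.1)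
    fun u hu v hv => by rw [hform]; exact h u hu v hv
  set w := ∑ j, c j • X j with hw
  by_cases hw0 : w = 0
  · rw [hw0, norm_zero, zero_pow two_ne_zero]; positivity
  have hr : 0 < ∑ j, c j ^ 2 := by
    refine (Finset.sum_nonneg fun i _ => sq_nonneg _).lt_of_ne fun h0 => hw0 ?_
    rw [hw]
    refine Finset.sum_eq_zero fun j _ => ?_
    have := (Finset.sum_eq_zero_iff_of_nonneg fun i _ => sq_nonneg (c i)).1 h0.symm j
      (Finset.mem_univ j)
    rw [pow_eq_zero_iff two_ne_zero] at this
    rw [this, zero_smul]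
  set r := √(∑ j, c j ^ 2)
  have hr' : 0 < r := Real.sqrt_pos.2 hr
  have hrsq : r ^ 2 = ∑ j, c j ^ 2 := Real.sq_sqrt hr.le
  have hu : (fun j => c j / r) ∈ flatBall ι 1 := mem_flatBall_one.2 (by
    simp_rw [div_pow]; rw [← Finset.sum_div, hrsq, div_self hr.ne'])
  have hv : (fun a => w a / ‖w‖) ∈ flatBall κ 1 := mem_flatBall_one.2 (by
    simp_rw [div_pow]
    rw [← Finset.sum_div, EuclideanSpace.real_norm_sq_eq, div_self]
    rw [← EuclideanSpace.real_norm_sq_eq]; positivity)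
  have h1 := hmain _ hu _ hv
  have h2 : ∑ j, inner ℝ ((c j / r) • WithLp.toLp 2 fun a => w a / ‖w‖) (X j) = ‖w‖ / r := by
    have hv' : (WithLp.toLp 2 fun a => w a / ‖w‖) = (‖w‖⁻¹ • w : EuclideanSpace ℝ κ) := by
      ext a; simp [div_eq_inv_mul]
    have h3 : ∀ j, inner ℝ ((c j / r) • (‖w‖⁻¹ • w)) (X j) =
        (‖w‖⁻¹ / r) * inner ℝ w (c j • X j) := fun j => by
      rw [real_inner_smul_left, real_inner_smul_left, real_inner_smul_right]; ring
    rw [hv']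
    simp_rw [h3]
    rw [← Finset.mul_sum, ← inner_sum, ← hw, real_inner_self_eq_norm_sq]
    field_simp
  rw [hform, h2, div_le_iff₀ hr'] at h1
  calc ‖w‖ ^ 2 ≤ (4 * t * r) ^ 2 := by gcongr
    _ = 16 * t ^ 2 * r ^ 2 := by ring
    _ = _ := by rw [hrsq]

/-- Union bound over a finite family of at most `c` events. -/
lemma measure_biUnion_ncard_le {Ω α : Type*} [MeasurableSpace Ω] {μ : Measure Ω} {N : Set α}
    (hN : N.Finite) {b c : ℝ} (hb : 0 ≤ b) (hc : (N.ncard : ℝ) ≤ c) {s : α → Set Ω}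
    (h : ∀ a ∈ N, μ (s a) ≤ ENNReal.ofReal b) : μ (⋃ a ∈ N, s a) ≤ ENNReal.ofReal (c * b) := by
  lift N to Finset α using hN
  simp only [Finset.mem_coe, Set.ncard_coe_finset] at *
  refine (measure_biUnion_finset_le N s).trans ((Finset.sum_le_sum h).trans ?_)
  rw [Finset.sum_const, nsmul_eq_mul, ← ENNReal.ofReal_natCast,
    ← ENNReal.ofReal_mul (by positivity)]
  gcongr

/-- The operator norm condition in the definition of `regularSet`. -/
lemma measure_not_opNorm_le [Nonempty κ] [Fintype ι] [Nonempty ι] {q : ℝ} (hq : 0 ≤ q) :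
    (Measure.pi fun _ : ι => stdGaussian (EuclideanSpace ℝ κ))
      {X | ¬ ∀ c : ι → ℝ, ‖∑ j, c j • X j‖ ^ 2 ≤
        32 * (5 + q) * (Fintype.card κ + Fintype.card ι) * ∑ j, c j ^ 2} ≤
      ENNReal.ofReal (Real.exp (-(q * (Fintype.card κ + Fintype.card ι)))) := by
  have hκ : (0 : ℝ) < Fintype.card κ := by exact_mod_cast Fintype.card_pos
  have hι : (0 : ℝ) < Fintype.card ι := by exact_mod_cast Fintype.card_pos
  set T : ℝ := 2 * (5 + q) * (Fintype.card κ + Fintype.card ι) with hT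
  have hT0 : 0 < T := by positivity
  have htsq : √T ^ 2 = T := Real.sq_sqrt hT0.le
  set N := (gridNet ι (Fintype.card ι) ∩ flatBall ι 1)
  set N' := (gridNet κ (Fintype.card κ) ∩ flatBall κ 1)
  have hfin : (gridNet ι (Fintype.card ι)).Finite := (gridNet_finite_and_ncard_le ι hι le_rfl).1
  have hfin' : (gridNet κ (Fintype.card κ)).Finite :=
    (gridNet_finite_and_ncard_le κ hκ le_rfl).1
  have hsub : {X : ι → EuclideanSpace ℝ κ | ¬ ∀ c : ι → ℝ, ‖∑ j, c j • X j‖ ^ 2 ≤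
      32 * (5 + q) * (Fintype.card κ + Fintype.card ι) * ∑ j, c j ^ 2} ⊆
      ⋃ u ∈ N, ⋃ v ∈ N', {X | √T ≤ ∑ j, inner ℝ (u j • WithLp.toLp 2 v) (X j)} := by
    intro X hX
    by_contra hcon
    simp only [Set.mem_iUnion, Set.mem_ofPred_eq, not_exists, not_le] at hcon
    refine hX fun c => ?_
    have := norm_sum_smul_le_of_net (X := X) (fun u hu v hv => (hcon u hu v hv).le) c
    rw [htsq] at this
    calc _ ≤ _ := this
      _ = _ := by rw [hT]; ring
  refine (measure_mono hsub).trans ?_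
  have hsingle : ∀ u ∈ N, ∀ v ∈ N', (Measure.pi fun _ : ι => stdGaussian (EuclideanSpace ℝ κ))
      {X | √T ≤ ∑ j, inner ℝ (u j • WithLp.toLp 2 v) (X j)} ≤
        ENNReal.ofReal (Real.exp (-(T / 2))) := by
    intro u hu v hv
    have h := pi_stdGaussian_sum_inner_ge_le (c := fun j => u j • WithLp.toLp 2 v) ?_
      (Real.sqrt_pos.2 hT0)
    · rwa [htsq] at h
    simp_rw [norm_smul, mul_pow, EuclideanSpace.real_norm_sq_eq, Real.norm_eq_abs, sq_abs]
    rw [← Finset.sum_mul]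
    exact mul_le_one₀ hu.2.1 (Finset.sum_nonneg fun _ _ => sq_nonneg _) hv.2.1
  have hcard : (N.ncard : ℝ) ≤ Real.exp (5 * Fintype.card ι) :=
    le_trans (Nat.cast_le.2 (Set.ncard_le_ncard Set.inter_subset_left hfin))
      (gridNet_card_ncard_le ι)
  have hcard' : (N'.ncard : ℝ) ≤ Real.exp (5 * Fintype.card κ) :=
    le_trans (Nat.cast_le.2 (Set.ncard_le_ncard Set.inter_subset_left hfin'))
      (gridNet_card_ncard_le κ)
  refine (measure_biUnion_ncard_le (hfin.subset Set.inter_subset_left) (by positivity) hcard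
    fun u hu => measure_biUnion_ncard_le (hfin'.subset Set.inter_subset_left)
      (Real.exp_pos _).le hcard' (hsingle u hu)).trans ?_
  rw [← Real.exp_add, ← Real.exp_add]
  refine ENNReal.ofReal_le_ofReal (Real.exp_le_exp.2 (le_of_eq ?_))
  rw [hT]; ring

lemma measure_norm_sq_gt_le [Nonempty κ] {q : ℝ} (hq : 0 ≤ q) :
    stdGaussian (EuclideanSpace ℝ κ) {x | 8 * (5 + q) * Fintype.card κ < ‖x‖ ^ 2} ≤
      ENNReal.ofReal (Real.exp (-(q * Fintype.card κ))) := by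
  have hκ : (0 : ℝ) < Fintype.card κ := by exact_mod_cast Fintype.card_pos
  set T : ℝ := 2 * (5 + q) * Fintype.card κ with hT
  have hT0 : 0 < T := by positivity
  have htsq : √T ^ 2 = T := Real.sq_sqrt hT0.le
  set N' := (gridNet κ (Fintype.card κ) ∩ flatBall κ 1)
  have hfin' : (gridNet κ (Fintype.card κ)).Finite :=
    (gridNet_finite_and_ncard_le κ hκ le_rfl).1
  have hsub : {x : EuclideanSpace ℝ κ | 8 * (5 + q) * Fintype.card κ < ‖x‖ ^ 2} ⊆
      ⋃ v ∈ N', {x | √T ≤ inner ℝ (WithLp.toLp 2 v) x} := by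
    intro x hx
    by_contra hcon
    simp only [Set.mem_iUnion, Set.mem_ofPred_eq, not_exists, not_le] at hcon hx
    have hx0 : 0 < ‖x‖ := by
      refine (norm_nonneg x).lt_of_ne fun h0 => ?_
      rw [← h0] at hx
      have : 0 ≤ 8 * (5 + q) * (Fintype.card κ : ℝ) := by positivity
      linarith
    have hdot : ∀ v : κ → ℝ, v ⬝ᵥ (fun a => x a) = inner ℝ (WithLp.toLp 2 v) x := fun v => by
      rw [PiLp.inner_apply]
      exact Finset.sum_congr rfl fun a _ => mul_comm _ _
    have hnorm : ∑ a, (x a / ‖x‖) ^ 2 = 1 := by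
      simp_rw [div_pow]
      rw [← Finset.sum_div, EuclideanSpace.real_norm_sq_eq, div_self]
      rw [← EuclideanSpace.real_norm_sq_eq]; positivity
    have h1 := dotProduct_le_of_isHalfNet (isHalfNet_flatBall κ (one_div_sqrt_card_le_one κ))
      (fun u hu => hu.1)
      (a := fun a => x a) (t := √T) (fun v hv => by rw [hdot]; exact (hcon v hv).le)
      (fun a => x a / ‖x‖) (mem_flatBall_one.2 hnorm.le)
    have h2 : (WithLp.toLp 2 fun a => x a / ‖x‖) = (‖x‖⁻¹ • x : EuclideanSpace ℝ κ) := by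
      ext a; simp [div_eq_inv_mul]
    rw [hdot, h2, real_inner_smul_left, real_inner_self_eq_norm_sq, pow_two, ← mul_assoc,
      inv_mul_cancel₀ hx0.ne', one_mul] at h1
    have h3 : ‖x‖ ^ 2 ≤ (2 * √T) ^ 2 := by gcongr
    rw [mul_pow, htsq, hT] at h3
    linarith
  refine (measure_mono hsub).trans ?_
  have hcard' : (N'.ncard : ℝ) ≤ Real.exp (5 * Fintype.card κ) :=
    le_trans (Nat.cast_le.2 (Set.ncard_le_ncard Set.inter_subset_left hfin'))
      (gridNet_card_ncard_le κ)
  refine (measure_biUnion_ncard_le (hfin'.subset Set.inter_subset_left) (Real.exp_pos _).le hcard'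
    fun v hv => ?_).trans (b := ENNReal.ofReal (_ * Real.exp (-(T / 2)))) ?_
  · have h := stdGaussian_inner_ge_le (c := WithLp.toLp 2 v) ?_ (Real.sqrt_pos.2 hT0)
    · rwa [htsq] at h
    have : ‖WithLp.toLp 2 v‖ ^ 2 ≤ 1 := by
      rw [EuclideanSpace.real_norm_sq_eq]; exact hv.2.1
    exact (sq_le_one_iff₀ (norm_nonneg _)).1 this
  · rw [← Real.exp_add]
    refine ENNReal.ofReal_le_ofReal (Real.exp_le_exp.2 (le_of_eq ?_))
    rw [hT]; ring

/-- For a fixed vector `y` with `‖y‖² ≤ C₀ n`, the average of `exp (γ |⟨y, xⱼ⟩| / √n)` is at most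
three times a bound for its mean, outside an event of superpolynomially small plus `p ^ (1 - q)`
probability. The summands are truncated at `√p`; the truncated sum obeys a Chernoff bound with
exponent `√p`, and a single summand exceeds `√p` with probability of order `p ^ (-q)`. -/
lemma measure_sum_exp_inner_gt_le [Nonempty κ] [Fintype ι] [Nonempty ι] {C₀ γ q : ℝ}
    (hq : 0 ≤ q) {y : EuclideanSpace ℝ κ} (hy : ‖y‖ ^ 2 ≤ C₀ * Fintype.card κ) :
    (Measure.pi fun _ : ι => stdGaussian (EuclideanSpace ℝ κ))
      {X | 6 * Real.exp (γ ^ 2 * C₀ / 2) * Fintype.card ι <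
        ∑ j, Real.exp (γ * |inner ℝ y (X j) / √(Fintype.card κ)|)} ≤
      ENNReal.ofReal (Real.exp (-√(Fintype.card ι)) +
        Fintype.card ι * (2 * Real.exp (2 * q ^ 2 * γ ^ 2 * C₀) *
          (Fintype.card ι : ℝ) ^ (-q))) := by
  have hκ : (0 : ℝ) < Fintype.card κ := by exact_mod_cast Fintype.card_pos
  have hι : (0 : ℝ) < Fintype.card ι := by exact_mod_cast Fintype.card_pos
  have hC₀ : 0 ≤ C₀ := by
    by_contra hneg
    nlinarith [sq_nonneg ‖y‖]
  set p : ℝ := (Fintype.card ι : ℝ) with hp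
  set B := √p
  have hB0 : 0 < B := Real.sqrt_pos.2 hι
  have hBB : B * B = p := Real.mul_self_sqrt hι.le
  set m : ℝ := 2 * Real.exp (γ ^ 2 * C₀ / 2) with hm
  have hm1 : 1 ≤ m := by
    have : 1 ≤ Real.exp (γ ^ 2 * C₀ / 2) := Real.one_le_exp (by positivity)
    linarith
  set ξ : EuclideanSpace ℝ κ → ℝ := fun x => Real.exp (γ * |inner ℝ y x / √(Fintype.card κ)|)
    with hξ
  have hξm : Measurable ξ := by fun_prop
  -- exponential moments of the overlap with `y`
  have hmom : ∀ b : ℝ, 0 ≤ b → ∫⁻ x, ENNReal.ofReal (Real.exp (b * γ * |inner ℝ y x /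
      √(Fintype.card κ)|)) ∂(stdGaussian (EuclideanSpace ℝ κ)) ≤
      ENNReal.ofReal (2 * Real.exp (b ^ 2 * γ ^ 2 * C₀ / 2)) := by
    intro b hb
    have h := lintegral_exp_mul_abs_inner_le y (b * γ / √(Fintype.card κ))
    have hsq : √(Fintype.card κ : ℝ) ^ 2 = Fintype.card κ := Real.sq_sqrt hκ.le
    calc _ = ∫⁻ x, ENNReal.ofReal (Real.exp (b * γ / √(Fintype.card κ) * |inner ℝ y x|))
          ∂(stdGaussian (EuclideanSpace ℝ κ)) := by
            congr 1; ext x; rw [abs_div, abs_of_nonneg (Real.sqrt_nonneg _)]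
            congr 2; ring
      _ ≤ _ := h
      _ ≤ _ := by
          refine ENNReal.ofReal_le_ofReal (mul_le_mul_of_nonneg_left (Real.exp_le_exp.2 ?_)
            zero_le_two)
          refine div_le_div_of_nonneg_right ?_ zero_le_two
          rw [div_pow, hsq, div_mul_eq_mul_div, div_le_iff₀ hκ, mul_pow]
          calc b ^ 2 * γ ^ 2 * ‖y‖ ^ 2 ≤ b ^ 2 * γ ^ 2 * (C₀ * Fintype.card κ) := by gcongr
            _ = _ := by ring
  set μ := Measure.pi fun _ : ι => stdGaussian (EuclideanSpace ℝ κ) with hμ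
  have hsub : {X : ι → EuclideanSpace ℝ κ | 6 * Real.exp (γ ^ 2 * C₀ / 2) * p <
      ∑ j, ξ (X j)} ⊆ {X | ENNReal.ofReal (Real.exp (3 * m * B)) ≤
        ∏ j, ENNReal.ofReal (Real.exp (min (ξ (X j)) B / B))} ∪
        ⋃ j ∈ Finset.univ, {X | B < ξ (X j)} := by
    intro X hX
    by_cases hex : ∃ j, B < ξ (X j)
    · obtain ⟨j, hj⟩ := hex
      exact Or.inr (Set.mem_biUnion (Finset.mem_univ j) hj)
    · push Not at hex
      left
      have hX' : 6 * Real.exp (γ ^ 2 * C₀ / 2) * p < ∑ j, ξ (X j) := hX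
      rw [Set.mem_ofPred_eq, ← ENNReal.ofReal_prod_of_nonneg fun _ _ => (Real.exp_pos _).le,
        ← Real.exp_sum]
      simp_rw [fun j => min_eq_left (hex j)]
      rw [← Finset.sum_div]
      refine ENNReal.ofReal_le_ofReal (Real.exp_le_exp.2 ?_)
      rw [le_div_iff₀ hB0, mul_assoc, hBB, hm]
      linarith
  have h1 : μ {X | ENNReal.ofReal (Real.exp (3 * m * B)) ≤
      ∏ j, ENNReal.ofReal (Real.exp (min (ξ (X j)) B / B))} ≤ ENNReal.ofReal (Real.exp (-B)) := by
    have hone : ∫⁻ x, ENNReal.ofReal (Real.exp (min (ξ x) B / B))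
        ∂(stdGaussian (EuclideanSpace ℝ κ)) ≤ ENNReal.ofReal (Real.exp (2 * m / B)) := by
      calc _ ≤ ∫⁻ x, (1 + ENNReal.ofReal (2 / B) * ENNReal.ofReal (Real.exp (1 * γ *
              |inner ℝ y x / √(Fintype.card κ)|))) ∂(stdGaussian (EuclideanSpace ℝ κ)) := by
            refine lintegral_mono fun x => ?_
            rw [← ENNReal.ofReal_mul (by positivity), ← ENNReal.ofReal_one,
              ← ENNReal.ofReal_add zero_le_one (by positivity), one_mul]
            refine ENNReal.ofReal_le_ofReal ?_
            have hx0 : 0 ≤ min (ξ x) B / B := by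
              have : 0 < ξ x := Real.exp_pos _
              positivity
            have hx1 : min (ξ x) B / B ≤ 1 := (div_le_one hB0).2 (min_le_right _ _)
            have hexp : Real.exp (min (ξ x) B / B) ≤ 1 + 2 * (min (ξ x) B / B) := by
              have := Real.abs_exp_sub_one_le (x := min (ξ x) B / B) (by rwa [abs_of_nonneg hx0])
              rw [abs_of_nonneg hx0] at this
              linarith [le_abs_self (Real.exp (min (ξ x) B / B) - 1)]
            refine hexp.trans ?_
            have : min (ξ x) B / B ≤ ξ x / B := by gcongr; exact min_le_left _ _
            calc _ ≤ 1 + 2 * (ξ x / B) := by linarith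
              _ = _ := by ring
        _ ≤ 1 + ENNReal.ofReal (2 / B) * ENNReal.ofReal m := by
            rw [lintegral_add_left measurable_const, lintegral_const_mul _ (by fun_prop)]
            simp only [lintegral_const, measure_univ, mul_one]
            gcongr
            simpa [hm] using hmom 1 zero_le_one
        _ ≤ _ := by
            rw [← ENNReal.ofReal_mul (by positivity), ← ENNReal.ofReal_one,
              ← ENNReal.ofReal_add zero_le_one (by positivity)]
            refine ENNReal.ofReal_le_ofReal ?_
            have := Real.add_one_le_exp (2 * m / B)
            calc _ = 2 * m / B + 1 := by ring
              _ ≤ _ := this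
    have hprod : ∫⁻ X, ∏ j, ENNReal.ofReal (Real.exp (min (ξ (X j)) B / B)) ∂μ ≤
        ENNReal.ofReal (Real.exp (2 * m * B)) := by
      rw [hμ, lintegral_pi_prod (fun _ : ι => stdGaussian (EuclideanSpace ℝ κ))
        (f := fun _ x => ENNReal.ofReal (Real.exp (min (ξ x) B / B))) fun _ => by fun_prop]
      refine (Finset.prod_le_prod' fun _ _ => hone).trans ?_
      rw [← ENNReal.ofReal_prod_of_nonneg fun _ _ => (Real.exp_pos _).le, ← Real.exp_sum]
      refine ENNReal.ofReal_le_ofReal (Real.exp_le_exp.2 (le_of_eq ?_))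
      rw [Finset.sum_const, Finset.card_univ, nsmul_eq_mul, ← hp, ← hBB]
      field_simp
    have hmk := mul_meas_ge_le_lintegral₀ (μ := μ)
      (f := fun X => ∏ j, ENNReal.ofReal (Real.exp (min (ξ (X j)) B / B)))
      (Finset.measurable_fun_prod _ fun j _ => by
        have := hξm.comp (measurable_pi_apply (X := fun _ : ι => EuclideanSpace ℝ κ) j)
        exact ((Real.measurable_exp.comp ((this.min measurable_const).div_const _))
          ).ennreal_ofReal).aemeasurable (ENNReal.ofReal (Real.exp (3 * m * B)))
    have h3 : ∀ a : ENNReal, ENNReal.ofReal (Real.exp (-(3 * m * B))) *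
        (ENNReal.ofReal (Real.exp (3 * m * B)) * a) = a := fun a => by
      rw [← mul_assoc, ← ENNReal.ofReal_mul (Real.exp_pos _).le, ← Real.exp_add]
      simp
    rw [← h3 (μ _)]
    refine (mul_le_mul_right (hmk.trans hprod) _).trans ?_
    rw [← ENNReal.ofReal_mul (Real.exp_pos _).le, ← Real.exp_add]
    refine ENNReal.ofReal_le_ofReal (Real.exp_le_exp.2 ?_)
    nlinarith
  have h2 : ∀ j, μ {X | B < ξ (X j)} ≤
      ENNReal.ofReal (2 * Real.exp (2 * q ^ 2 * γ ^ 2 * C₀) * p ^ (-q)) := by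
    intro j
    have hmp : μ {X | B < ξ (X j)} = stdGaussian (EuclideanSpace ℝ κ) {x | B < ξ x} :=
      (measurePreserving_eval (fun _ : ι => stdGaussian (EuclideanSpace ℝ κ)) j).measure_preimage
        (measurableSet_lt measurable_const hξm).nullMeasurableSet
    have hincl : {x | B < ξ x} ⊆ {x | ENNReal.ofReal (p ^ q) ≤
        ENNReal.ofReal (Real.exp (2 * q * γ * |inner ℝ y x / √(Fintype.card κ)|))} := by
      intro x hx
      have hx' : B < ξ x := hx
      refine ENNReal.ofReal_le_ofReal ?_
      have hpow : (B ^ (2 * q) : ℝ) = p ^ q := by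
        rw [Real.rpow_mul hB0.le, Real.rpow_two, pow_two, hBB]
      calc p ^ q = B ^ (2 * q) := hpow.symm
        _ ≤ ξ x ^ (2 * q) := by gcongr
        _ = _ := by rw [hξ, ← Real.exp_mul]; congr 1; ring
    have hmk := mul_meas_ge_le_lintegral₀ (μ := stdGaussian (EuclideanSpace ℝ κ))
      (f := fun x => ENNReal.ofReal (Real.exp (2 * q * γ * |inner ℝ y x / √(Fintype.card κ)|)))
      (by fun_prop) (ENNReal.ofReal (p ^ q))
    have h3 : ∀ a : ENNReal, ENNReal.ofReal (p ^ (-q)) * (ENNReal.ofReal (p ^ q) * a) = a :=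
      fun a => by
        rw [← mul_assoc, ← ENNReal.ofReal_mul (by positivity), ← Real.rpow_add hι]
        simp
    rw [hmp]
    refine (measure_mono hincl).trans ?_
    rw [← h3 (stdGaussian (EuclideanSpace ℝ κ) _)]
    refine (mul_le_mul_right (hmk.trans (hmom (2 * q) (by positivity))) _).trans ?_
    rw [← ENNReal.ofReal_mul (by positivity)]
    refine ENNReal.ofReal_le_ofReal (le_of_eq ?_)
    rw [mul_comm]
    congr 3
    ring
  refine (measure_mono hsub).trans ((measure_union_le _ _).trans ?_)
  rw [ENNReal.ofReal_add (Real.exp_pos _).le (by positivity)]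
  refine add_le_add h1 ((measure_biUnion_finset_le _ _).trans
    ((Finset.sum_le_sum fun j _ => h2 j).trans ?_))
  rw [Finset.sum_const, Finset.card_univ, nsmul_eq_mul, ← ENNReal.ofReal_natCast,
    ← ENNReal.ofReal_mul (by positivity)]

/-- The row condition in the definition of `regularSet`. Replacing row `i` by an independent copy,
which is the rotation of that row by `π / 2`, makes the row independent of all the others. -/
lemma measure_row_not_regular_le [Nonempty κ] [Fintype ι] [DecidableEq ι] [Nonempty ι] {γ q : ℝ}
    (hq : 0 ≤ q) (i : ι) :
    (Measure.pi fun _ : ι => stdGaussian (EuclideanSpace ℝ κ))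
      {X | 6 * Real.exp (γ ^ 2 * (8 * (5 + q)) / 2) * Fintype.card ι <
        ∑ j ∈ Finset.univ.erase i, Real.exp (γ * |overlap X i j|)} ≤
      ENNReal.ofReal (Real.exp (-(q * Fintype.card κ)) + (Real.exp (-√(Fintype.card ι)) +
        Fintype.card ι * (2 * Real.exp (2 * q ^ 2 * γ ^ 2 * (8 * (5 + q))) *
          (Fintype.card ι : ℝ) ^ (-q)))) := by
  set γ' := stdGaussian (EuclideanSpace ℝ κ)
  set μ := Measure.pi fun _ : ι => γ'
  set a : ℝ := 6 * Real.exp (γ ^ 2 * (8 * (5 + q)) / 2) * Fintype.card ι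
  set S : Set (ι → EuclideanSpace ℝ κ) :=
    {X | a < ∑ j ∈ Finset.univ.erase i, Real.exp (γ * |overlap X i j|)}
  have hSm : MeasurableSet S := by
    have := fun j => (continuous_overlap (κ := κ) (ι := ι) i j).measurable
    exact measurableSet_lt measurable_const (by fun_prop)
  set φ : ι → ℝ := Pi.single i (Real.pi / 2) with hφ
  have hmp : MeasurePreserving (fun Z => (rowRotation (κ := κ) φ Z).1) (μ.prod μ) μ :=
    measurePreserving_fst.comp (measurePreserving_rowRotation φ)
  set S₁ : Set ((ι → EuclideanSpace ℝ κ) × (ι → EuclideanSpace ℝ κ)) :=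
    {Z | 8 * (5 + q) * Fintype.card κ < ‖Z.2 i‖ ^ 2}
  set S₂ : Set ((ι → EuclideanSpace ℝ κ) × (ι → EuclideanSpace ℝ κ)) :=
    {Z | ‖Z.2 i‖ ^ 2 ≤ 8 * (5 + q) * Fintype.card κ ∧
      a < ∑ j, Real.exp (γ * |inner ℝ (Z.2 i) (Z.1 j) / √(Fintype.card κ)|)}
  have hsub : (fun Z => (rowRotation (κ := κ) φ Z).1) ⁻¹' S ⊆ S₁ ∪ S₂ := by
    intro Z hZ
    by_cases h : 8 * (5 + q) * Fintype.card κ < ‖Z.2 i‖ ^ 2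
    · exact Or.inl h
    · refine Or.inr ⟨not_lt.1 h, lt_of_lt_of_le hZ ?_⟩
      refine (le_of_eq ?_).trans (Finset.sum_le_sum_of_subset_of_nonneg
        (Finset.erase_subset i _) fun _ _ _ => (Real.exp_pos _).le)
      refine Finset.sum_congr rfl fun j hj => ?_
      have hji : j ≠ i := Finset.ne_of_mem_erase hj
      simp [overlap, rowRotation, hφ, hji]
  rw [← hmp.measure_preimage hSm.nullMeasurableSet,
    ENNReal.ofReal_add (Real.exp_pos _).le (by positivity)]
  refine (measure_mono hsub).trans ((measure_union_le _ _).trans (add_le_add ?_ ?_))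
  · have hmp2 : MeasurePreserving (fun Z : (ι → EuclideanSpace ℝ κ) × (ι → EuclideanSpace ℝ κ) =>
        Z.2 i) (μ.prod μ) γ' :=
      (measurePreserving_eval (fun _ : ι => γ') i).comp measurePreserving_snd
    have := hmp2.measure_preimage (s := {x | 8 * (5 + q) * Fintype.card κ < ‖x‖ ^ 2})
      (measurableSet_lt measurable_const (by fun_prop)).nullMeasurableSet
    exact (le_of_eq this).trans (measure_norm_sq_gt_le hq)
  · have hS₂m : MeasurableSet S₂ := by
      have h1 : Continuous fun Z : (ι → EuclideanSpace ℝ κ) × (ι → EuclideanSpace ℝ κ) =>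
          ‖Z.2 i‖ ^ 2 := by fun_prop
      have h2 : Continuous fun Z : (ι → EuclideanSpace ℝ κ) × (ι → EuclideanSpace ℝ κ) =>
          ∑ j, Real.exp (γ * |inner ℝ (Z.2 i) (Z.1 j) / √(Fintype.card κ)|) := by fun_prop
      exact (measurableSet_le h1.measurable measurable_const).inter
        (measurableSet_lt measurable_const h2.measurable)
    rw [Measure.prod_apply_symm hS₂m]
    refine (lintegral_mono (g := fun _ => _) fun Y => ?_).trans
      (b := ∫⁻ _, ENNReal.ofReal (Real.exp (-√(Fintype.card ι)) +
        Fintype.card ι * (2 * Real.exp (2 * q ^ 2 * γ ^ 2 * (8 * (5 + q))) *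
          (Fintype.card ι : ℝ) ^ (-q))) ∂μ) (by simp)
    by_cases hY : ‖Y i‖ ^ 2 ≤ 8 * (5 + q) * Fintype.card κ
    · refine (measure_mono fun X hX => ?_).trans (measure_sum_exp_inner_gt_le hq hY)
      exact hX.2
    · refine (measure_mono (t := ∅) fun X hX => hY hX.1).trans (by simp)

lemma measure_compl_regularSet_le [Nonempty κ] [Fintype ι] [Nonempty ι] {γ q : ℝ}
    (hq : 0 ≤ q) :
    (Measure.pi fun _ : ι => stdGaussian (EuclideanSpace ℝ κ))
      (regularSet κ ι (32 * (5 + q)) (6 * Real.exp (γ ^ 2 * (8 * (5 + q)) / 2)) γ)ᶜ ≤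
      ENNReal.ofReal (Real.exp (-(q * (Fintype.card κ + Fintype.card ι))) + Fintype.card ι *
        (Real.exp (-(q * Fintype.card κ)) + (Real.exp (-√(Fintype.card ι)) +
        Fintype.card ι * (2 * Real.exp (2 * q ^ 2 * γ ^ 2 * (8 * (5 + q))) *
          (Fintype.card ι : ℝ) ^ (-q))))) := by
  classical
  set b : ℝ := Real.exp (-(q * Fintype.card κ)) + (Real.exp (-√(Fintype.card ι)) +
        Fintype.card ι * (2 * Real.exp (2 * q ^ 2 * γ ^ 2 * (8 * (5 + q))) *
          (Fintype.card ι : ℝ) ^ (-q)))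
  have hsub : (regularSet κ ι (32 * (5 + q)) (6 * Real.exp (γ ^ 2 * (8 * (5 + q)) / 2)) γ)ᶜ ⊆
      {X | ¬ ∀ c : ι → ℝ, ‖∑ j, c j • X j‖ ^ 2 ≤
        32 * (5 + q) * (Fintype.card κ + Fintype.card ι) * ∑ j, c j ^ 2} ∪
      ⋃ i ∈ Finset.univ, {X | 6 * Real.exp (γ ^ 2 * (8 * (5 + q)) / 2) * Fintype.card ι <
        ∑ j ∈ Finset.univ.erase i, Real.exp (γ * |overlap X i j|)} := by
    intro X hX
    by_contra hcon
    simp only [Set.mem_union, Set.mem_iUnion, Set.mem_ofPred_eq, not_or, not_exists, not_not,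
      not_lt, Finset.mem_univ, forall_true_left] at hcon
    refine hX ⟨hcon.1, fun i => ?_⟩
    convert hcon.2 i
  refine (measure_mono hsub).trans ((measure_union_le _ _).trans ?_)
  rw [ENNReal.ofReal_add (Real.exp_pos _).le (by positivity)]
  refine add_le_add (measure_not_opNorm_le hq) ((measure_biUnion_finset_le _ _).trans
    ((Finset.sum_le_sum fun i _ => measure_row_not_regular_le hq i).trans ?_))
  rw [Finset.sum_const, Finset.card_univ, nsmul_eq_mul, ← ENNReal.ofReal_natCast,
    ← ENNReal.ofReal_mul (by positivity)]

end Regular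

/-! ### Odd absolutely continuous functions along half rotations -/

/-- A version of the derivative of an odd function that is even and satisfies its almost everywhere
bound everywhere. -/
lemma exists_even_density {k : ℝ → ℝ} {A β : ℝ} (hA : 0 ≤ A) (hodd : Function.Odd k)
    (hac : LocallyAbsolutelyContinuous k)
    (hk : ∀ᵐ x : ℝ, DifferentiableAt ℝ k x ∧ |deriv k x| ≤ A * Real.exp (β * |x|)) :
    ∃ h : ℝ → ℝ, Measurable h ∧ (∀ x, h (-x) = h x) ∧ (∀ x, |h x| ≤ A * Real.exp (β * |x|)) ∧
      ∀ x, ∫ t in (0 : ℝ)..x, h t = k x := by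
  classical
  have heven : ∀ x, deriv k (-x) = deriv k x := fun x => by
    have h1 : (fun x => k (-x)) = fun x => -k x := funext hodd
    have h2 := deriv_comp_neg k x
    rw [h1, deriv.fun_neg] at h2
    linarith
  refine ⟨fun x => if |deriv k x| ≤ A * Real.exp (β * |x|) then deriv k x else 0, ?_, ?_, ?_, ?_⟩
  · have h1 : Measurable fun x => |deriv k x| := (measurable_deriv k).abs
    exact Measurable.ite (measurableSet_le h1 (by fun_prop)) (measurable_deriv k) measurable_const
  · intro x
    simp only [heven, abs_neg]
  · intro x
    dsimp only
    split_ifs with h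
    · exact h
    · simp only [abs_zero]; positivity
  · intro x
    have h0 : k 0 = 0 := by have := hodd 0; rw [neg_zero] at this; linarith
    have h1 := (hac 0 x).integral_deriv_eq_sub
    rw [h0, sub_zero] at h1
    rw [← h1]
    refine intervalIntegral.integral_congr_ae ?_
    filter_upwards [hk] with y hy _
    rw [if_pos hy.2]

lemma intervalIntegrable_of_abs_le {h : ℝ → ℝ} (hm : Measurable h) {M : ℝ}
    (hM : ∀ x, |h x| ≤ M) (a b : ℝ) : IntervalIntegrable h volume a b := by
  rw [intervalIntegrable_iff]
  exact Measure.integrableOn_of_bounded (M := M) (by simp) hm.aestronglyMeasurable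
    (Filter.Eventually.of_forall hM)

/-- Change of variables on an interval where the inner function is monotone; the outer function is
merely measurable. -/
lemma integral_comp_mul_deriv_of_sign {h g g' : ℝ → ℝ} {c d : ℝ} (hcd : c ≤ d)
    (hg : ∀ x, HasDerivAt g (g' x) x)
    (hs : (∀ x ∈ Set.Ioo c d, 0 ≤ g' x) ∨ ∀ x ∈ Set.Ioo c d, g' x ≤ 0) :
    ∫ x in c..d, h (g x) * g' x = ∫ t in g c..g d, h t := by
  have hcont : Continuous g := continuous_iff_continuousAt.2 fun x => (hg x).continuousAt
  have hdiff : Differentiable ℝ g := fun x => (hg x).differentiableAt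
  have hcomm : ∀ x, h (g x) * g' x = g' x • h (g x) := fun x => mul_comm _ _
  simp_rw [hcomm]
  rw [intervalIntegral.integral_of_le hcd, ← integral_Icc_eq_integral_Ioc]
  rcases hs with hs | hs
  · have hle : g c ≤ g d := by
      refine monotoneOn_of_deriv_nonneg (convex_Icc c d) hcont.continuousOn
        hdiff.differentiableOn (fun x hx => ?_) (Set.left_mem_Icc.2 hcd) (Set.right_mem_Icc.2 hcd)
        hcd
      rw [(hg x).deriv]
      exact hs x (by rwa [interior_Icc] at hx)
    rw [integral_Icc_deriv_smul_of_deriv_nonneg hcont.continuousOn (fun x _ => hg x) hs hcd,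
      intervalIntegral.integral_of_le hle, ← integral_Icc_eq_integral_Ioc]
  · have hle : g d ≤ g c := by
      refine antitoneOn_of_deriv_nonpos (convex_Icc c d) hcont.continuousOn
        hdiff.differentiableOn (fun x hx => ?_) (Set.left_mem_Icc.2 hcd) (Set.right_mem_Icc.2 hcd)
        hcd
      rw [(hg x).deriv]
      exact hs x (by rwa [interior_Icc] at hx)
    rw [integral_Icc_deriv_smul_of_deriv_nonpos hcont.continuousOn (fun x _ => hg x) hs hcd,
      intervalIntegral.integral_of_ge hle, ← integral_Icc_eq_integral_Ioc]

/-- Along the half circle `θ ↦ a cos θ + b sin θ` from `a` to `-a`, an odd primitive `H` of `h`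
changes by `-2 H a`, whatever the value of `b`. -/
lemma integral_half_rotation {h : ℝ → ℝ} (hm : Measurable h) {M : ℝ} (hM : ∀ x, |h x| ≤ M)
    (heven : ∀ x, h (-x) = h x) (a b : ℝ) :
    ∫ θ in (0 : ℝ)..Real.pi, h (Real.cos θ * a + Real.sin θ * b) *
      (-Real.sin θ * a + Real.cos θ * b) = -2 * ∫ t in (0 : ℝ)..a, h t := by
  set g : ℝ → ℝ := fun θ => Real.cos θ * a + Real.sin θ * b with hg
  set g' : ℝ → ℝ := fun θ => -Real.sin θ * a + Real.cos θ * b with hg'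
  have hgd : ∀ θ, HasDerivAt g (g' θ) θ := fun θ =>
    ((Real.hasDerivAt_cos θ).mul_const a).add ((Real.hasDerivAt_sin θ).mul_const b)
  have hg0 : g 0 = a := by simp [hg]
  have hgπ : g Real.pi = -a := by simp [hg]
  have hII := intervalIntegrable_of_abs_le hm hM
  -- the angle at which `g` stops being monotone
  obtain ⟨c, hc0, hcπ, hs⟩ : ∃ c, 0 ≤ c ∧ c ≤ Real.pi ∧
      (((∀ x ∈ Set.Ioo 0 c, 0 ≤ g' x) ∧ ∀ x ∈ Set.Ioo c Real.pi, g' x ≤ 0) ∨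
        ((∀ x ∈ Set.Ioo 0 c, g' x ≤ 0) ∧ ∀ x ∈ Set.Ioo c Real.pi, 0 ≤ g' x)) := by
    set z : ℂ := ⟨a, b⟩
    have ha : a = ‖z‖ * Real.cos z.arg := by rw [Complex.norm_mul_cos_arg]
    have hb : b = ‖z‖ * Real.sin z.arg := by rw [Complex.norm_mul_sin_arg]
    have hform : ∀ θ, g' θ = -(‖z‖ * Real.sin (θ - z.arg)) := fun θ => by
      rw [hg', Real.sin_sub]
      dsimp only
      linear_combination -Real.sin θ * ha + Real.cos θ * hb
    have h1 := Complex.neg_pi_lt_arg z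
    have h2 := Complex.arg_le_pi z
    rcases le_or_gt 0 z.arg with h | h
    · refine ⟨z.arg, h, h2, Or.inl ⟨fun x hx => ?_, fun x hx => ?_⟩⟩
      · have := Real.sin_nonpos_of_nonpos_of_neg_pi_le (x := x - z.arg) (by linarith [hx.2])
          (by linarith [hx.1])
        rw [hform]
        nlinarith [norm_nonneg z]
      · have := Real.sin_nonneg_of_nonneg_of_le_pi (x := x - z.arg) (by linarith [hx.1])
          (by linarith [hx.2])
        rw [hform]
        nlinarith [norm_nonneg z]
    · refine ⟨z.arg + Real.pi, by linarith, by linarith, Or.inr ⟨fun x hx => ?_, fun x hx => ?_⟩⟩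
      · have := Real.sin_nonneg_of_nonneg_of_le_pi (x := x - z.arg) (by linarith [hx.1])
          (by linarith [hx.2])
        rw [hform]
        nlinarith [norm_nonneg z]
      · have := Real.sin_nonneg_of_nonneg_of_le_pi (x := x - z.arg - Real.pi) (by linarith [hx.1])
          (by linarith [hx.2])
        rw [Real.sin_sub_pi] at this
        rw [hform]
        nlinarith [norm_nonneg z]
  have hint : ∀ u v : ℝ, IntervalIntegrable (fun θ => h (g θ) * g' θ) volume u v := fun u v => by
    have hgc : Continuous g := by fun_prop
    have hgc' : Continuous g' := by fun_prop
    refine intervalIntegrable_of_abs_le (M := M * (|a| + |b|))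
      ((hm.comp hgc.measurable).mul hgc'.measurable) (fun θ => ?_) u v
    have hM0 : 0 ≤ M := (abs_nonneg _).trans (hM 0)
    rw [Pi.mul_apply, abs_mul]
    refine mul_le_mul (hM _) ((abs_add_le _ _).trans ?_) (abs_nonneg _) hM0
    rw [abs_mul, abs_mul, abs_neg]
    have h1 := Real.abs_sin_le_one θ
    have h2 := Real.abs_cos_le_one θ
    nlinarith [abs_nonneg a, abs_nonneg b]
  have hsum : ∫ θ in (0 : ℝ)..Real.pi, h (g θ) * g' θ = ∫ t in a..(-a), h t := by
    rw [← intervalIntegral.integral_add_adjacent_intervals (hint 0 c) (hint c Real.pi),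
      integral_comp_mul_deriv_of_sign hc0 hgd (hs.imp (fun h => h.1) fun h => h.1),
      integral_comp_mul_deriv_of_sign hcπ hgd (hs.symm.imp (fun h => h.2) fun h => h.2),
      intervalIntegral.integral_add_adjacent_intervals (hII _ _) (hII _ _), hg0, hgπ]
  have hodd : ∫ t in (0 : ℝ)..(-a), h t = -∫ t in (0 : ℝ)..a, h t := by
    have := intervalIntegral.integral_comp_neg (a := 0) (b := a) h
    rw [neg_zero] at this
    simp_rw [heven] at this
    rw [this, intervalIntegral.integral_symm]
  rw [hsum, ← intervalIntegral.integral_add_adjacent_intervals (hII a 0) (hII 0 (-a)), hodd,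
    intervalIntegral.integral_symm]
  ring

/-! ### Averages over random half rotations -/

section HalfTurn

/-- The fair coin. -/
noncomputable def coinMeasure : Measure Bool :=
  ENNReal.ofReal (1 / 2) • (Measure.dirac true + Measure.dirac false)

instance : IsProbabilityMeasure coinMeasure := ⟨by
  simp only [coinMeasure, Measure.smul_apply, Measure.add_apply, measure_univ, smul_eq_mul,
    one_add_one_eq_two]
  rw [← ENNReal.ofReal_ofNat, ← ENNReal.ofReal_mul (by norm_num)]
  norm_num⟩

lemma integral_coinMeasure (f : Bool → ℝ) : ∫ b, f b ∂coinMeasure = (f true + f false) / 2 := by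
  rw [coinMeasure, integral_smul_measure, integral_add_measure .of_finite .of_finite,
    integral_dirac, integral_dirac, ENNReal.toReal_ofReal (by norm_num), smul_eq_mul]
  ring

/-- The uniform law on the angles of a half turn. -/
noncomputable def angleMeasure : Measure ℝ :=
  ENNReal.ofReal Real.pi⁻¹ • volume.restrict (Set.Ioc 0 Real.pi)

instance : IsProbabilityMeasure angleMeasure := ⟨by
  simp only [angleMeasure, Measure.smul_apply, Measure.restrict_apply MeasurableSet.univ,
    Set.univ_inter, Real.volume_Ioc, sub_zero, smul_eq_mul]
  rw [← ENNReal.ofReal_mul (by positivity), inv_mul_cancel₀ Real.pi_ne_zero, ENNReal.ofReal_one]⟩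

lemma integral_angleMeasure (f : ℝ → ℝ) :
    ∫ θ, f θ ∂angleMeasure = Real.pi⁻¹ * ∫ θ in (0 : ℝ)..Real.pi, f θ := by
  rw [angleMeasure, integral_smul_measure, ENNReal.toReal_ofReal (by positivity), smul_eq_mul,
    intervalIntegral.integral_of_le Real.pi_nonneg]

/-- A random subset of `ι` (the indices with value `true`) and an independent uniform angle. -/
noncomputable def halfTurnMeasure (ι : Type*) [Fintype ι] : Measure ((ι → Bool) × ℝ) :=
  (Measure.pi fun _ : ι => coinMeasure).prod angleMeasure

instance (ι : Type*) [Fintype ι] : IsProbabilityMeasure (halfTurnMeasure ι) := by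
  unfold halfTurnMeasure; infer_instance

instance (ι : Type*) [Fintype ι] : SFinite (halfTurnMeasure ι) :=
  have : SigmaFinite (halfTurnMeasure ι) := inferInstance
  instSFiniteOfSigmaFinite

/-- Two distinct indices are separated in a prescribed order with probability `1 / 4`. -/
lemma integral_separated {ι : Type*} [Fintype ι] {i j : ι} (hij : i ≠ j) :
    ∫ w : ι → Bool, (if w i = true ∧ w j = false then (1 : ℝ) else 0)
      ∂(Measure.pi fun _ : ι => coinMeasure) = 1 / 4 := by
  classical
  set f : ι → Bool → ℝ := fun k b =>
    if k = i then (if b = true then 1 else 0) else if k = j then (if b = false then 1 else 0) else 1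
    with hf
  have h1 : ∀ w : ι → Bool, (if w i = true ∧ w j = false then (1 : ℝ) else 0) =
      ∏ k, f k (w k) := by
    intro w
    rw [Fintype.prod_eq_mul i j hij fun k hk => by simp [hf, hk.1, hk.2]]
    simp only [hf, if_true, if_neg hij.symm]
    by_cases h1 : w i = true <;> by_cases h2 : w j = false <;> simp [h1, h2]
  simp_rw [h1]
  rw [integral_fintype_prod_eq_prod]
  simp only [integral_coinMeasure]
  rw [Fintype.prod_eq_mul i j hij fun k hk => by simp [hf, hk.1, hk.2]]
  simp [hf, hij.symm]
  norm_num

variable {κ ι : Type*} [Fintype κ]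

/-- Rotate the rows in the chosen subset by the chosen angle, and leave the others in place. -/
noncomputable def halfTurn (s : (ι → Bool) × ℝ)
    (Z : (ι → EuclideanSpace ℝ κ) × (ι → EuclideanSpace ℝ κ)) :
    (ι → EuclideanSpace ℝ κ) × (ι → EuclideanSpace ℝ κ) :=
  rowRotation (fun i => if s.1 i = true then s.2 else 0) Z

/-- The bilinear term `a(x)ᵢⱼ ⟨yᵢ, xⱼ⟩`, restricted to the pairs separated by the subset `w`. With
`a(x)ᵢⱼ = h (overlap x i j)` it is, up to a factor, the derivative of a function of the overlap of
`xᵢ` and `xⱼ` when the rows in `w` rotate with velocity `y`. -/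
noncomputable def crossTerm (a : (ι → EuclideanSpace ℝ κ) → ι → ι → ℝ) (w : ι → Bool)
    (Z : (ι → EuclideanSpace ℝ κ) × (ι → EuclideanSpace ℝ κ)) (i j : ι) : ℝ :=
  if w i = true ∧ w j = false then a Z.1 i j * inner ℝ (Z.2 i) (Z.1 j) else 0

/-- The mean of `crossTerm` along a random half turn of `Z`. -/
noncomputable def halfTurnMean [Fintype ι] (a : (ι → EuclideanSpace ℝ κ) → ι → ι → ℝ)
    (Z : (ι → EuclideanSpace ℝ κ) × (ι → EuclideanSpace ℝ κ)) (i j : ι) : ℝ :=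
  ∫ s, crossTerm a s.1 (halfTurn s Z) i j ∂(halfTurnMeasure ι)

lemma measurable_halfTurn [Fintype ι] :
    Measurable fun q : ((ι → Bool) × ℝ) × ((ι → EuclideanSpace ℝ κ) × (ι → EuclideanSpace ℝ κ)) =>
      halfTurn q.1 q.2 := by
  have hφ : ∀ i, Measurable fun q : ((ι → Bool) × ℝ) ×
      ((ι → EuclideanSpace ℝ κ) × (ι → EuclideanSpace ℝ κ)) =>
      if q.1.1 i = true then q.1.2 else 0 := fun i => by
    have : Measurable fun q : ((ι → Bool) × ℝ) ×
      ((ι → EuclideanSpace ℝ κ) × (ι → EuclideanSpace ℝ κ)) => q.1.1 i := by fun_prop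
    exact Measurable.ite (this (measurableSet_singleton true)) (by fun_prop) measurable_const
  have hx : ∀ i, Measurable fun q : ((ι → Bool) × ℝ) ×
      ((ι → EuclideanSpace ℝ κ) × (ι → EuclideanSpace ℝ κ)) => q.2.1 i := fun i => by fun_prop
  have hy : ∀ i, Measurable fun q : ((ι → Bool) × ℝ) ×
      ((ι → EuclideanSpace ℝ κ) × (ι → EuclideanSpace ℝ κ)) => q.2.2 i := fun i => by fun_prop
  refine Measurable.prodMk (measurable_pi_lambda _ fun i => ?_)
    (measurable_pi_lambda _ fun i => ?_)
  · exact ((hφ i).cos.smul (hx i)).add ((hφ i).sin.smul (hy i))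
  · exact ((hφ i).sin.neg.smul (hx i)).add ((hφ i).cos.smul (hy i))

lemma measurePreserving_halfTurn [Fintype ι] (s : (ι → Bool) × ℝ) :
    MeasurePreserving (halfTurn (κ := κ) s)
      ((Measure.pi fun _ : ι => stdGaussian (EuclideanSpace ℝ κ)).prod
        (Measure.pi fun _ : ι => stdGaussian (EuclideanSpace ℝ κ)))
      ((Measure.pi fun _ : ι => stdGaussian (EuclideanSpace ℝ κ)).prod
        (Measure.pi fun _ : ι => stdGaussian (EuclideanSpace ℝ κ))) :=
  measurePreserving_rowRotation _

lemma measurable_crossTerm [Fintype ι] {a : (ι → EuclideanSpace ℝ κ) → ι → ι → ℝ}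
    (ha : ∀ i j, Measurable fun X => a X i j) (i j : ι) :
    Measurable fun q : (ι → Bool) × ((ι → EuclideanSpace ℝ κ) × (ι → EuclideanSpace ℝ κ)) =>
      crossTerm a q.1 q.2 i j := by
  unfold crossTerm
  have hw : ∀ k, Measurable fun q : (ι → Bool) ×
      ((ι → EuclideanSpace ℝ κ) × (ι → EuclideanSpace ℝ κ)) => q.1 k := fun k => by fun_prop
  refine Measurable.ite (((hw i) (measurableSet_singleton true)).inter
    ((hw j) (measurableSet_singleton false))) (Measurable.mul ?_ ?_) measurable_const
  · exact (ha i j).comp (by fun_prop)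
  · exact Measurable.inner (by fun_prop) (by fun_prop)

lemma measurable_crossTerm_halfTurn [Fintype ι] {a : (ι → EuclideanSpace ℝ κ) → ι → ι → ℝ}
    (ha : ∀ i j, Measurable fun X => a X i j) (i j : ι) :
    Measurable fun q : ((ι → Bool) × ℝ) ×
      ((ι → EuclideanSpace ℝ κ) × (ι → EuclideanSpace ℝ κ)) =>
      crossTerm a q.1.1 (halfTurn q.1 q.2) i j :=
  (measurable_crossTerm ha i j).comp
    (Measurable.prodMk (by fun_prop) measurable_halfTurn)

lemma integrable_crossTerm_halfTurn [Fintype ι] {a : (ι → EuclideanSpace ℝ κ) → ι → ι → ℝ}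
    (ha : ∀ i j, Measurable fun X => a X i j) {M : ℝ} (hM : ∀ X i j, |a X i j| ≤ M)
    (Z : (ι → EuclideanSpace ℝ κ) × (ι → EuclideanSpace ℝ κ)) (i j : ι) :
    Integrable (fun s => crossTerm a s.1 (halfTurn s Z) i j) (halfTurnMeasure ι) := by
  have hM0 : 0 ≤ M := (abs_nonneg _).trans (hM Z.1 i j)
  refine Integrable.of_bound ((measurable_crossTerm_halfTurn ha i j).comp
    (measurable_prodMk_right (y := Z))).aestronglyMeasurable
    (M * ((‖Z.1 i‖ + ‖Z.2 i‖) * (‖Z.1 j‖ + ‖Z.2 j‖))) (Filter.Eventually.of_forall fun s => ?_)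
  have hrot : ∀ (c d : ℝ) (x y : EuclideanSpace ℝ κ), |c| ≤ 1 → |d| ≤ 1 →
      ‖c • x + d • y‖ ≤ ‖x‖ + ‖y‖ := fun c d x y hc hd => by
    refine (norm_add_le _ _).trans (add_le_add ?_ ?_)
    · rw [norm_smul]; exact mul_le_of_le_one_left (norm_nonneg _) hc
    · rw [norm_smul]; exact mul_le_of_le_one_left (norm_nonneg _) hd
  rw [crossTerm]
  split_ifs
  · rw [norm_mul]
    refine mul_le_mul (hM _ _ _) ((norm_inner_le_norm _ _).trans ?_) (norm_nonneg _) hM0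
    refine mul_le_mul (hrot _ _ _ _ ?_ (Real.abs_cos_le_one _))
      (hrot _ _ _ _ (Real.abs_cos_le_one _) (Real.abs_sin_le_one _)) (norm_nonneg _)
      (by positivity)
    rw [abs_neg]; exact Real.abs_sin_le_one _
  · rw [norm_zero]; positivity

/-- An odd function of the overlap is the mean along half turns of its derivative: a half turn
of `xᵢ` changes the sign of the overlap, and a random subset separates two given indices with
probability `1 / 4`. -/
lemma halfTurnMean_overlap [Nonempty κ] [Fintype ι] {h : ℝ → ℝ} (hm : Measurable h) {M : ℝ}
    (hM : ∀ x, |h x| ≤ M) (heven : ∀ x, h (-x) = h x)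
    (Z : (ι → EuclideanSpace ℝ κ) × (ι → EuclideanSpace ℝ κ)) {i j : ι} (hij : i ≠ j) :
    halfTurnMean (fun X i j => h (overlap X i j)) Z i j =
      -(√(Fintype.card κ) / (2 * Real.pi)) * ∫ t in (0 : ℝ)..(overlap Z.1 i j), h t := by
  have hκ : (0 : ℝ) < Fintype.card κ := by exact_mod_cast Fintype.card_pos
  set r := √(Fintype.card κ : ℝ) with hr
  have hr0 : 0 < r := Real.sqrt_pos.2 hκ
  set b : ℝ := inner ℝ (Z.2 i) (Z.1 j) / r with hb
  have hpt : ∀ s : (ι → Bool) × ℝ,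
      crossTerm (fun X i j => h (overlap X i j)) s.1 (halfTurn s Z) i j =
      (if s.1 i = true ∧ s.1 j = false then (1 : ℝ) else 0) *
        (r * (h (Real.cos s.2 * overlap Z.1 i j + Real.sin s.2 * b) *
          (-Real.sin s.2 * overlap Z.1 i j + Real.cos s.2 * b))) := by
    intro s
    rw [crossTerm]
    split_ifs with hs
    · have h1 : overlap (halfTurn s Z).1 i j =
          Real.cos s.2 * overlap Z.1 i j + Real.sin s.2 * b := by
        simp only [overlap, halfTurn, rowRotation, hs.1, hs.2, if_true, Bool.false_eq_true,
          if_false, Real.cos_zero, Real.sin_zero, zero_smul, add_zero, one_smul, inner_add_left,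
          real_inner_smul_left, hb]
        ring
      have h2 : inner ℝ ((halfTurn s Z).2 i) ((halfTurn s Z).1 j) =
          r * (-Real.sin s.2 * overlap Z.1 i j + Real.cos s.2 * b) := by
        simp only [overlap, halfTurn, rowRotation, hs.1, hs.2, if_true, Bool.false_eq_true,
          if_false, Real.cos_zero, Real.sin_zero, zero_smul, add_zero, one_smul, inner_add_left,
          real_inner_smul_left, hb, ← hr]
        field_simp
      rw [h1, h2]; ring
    · rw [zero_mul]
  rw [halfTurnMean]
  simp_rw [hpt]
  rw [halfTurnMeasure, integral_prod_mul (fun w : ι → Bool =>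
    if w i = true ∧ w j = false then (1 : ℝ) else 0) (fun θ : ℝ =>
      r * (h (Real.cos θ * overlap Z.1 i j + Real.sin θ * b) *
          (-Real.sin θ * overlap Z.1 i j + Real.cos θ * b))), integral_separated hij,
    integral_angleMeasure, intervalIntegral.integral_const_mul,
    integral_half_rotation hm hM heven]
  field_simp
  ring

/-- Jensen's inequality for the exponential, with values in `[0, ∞]`. -/
lemma ofReal_exp_integral_le {S : Type*} [MeasurableSpace S] {Q : Measure S}
    [IsProbabilityMeasure Q] {f : S → ℝ} (hf : Integrable f Q) :
    ENNReal.ofReal (Real.exp (∫ s, f s ∂Q)) ≤ ∫⁻ s, ENNReal.ofReal (Real.exp (f s)) ∂Q := by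
  by_cases hi : Integrable (fun s => Real.exp (f s)) Q
  · rw [← ofReal_integral_eq_lintegral_ofReal hi
      (Filter.Eventually.of_forall fun s => (Real.exp_pos _).le)]
    exact ENNReal.ofReal_le_ofReal (convexOn_exp.map_integral_le Real.continuous_exp.continuousOn
      isClosed_univ (Filter.Eventually.of_forall fun _ => Set.mem_univ _) hf hi)
  · have : ∫⁻ s, ENNReal.ofReal (Real.exp (f s)) ∂Q = ⊤ := by
      by_contra hne
      refine hi ⟨(Real.continuous_exp.comp_aestronglyMeasurable hf.1), ?_⟩
      rw [hasFiniteIntegral_iff_ofReal (Filter.Eventually.of_forall fun s => (Real.exp_pos _).le)]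
      exact lt_top_iff_ne_top.2 hne
    rw [this]; exact le_top

end HalfTurn

section HalfTurnMoments

variable {κ ι : Type*} [Fintype κ]

/-- Sub-Gaussian bound for a bilinear form in a half-turn mean. Conditionally on the positions, the
velocities are standard Gaussian, and every half turn preserves the joint law. -/
lemma lintegral_exp_halfTurnMean_le [Fintype ι] {a : (ι → EuclideanSpace ℝ κ) → ι → ι → ℝ}
    (ha : ∀ i j, Measurable fun X => a X i j) {M : ℝ} (hM : ∀ X i j, |a X i j| ≤ M)
    {u v : ι → ℝ} {V : ℝ}
    (hV : ∀ (w : ι → Bool) (X : ι → EuclideanSpace ℝ κ),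
      ∑ i, ‖∑ j, (if w i = true ∧ w j = false then u i * v j * a X i j else 0) • X j‖ ^ 2 ≤ V)
    (l : ℝ) :
    ∫⁻ Z, ENNReal.ofReal (Real.exp (l * ∑ i, ∑ j, u i * v j * halfTurnMean a Z i j))
        ∂((Measure.pi fun _ : ι => stdGaussian (EuclideanSpace ℝ κ)).prod
          (Measure.pi fun _ : ι => stdGaussian (EuclideanSpace ℝ κ))) ≤
      ENNReal.ofReal (Real.exp (l ^ 2 * V / 2)) := by
  set μ := Measure.pi fun _ : ι => stdGaussian (EuclideanSpace ℝ κ) with hμ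
  obtain ⟨F, hF⟩ : ∃ F : (ι → Bool) → ((ι → EuclideanSpace ℝ κ) × (ι → EuclideanSpace ℝ κ)) → ℝ,
      ∀ w Z, F w Z = l * ∑ i, ∑ j, u i * v j * crossTerm a w Z i j := ⟨_, fun _ _ => rfl⟩
  have hFm : Measurable fun q : (ι → Bool) ×
      ((ι → EuclideanSpace ℝ κ) × (ι → EuclideanSpace ℝ κ)) => F q.1 q.2 := by
    simp_rw [hF]
    refine Measurable.const_mul ?_ _
    refine Finset.measurable_fun_sum _ fun i _ => Finset.measurable_fun_sum _ fun j _ => ?_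
    exact (measurable_crossTerm ha i j).const_mul _
  have hFm' : Measurable fun q : ((ι → Bool) × ℝ) ×
      ((ι → EuclideanSpace ℝ κ) × (ι → EuclideanSpace ℝ κ)) => F q.1.1 (halfTurn q.1 q.2) :=
    hFm.comp (Measurable.prodMk (by fun_prop) measurable_halfTurn)
  have hint : ∀ Z, Integrable (fun s : (ι → Bool) × ℝ => F s.1 (halfTurn s Z))
      (halfTurnMeasure ι) := fun Z => by
    simp_rw [hF]
    refine Integrable.const_mul ?_ _
    refine integrable_finsetSum _ fun i _ => integrable_finsetSum _ fun j _ => ?_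
    exact (integrable_crossTerm_halfTurn ha hM Z i j).const_mul _
  have hmean : ∀ Z, l * ∑ i, ∑ j, u i * v j * halfTurnMean a Z i j =
      ∫ s, F s.1 (halfTurn s Z) ∂(halfTurnMeasure ι) := by
    intro Z
    have hI := integrable_crossTerm_halfTurn ha hM Z
    simp only [hF, halfTurnMean]
    rw [integral_const_mul, integral_finsetSum _ fun i _ => integrable_finsetSum _ fun j _ =>
      (hI i j).const_mul _]
    congr 1
    refine Finset.sum_congr rfl fun i _ => ?_
    rw [integral_finsetSum _ fun j _ => (hI i j).const_mul _]
    exact Finset.sum_congr rfl fun j _ => (integral_const_mul _ _).symm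
  have hfix : ∀ w, ∫⁻ Z, ENNReal.ofReal (Real.exp (F w Z)) ∂(μ.prod μ) ≤
      ENNReal.ofReal (Real.exp (l ^ 2 * V / 2)) := by
    intro w
    have hFw : Measurable (F w) := hFm.comp measurable_prodMk_left
    rw [lintegral_prod _ hFw.exp.ennreal_ofReal.aemeasurable]
    suffices hX : ∀ X, ∫⁻ Y, ENNReal.ofReal (Real.exp (F w (X, Y))) ∂μ ≤
        ENNReal.ofReal (Real.exp (l ^ 2 * V / 2)) by
      calc _ ≤ ∫⁻ _, ENNReal.ofReal (Real.exp (l ^ 2 * V / 2)) ∂μ := lintegral_mono hX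
        _ = _ := by simp
    intro X
    set c : ι → EuclideanSpace ℝ κ := fun i =>
      ∑ j, (if w i = true ∧ w j = false then u i * v j * a X i j else 0) • X j with hc
    have hlin : ∀ Y, F w (X, Y) = ∑ i, inner ℝ (l • c i) (Y i) := by
      intro Y
      simp only [hF, hc, Finset.mul_sum]
      refine Finset.sum_congr rfl fun i _ => ?_
      rw [real_inner_smul_left, sum_inner, Finset.mul_sum]
      refine Finset.sum_congr rfl fun j _ => ?_
      rw [real_inner_smul_left, real_inner_comm, crossTerm]
      split_ifs <;> ring
    simp_rw [hlin]
    rw [hμ, lintegral_exp_sum_inner]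
    refine ENNReal.ofReal_le_ofReal (Real.exp_le_exp.2 ?_)
    simp_rw [norm_smul, mul_pow, Real.norm_eq_abs, sq_abs]
    rw [← Finset.mul_sum]
    gcongr
    exact hV w X
  have hturn : ∀ s : (ι → Bool) × ℝ,
      ∫⁻ Z, ENNReal.ofReal (Real.exp (F s.1 (halfTurn s Z))) ∂(μ.prod μ) ≤
        ENNReal.ofReal (Real.exp (l ^ 2 * V / 2)) := fun s => by
    have hFw : Measurable (F s.1) := hFm.comp measurable_prodMk_left
    have := (measurePreserving_halfTurn (κ := κ) s).lintegral_comp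
      (f := fun Z => ENNReal.ofReal (Real.exp (F s.1 Z)))
      hFw.exp.ennreal_ofReal
    rw [← hμ] at this
    rw [this]
    exact hfix s.1
  calc _ = ∫⁻ Z, ENNReal.ofReal (Real.exp (∫ s, F s.1 (halfTurn s Z) ∂(halfTurnMeasure ι)))
          ∂(μ.prod μ) := by simp_rw [hmean]
    _ ≤ ∫⁻ Z, ∫⁻ s, ENNReal.ofReal (Real.exp (F s.1 (halfTurn s Z))) ∂(halfTurnMeasure ι)
          ∂(μ.prod μ) := lintegral_mono fun Z => ofReal_exp_integral_le (hint Z)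
    _ = ∫⁻ s, ∫⁻ Z, ENNReal.ofReal (Real.exp (F s.1 (halfTurn s Z))) ∂(μ.prod μ)
          ∂(halfTurnMeasure ι) :=
        lintegral_lintegral_swap
          (hFm'.comp measurable_swap).exp.ennreal_ofReal.aemeasurable
    _ ≤ ∫⁻ _, ENNReal.ofReal (Real.exp (l ^ 2 * V / 2)) ∂(halfTurnMeasure ι) := by
        exact lintegral_mono hturn
    _ = _ := by simp

lemma lintegral_norm_sq_stdGaussian :
    ∫⁻ x, ENNReal.ofReal (‖x‖ ^ 2) ∂(stdGaussian (EuclideanSpace ℝ κ)) =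
      ENNReal.ofReal (Fintype.card κ) := by
  classical
  have h1 : ∀ x : EuclideanSpace ℝ κ, ENNReal.ofReal (‖x‖ ^ 2) =
      ∑ a, ENNReal.ofReal (inner ℝ (EuclideanSpace.single a (1 : ℝ)) x ^ 2) := fun x => by
    rw [EuclideanSpace.real_norm_sq_eq, ENNReal.ofReal_sum_of_nonneg fun _ _ => sq_nonneg _]
    simp [EuclideanSpace.inner_single_left]
  simp_rw [h1]
  rw [lintegral_finsetSum _ fun a _ => by fun_prop]
  simp_rw [lintegral_inner_sq]
  simp

/-- First moment of a half-turn mean whose weight lives on a rare event `D`: up to constants, it is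
the standard deviation `√n` of `⟨yᵢ, xⱼ⟩` times the square root of the probability of `D`. -/
lemma lintegral_abs_halfTurnMean_le [Nonempty κ] [Fintype ι]
    {a : (ι → EuclideanSpace ℝ κ) → ι → ι → ℝ}
    (ha : ∀ i j, Measurable fun X => a X i j) {M : ℝ} (hM : ∀ X i j, |a X i j| ≤ M)
    {D : Set (ι → EuclideanSpace ℝ κ)} (hD : MeasurableSet D)
    (haD : ∀ X ∉ D, ∀ i j, a X i j = 0) {η : ℝ} (hη : 0 < η)
    (hDη : (Measure.pi fun _ : ι => stdGaussian (EuclideanSpace ℝ κ)) D ≤ ENNReal.ofReal (η ^ 2))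
    (i j : ι) :
    ∫⁻ Z, ENNReal.ofReal |halfTurnMean a Z i j|
        ∂((Measure.pi fun _ : ι => stdGaussian (EuclideanSpace ℝ κ)).prod
          (Measure.pi fun _ : ι => stdGaussian (EuclideanSpace ℝ κ))) ≤
      ENNReal.ofReal (M * (√(Fintype.card κ) * η)) := by
  classical
  have hκ : (0 : ℝ) < Fintype.card κ := by exact_mod_cast Fintype.card_pos
  set μ := Measure.pi fun _ : ι => stdGaussian (EuclideanSpace ℝ κ)
  set r := √(Fintype.card κ : ℝ)
  have hr0 : 0 < r := Real.sqrt_pos.2 hκ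
  have hrr : r ^ 2 = Fintype.card κ := Real.sq_sqrt hκ.le
  have hM0 : 0 ≤ M := (abs_nonneg _).trans (hM 0 i j)
  have hct : ∀ (w : ι → Bool) (Z : (ι → EuclideanSpace ℝ κ) × (ι → EuclideanSpace ℝ κ)),
      ENNReal.ofReal |crossTerm a w Z i j| ≤
        ENNReal.ofReal (M * r / (2 * η)) * D.indicator 1 Z.1 +
          ENNReal.ofReal (M * η / (2 * r)) * ENNReal.ofReal (inner ℝ (Z.1 j) (Z.2 i) ^ 2) := by
    intro w Z
    have hpos : 0 ≤ M * η / (2 * r) * inner ℝ (Z.1 j) (Z.2 i) ^ 2 := by positivity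
    rw [← ENNReal.ofReal_mul (by positivity)]
    by_cases hZ : Z.1 ∈ D
    · rw [Set.indicator_of_mem hZ, Pi.one_apply, mul_one, ← ENNReal.ofReal_add (by positivity) hpos]
      refine ENNReal.ofReal_le_ofReal ?_
      have hbd : |crossTerm a w Z i j| ≤ M * |inner ℝ (Z.1 j) (Z.2 i)| := by
        rw [crossTerm]
        split_ifs
        · rw [abs_mul, real_inner_comm]
          exact mul_le_mul_of_nonneg_right (hM _ _ _) (abs_nonneg _)
        · rw [abs_zero]; positivity
      refine hbd.trans ?_
      set x := inner ℝ (Z.1 j) (Z.2 i)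
      -- the balanced form of `2 |x| ≤ r / η + η x² / r`, as `𝔼 x² = r²` and `ℙ D ≤ η²`
      have hamgm : |x| ≤ r / (2 * η) + η / (2 * r) * x ^ 2 := by
        have h0 : 0 ≤ (r - η * |x|) ^ 2 / (2 * η * r) := by positivity
        have : r / (2 * η) + η / (2 * r) * x ^ 2 - |x| = (r - η * |x|) ^ 2 / (2 * η * r) := by
          rw [← sq_abs x]; field_simp; ring
        linarith
      calc M * |x| ≤ M * (r / (2 * η) + η / (2 * r) * x ^ 2) := by gcongr
        _ = _ := by ring
    · have : crossTerm a w Z i j = 0 := by rw [crossTerm, haD _ hZ]; simp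
      rw [this]; simp
  have hinner : ∫⁻ Z : (ι → EuclideanSpace ℝ κ) × (ι → EuclideanSpace ℝ κ),
      ENNReal.ofReal (inner ℝ (Z.1 j) (Z.2 i) ^ 2) ∂(μ.prod μ) =
        ENNReal.ofReal (Fintype.card κ) := by
    have hmeas : Measurable fun Z : (ι → EuclideanSpace ℝ κ) × (ι → EuclideanSpace ℝ κ) =>
        ENNReal.ofReal (inner ℝ (Z.1 j) (Z.2 i) ^ 2) := by
      have h2 : Measurable fun Z : (ι → EuclideanSpace ℝ κ) × (ι → EuclideanSpace ℝ κ) =>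
        inner ℝ (Z.1 j) (Z.2 i) := Measurable.inner (by fun_prop) (by fun_prop)
      exact (h2.pow_const 2).ennreal_ofReal
    rw [lintegral_prod _ hmeas.aemeasurable]
    have h1 : ∀ X : ι → EuclideanSpace ℝ κ,
        ∫⁻ Y : ι → EuclideanSpace ℝ κ, ENNReal.ofReal (inner ℝ (X j) (Y i) ^ 2) ∂μ =
          ENNReal.ofReal (‖X j‖ ^ 2) := fun X => by
      rw [← lintegral_inner_sq]
      exact (measurePreserving_eval (fun _ : ι => stdGaussian (EuclideanSpace ℝ κ))
        i).lintegral_comp (f := fun y => ENNReal.ofReal (inner ℝ (X j) y ^ 2)) (by fun_prop)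
    simp_rw [h1]
    rw [← lintegral_norm_sq_stdGaussian]
    exact (measurePreserving_eval (fun _ : ι => stdGaussian (EuclideanSpace ℝ κ))
        j).lintegral_comp (f := fun x => ENNReal.ofReal (‖x‖ ^ 2)) (by fun_prop)
  have hfix : ∀ w, ∫⁻ Z, ENNReal.ofReal |crossTerm a w Z i j| ∂(μ.prod μ) ≤
      ENNReal.ofReal (M * (r * η)) := by
    intro w
    refine (lintegral_mono (hct w)).trans ?_
    have hind : Measurable fun Z : (ι → EuclideanSpace ℝ κ) × (ι → EuclideanSpace ℝ κ) =>
        D.indicator (1 : (ι → EuclideanSpace ℝ κ) → ENNReal) Z.1 :=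
      (measurable_one.indicator hD).comp measurable_fst
    rw [lintegral_add_left (hind.const_mul _), lintegral_const_mul _ hind,
      lintegral_const_mul' _ _ ENNReal.ofReal_ne_top, hinner,
      (measurePreserving_fst (μ := μ) (ν := μ)).lintegral_comp (measurable_one.indicator hD),
      lintegral_indicator_one hD]
    refine (add_le_add (mul_le_mul_right hDη _) le_rfl).trans ?_
    rw [← ENNReal.ofReal_mul (by positivity), ← ENNReal.ofReal_mul (by positivity),
      ← ENNReal.ofReal_add (by positivity) (by positivity)]
    refine ENNReal.ofReal_le_ofReal (le_of_eq ?_)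
    rw [← hrr]
    field_simp
    ring
  have hcm : Measurable fun q : ((ι → Bool) × ℝ) ×
      ((ι → EuclideanSpace ℝ κ) × (ι → EuclideanSpace ℝ κ)) =>
      ENNReal.ofReal |crossTerm a q.1.1 (halfTurn q.1 q.2) i j| :=
    ((measurable_crossTerm_halfTurn ha i j).abs).ennreal_ofReal
  calc _ ≤ ∫⁻ Z, ∫⁻ s, ENNReal.ofReal |crossTerm a s.1 (halfTurn s Z) i j| ∂(halfTurnMeasure ι)
          ∂(μ.prod μ) := by
        refine lintegral_mono fun Z => ?_
        rw [← ofReal_integral_eq_lintegral_ofReal (integrable_crossTerm_halfTurn ha hM Z i j).abs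
          (Filter.Eventually.of_forall fun _ => abs_nonneg _)]
        exact ENNReal.ofReal_le_ofReal abs_integral_le_integral_abs
    _ = ∫⁻ s, ∫⁻ Z, ENNReal.ofReal |crossTerm a s.1 (halfTurn s Z) i j| ∂(μ.prod μ)
          ∂(halfTurnMeasure ι) :=
        lintegral_lintegral_swap (hcm.comp measurable_swap).aemeasurable
    _ ≤ ∫⁻ _, ENNReal.ofReal (M * (r * η)) ∂(halfTurnMeasure ι) := by
        refine lintegral_mono fun s => ?_
        have hFw : Measurable fun Z => crossTerm a s.1 Z i j :=
          (measurable_crossTerm ha i j).comp measurable_prodMk_left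
        have := (measurePreserving_halfTurn (κ := κ) s).lintegral_comp
          (f := fun Z => ENNReal.ofReal |crossTerm a s.1 Z i j|) hFw.abs.ennreal_ofReal
        exact (le_of_eq this).trans (hfix s.1)
    _ = _ := by simp

end HalfTurnMoments

/-! ### Splitting vectors into flat and sparse parts -/

open Matrix in
/-- A bilinear form on the unit ball is controlled by its values on pairs in which one vector is
flat, and on pairs of sparse vectors: a vector of the unit ball has at most `s` coordinates above
`1 / √s`. -/
lemma bilin_le_of_flat_of_sparse {ι : Type*} [Fintype ι] {M : Matrix ι ι ℝ} {s T : ℝ} (hs : 0 < s)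
    (h₁ : ∀ u ∈ flatBall ι 1, ∀ v ∈ flatBall ι (1 / √s), u ⬝ᵥ M *ᵥ v ≤ T)
    (h₂ : ∀ u ∈ flatBall ι (1 / √s), ∀ v ∈ flatBall ι 1, u ⬝ᵥ M *ᵥ v ≤ T)
    (h₃ : ∀ u ∈ sparseBall ι s, ∀ v ∈ sparseBall ι s, u ⬝ᵥ M *ᵥ v ≤ T) :
    ∀ u ∈ flatBall ι 1, ∀ v ∈ flatBall ι 1, u ⬝ᵥ M *ᵥ v ≤ 3 * T := by
  have hsplit : ∀ u ∈ flatBall ι 1, ∃ x ∈ flatBall ι (1 / √s), ∃ y ∈ sparseBall ι s,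
      u = x + y := by
    intro u hu
    refine ⟨fun i => if |u i| ≤ 1 / √s then u i else 0, ⟨?_, fun i => ?_⟩,
      fun i => if |u i| ≤ 1 / √s then 0 else u i, ⟨?_, ?_⟩, ?_⟩
    · refine (Finset.sum_le_sum fun i _ => ?_).trans hu.1
      dsimp only
      split_ifs
      · exact le_rfl
      · simpa using sq_nonneg (u i)
    · dsimp only
      split_ifs with h
      · exact h
      · simp
    · refine (Finset.sum_le_sum fun i _ => ?_).trans hu.1
      dsimp only
      split_ifs
      · simpa using sq_nonneg (u i)
      · exact le_rfl
    · have h1 : ∑ i, (if (if |u i| ≤ 1 / √s then 0 else u i) ≠ 0 then 1 / s else 0) ≤ 1 := by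
        refine (Finset.sum_le_sum fun i _ => ?_).trans hu.1
        by_cases h : |u i| ≤ 1 / √s
        · rw [if_pos h]
          simpa using sq_nonneg (u i)
        · have h2 : (1 / √s) ^ 2 ≤ u i ^ 2 := by
            rw [← sq_abs (u i)]
            exact pow_le_pow_left₀ (by positivity) (not_le.1 h).le 2
          rw [div_pow, Real.sq_sqrt hs.le, one_pow] at h2
          simp only [if_neg h]
          split_ifs
          · exact h2
          · exact sq_nonneg _
      rw [← Finset.sum_filter, Finset.sum_const, nsmul_eq_mul, mul_one_div, div_le_one hs] at h1
      exact h1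
    · ext i
      rw [Pi.add_apply]
      split_ifs <;> simp
  intro u hu v hv
  obtain ⟨x, hx, y, hy, rfl⟩ := hsplit u hu
  obtain ⟨x', hx', y', hy', rfl⟩ := hsplit v hv
  have e1 := h₁ _ hu x' hx'
  have e2 := h₂ x hx y' (mem_flatBall_one.2 hy'.1)
  have e3 := h₃ y hy y' hy'
  rw [mulVec_add, dotProduct_add]
  rw [add_dotProduct] at e1 ⊢
  rw [add_dotProduct]
  linarith

open Matrix in
/-- Chernoff and union bound for a random bilinear form on a product of half-nets. -/
lemma measure_not_bilin_le_le {Ω ι : Type*} [MeasurableSpace Ω] [Fintype ι] {ν : Measure Ω}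
    {W : Ω → Matrix ι ι ℝ} (hW : ∀ i j, Measurable fun ω => W ω i j) {G C G' C' : Set (ι → ℝ)}
    (hN : IsHalfNet (G ∩ C) C) (hN' : IsHalfNet (G' ∩ C') C')
    (hC : ∀ u ∈ C, ∑ i, u i ^ 2 ≤ 1) (hC' : ∀ u ∈ C', ∑ i, u i ^ 2 ≤ 1) (hfin : G.Finite)
    (hfin' : G'.Finite) {c c' : ℝ} (hc : (G.ncard : ℝ) ≤ c)
    (hc' : (G'.ncard : ℝ) ≤ c') {σ t : ℝ} (hσ : 0 < σ) (ht : 0 < t)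
    (hmgf : ∀ u ∈ C, ∀ v ∈ C', ∀ l : ℝ,
      ∫⁻ ω, ENNReal.ofReal (Real.exp (l * (u ⬝ᵥ W ω *ᵥ v))) ∂ν ≤
        ENNReal.ofReal (Real.exp (l ^ 2 * σ / 2))) :
    ν {ω | ¬ ∀ u ∈ C, ∀ v ∈ C', u ⬝ᵥ W ω *ᵥ v ≤ 4 * t} ≤
      ENNReal.ofReal (c * (c' * Real.exp (-(t ^ 2 / (2 * σ))))) := by
  have hsub : {ω | ¬ ∀ u ∈ C, ∀ v ∈ C', u ⬝ᵥ W ω *ᵥ v ≤ 4 * t} ⊆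
      ⋃ u ∈ G ∩ C, ⋃ v ∈ G' ∩ C', {ω | t ≤ u ⬝ᵥ W ω *ᵥ v} := by
    intro ω hω
    by_contra hcon
    simp only [Set.mem_iUnion, Set.mem_ofPred_eq, not_exists, not_le] at hcon
    exact hω (bilin_le_of_isHalfNet hN hN' hC hC' fun u hu v hv => (hcon u hu v hv).le)
  have hcard : ((G ∩ C).ncard : ℝ) ≤ c :=
    le_trans (Nat.cast_le.2 (Set.ncard_le_ncard Set.inter_subset_left hfin)) hc
  have hcard' : ((G' ∩ C').ncard : ℝ) ≤ c' :=
    le_trans (Nat.cast_le.2 (Set.ncard_le_ncard Set.inter_subset_left hfin')) hc'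
  have hc0 : 0 ≤ c' := (Nat.cast_nonneg _).trans hc'
  refine (measure_mono hsub).trans
    (measure_biUnion_ncard_le (hfin.subset Set.inter_subset_left) (by positivity) hcard
    fun u hu => measure_biUnion_ncard_le (hfin'.subset Set.inter_subset_left)
      (Real.exp_pos _).le hcard' fun v hv => ?_)
  refine measure_ge_le_of_lintegral_exp_le hσ ht (fun l _ => hmgf u hu.2 v hv.2 l) ?_
  refine (Finset.measurable_fun_sum _ fun i _ => Measurable.const_mul ?_ _).aemeasurable
  exact Finset.measurable_fun_sum _ fun j _ => (hW i j).mul_const _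

/-! ### One level of the derivative -/

section Level

variable {κ ι : Type*} [Fintype κ] [Fintype ι]

open Classical in
/-- The part of `h (overlap X i j)` that comes from regular configurations and from overlaps of
absolute value in `[l, l + 1)`. -/
noncomputable def levelWeight (h : ℝ → ℝ) (C₁ C₂ γ : ℝ) (l : ℕ) (X : ι → EuclideanSpace ℝ κ)
    (i j : ι) : ℝ :=
  if X ∈ regularSet κ ι C₁ C₂ γ ∧ ⌊|overlap X i j|⌋₊ = l then h (overlap X i j) else 0

open Classical in
/-- The part of `h (overlap X i j)` that comes from irregular configurations. -/
noncomputable def irregularWeight (h : ℝ → ℝ) (C₁ C₂ γ : ℝ) (X : ι → EuclideanSpace ℝ κ)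
    (i j : ι) : ℝ :=
  if X ∈ regularSet κ ι C₁ C₂ γ then 0 else h (overlap X i j)

lemma measurable_levelWeight {h : ℝ → ℝ} (hm : Measurable h) (C₁ C₂ γ : ℝ) (l : ℕ) (i j : ι) :
    Measurable fun X : ι → EuclideanSpace ℝ κ => levelWeight h C₁ C₂ γ l X i j := by
  have ho := (continuous_overlap (κ := κ) (ι := ι) i j).measurable
  refine Measurable.ite ((measurableSet_regularSet C₁ C₂ γ).inter ?_) (hm.comp ho) measurable_const
  exact (Nat.measurable_floor.comp ho.abs) (measurableSet_singleton l)

lemma measurable_irregularWeight {h : ℝ → ℝ} (hm : Measurable h) (C₁ C₂ γ : ℝ) (i j : ι) :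
    Measurable fun X : ι → EuclideanSpace ℝ κ => irregularWeight h C₁ C₂ γ X i j :=
  Measurable.ite (measurableSet_regularSet C₁ C₂ γ) measurable_const
    (hm.comp (continuous_overlap (κ := κ) (ι := ι) i j).measurable)

/-- Large overlaps carry little of the mass `u² ⊗ v²` when one of the vectors is flat. -/
lemma sum_sq_mul_sq_large_overlap_le {C₁ C₂ γ : ℝ} {X : ι → EuclideanSpace ℝ κ}
    (hX : X ∈ regularSet κ ι C₁ C₂ γ) (hγ : 0 ≤ γ) {l : ℕ} {w : ι → Bool} {u v : ι → ℝ} {δ : ℝ}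
    (huv : (u ∈ flatBall ι 1 ∧ v ∈ flatBall ι δ) ∨ (u ∈ flatBall ι δ ∧ v ∈ flatBall ι 1)) :
    ∑ i, ∑ j, (if (w i = true ∧ w j = false) ∧ ⌊|overlap X i j|⌋₊ = l then
      u i ^ 2 * v j ^ 2 else 0) ≤ δ ^ 2 * (C₂ * Fintype.card ι * Real.exp (-(γ * l))) := by
  classical
  set P : ι → ι → Prop := fun i j => (w i = true ∧ w j = false) ∧ ⌊|overlap X i j|⌋₊ = l
  have hsymm : ∀ i j, overlap X i j = overlap X j i := fun i j => by
    rw [overlap, overlap, real_inner_comm]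
  have hexp : ∀ i j, ⌊|overlap X i j|⌋₊ = l →
      1 ≤ Real.exp (γ * |overlap X i j|) * Real.exp (-(γ * l)) := by
    intro i j hl
    rw [← Real.exp_add]
    have : (l : ℝ) ≤ |overlap X i j| := by rw [← hl]; exact Nat.floor_le (abs_nonneg _)
    exact Real.one_le_exp (by nlinarith)
  have hrow : ∀ i, ∑ j, (if P i j then (1 : ℝ) else 0) ≤
      C₂ * Fintype.card ι * Real.exp (-(γ * l)) := by
    intro i
    have hi : ¬ P i i := by
      rintro ⟨⟨h1, h2⟩, -⟩
      rw [h1] at h2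
      cases h2
    calc ∑ j, (if P i j then (1 : ℝ) else 0)
        = ∑ j ∈ Finset.univ.erase i, (if P i j then (1 : ℝ) else 0) := by
          rw [Finset.sum_erase]; rw [if_neg hi]
      _ ≤ ∑ j ∈ Finset.univ.erase i, Real.exp (γ * |overlap X i j|) * Real.exp (-(γ * l)) := by
          refine Finset.sum_le_sum fun j _ => ?_
          split_ifs with h
          · exact hexp i j h.2
          · positivity
      _ ≤ _ := by
          rw [← Finset.sum_mul]
          have := hX.2 i
          gcongr
  have hcol : ∀ j, ∑ i, (if P i j then (1 : ℝ) else 0) ≤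
      C₂ * Fintype.card ι * Real.exp (-(γ * l)) := by
    intro j
    have hj : ¬ P j j := by
      rintro ⟨⟨h1, h2⟩, -⟩
      rw [h1] at h2
      cases h2
    calc ∑ i, (if P i j then (1 : ℝ) else 0)
        = ∑ i ∈ Finset.univ.erase j, (if P i j then (1 : ℝ) else 0) := by
          rw [Finset.sum_erase]; rw [if_neg hj]
      _ ≤ ∑ i ∈ Finset.univ.erase j, Real.exp (γ * |overlap X j i|) * Real.exp (-(γ * l)) := by
          refine Finset.sum_le_sum fun i _ => ?_
          split_ifs with h
          · rw [hsymm]; exact hexp i j h.2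
          · positivity
      _ ≤ _ := by
          rw [← Finset.sum_mul]
          have := hX.2 j
          gcongr
  have hB : 0 ≤ C₂ * Fintype.card ι * Real.exp (-(γ * l)) ∨ IsEmpty ι := by
    rcases isEmpty_or_nonempty ι with h | ⟨⟨i⟩⟩
    · exact Or.inr h
    · exact Or.inl ((Finset.sum_nonneg fun j _ => by split_ifs <;> norm_num).trans (hrow i))
  rcases hB with hB | hB
  swap
  · simp
  set B := C₂ * Fintype.card ι * Real.exp (-(γ * l))
  rcases huv with ⟨hu, hv⟩ | ⟨hu, hv⟩
  · calc _ ≤ ∑ i, u i ^ 2 * (δ ^ 2 * B) := by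
          refine Finset.sum_le_sum fun i _ => ?_
          calc _ ≤ ∑ j, u i ^ 2 * (δ ^ 2 * if P i j then (1 : ℝ) else 0) := by
                refine Finset.sum_le_sum fun j _ => ?_
                have : v j ^ 2 ≤ δ ^ 2 := sq_le_sq.2 ((hv.2 j).trans (le_abs_self δ))
                split_ifs
                · rw [mul_one]; gcongr
                · simp
            _ = u i ^ 2 * (δ ^ 2 * ∑ j, if P i j then (1 : ℝ) else 0) := by
                rw [Finset.mul_sum, Finset.mul_sum]
            _ ≤ _ := by gcongr; exact hrow i
      _ = (∑ i, u i ^ 2) * (δ ^ 2 * B) := by rw [Finset.sum_mul]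
      _ ≤ 1 * (δ ^ 2 * B) := by gcongr; exact hu.1
      _ = _ := one_mul _
  · rw [Finset.sum_comm]
    calc _ ≤ ∑ j, v j ^ 2 * (δ ^ 2 * B) := by
          refine Finset.sum_le_sum fun j _ => ?_
          calc _ ≤ ∑ i, v j ^ 2 * (δ ^ 2 * if P i j then (1 : ℝ) else 0) := by
                refine Finset.sum_le_sum fun i _ => ?_
                have : u i ^ 2 ≤ δ ^ 2 := sq_le_sq.2 ((hu.2 i).trans (le_abs_self δ))
                split_ifs
                · rw [mul_one, mul_comm]; gcongr
                · simp
            _ = v j ^ 2 * (δ ^ 2 * ∑ i, if P i j then (1 : ℝ) else 0) := by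
                rw [Finset.mul_sum, Finset.mul_sum]
            _ ≤ _ := by gcongr; exact hcol j
      _ = (∑ j, v j ^ 2) * (δ ^ 2 * B) := by rw [Finset.sum_mul]
      _ ≤ 1 * (δ ^ 2 * B) := by gcongr; exact hv.1
      _ = _ := one_mul _

lemma sum_sq_mul_sq_le_one {P : ι → ι → Prop} [∀ i j, Decidable (P i j)] {u v : ι → ℝ}
    (hu : u ∈ flatBall ι 1) (hv : v ∈ flatBall ι 1) :
    ∑ i, ∑ j, (if P i j then u i ^ 2 * v j ^ 2 else 0) ≤ 1 := by
  calc _ ≤ ∑ i, ∑ j, u i ^ 2 * v j ^ 2 := by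
        refine Finset.sum_le_sum fun i _ => Finset.sum_le_sum fun j _ => ?_
        split_ifs
        · exact le_rfl
        · positivity
    _ = (∑ i, u i ^ 2) * ∑ j, v j ^ 2 := by rw [Finset.sum_mul_sum]
    _ ≤ 1 * 1 := mul_le_mul hu.1 hv.1 (Finset.sum_nonneg fun _ _ => sq_nonneg _) zero_le_one
    _ = 1 := one_mul 1

/-- The variance proxy of a bilinear form in one level, in terms of the mass that `u² ⊗ v²` gives
to the overlaps of that level. -/
lemma sum_norm_sq_levelWeight_le {h : ℝ → ℝ} {A β C₁ C₂ γ : ℝ} (hA : 0 ≤ A) (hβ : 0 ≤ β)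
    (hC₁ : 0 ≤ C₁) (hh : ∀ x, |h x| ≤ A * Real.exp (β * |x|)) {l : ℕ} {u v : ι → ℝ} {τ : ℝ}
    (hτ0 : 0 ≤ τ)
    (hτ : ∀ (w : ι → Bool), ∀ X ∈ regularSet κ ι C₁ C₂ γ, ∑ i, ∑ j,
      (if (w i = true ∧ w j = false) ∧ ⌊|overlap X i j|⌋₊ = l then u i ^ 2 * v j ^ 2 else 0) ≤ τ)
    (w : ι → Bool) (X : ι → EuclideanSpace ℝ κ) :
    ∑ i, ‖∑ j, (if w i = true ∧ w j = false then
      u i * v j * levelWeight h C₁ C₂ γ l X i j else 0) • X j‖ ^ 2 ≤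
      C₁ * (Fintype.card κ + Fintype.card ι) * (A ^ 2 * Real.exp (2 * β * (l + 1)) * τ) := by
  by_cases hX : X ∈ regularSet κ ι C₁ C₂ γ
  swap
  · have : ∀ i j, levelWeight h C₁ C₂ γ l X i j = 0 := fun i j => by
      rw [levelWeight, if_neg fun hc => hX hc.1]
    simp only [this, mul_zero, ite_self, zero_smul, Finset.sum_const_zero, norm_zero]
    rw [zero_pow two_ne_zero, Finset.sum_const_zero]
    positivity
  calc _ ≤ ∑ i, C₁ * (Fintype.card κ + Fintype.card ι) * ∑ j, (if w i = true ∧ w j = false then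
        u i * v j * levelWeight h C₁ C₂ γ l X i j else 0) ^ 2 :=
        Finset.sum_le_sum fun i _ => hX.1 _
    _ = C₁ * (Fintype.card κ + Fintype.card ι) * ∑ i, ∑ j, (if w i = true ∧ w j = false then
        u i * v j * levelWeight h C₁ C₂ γ l X i j else 0) ^ 2 := by rw [Finset.mul_sum]
    _ ≤ C₁ * (Fintype.card κ + Fintype.card ι) * ∑ i, ∑ j, A ^ 2 * Real.exp (2 * β * (l + 1)) *
        (if (w i = true ∧ w j = false) ∧ ⌊|overlap X i j|⌋₊ = l then
          u i ^ 2 * v j ^ 2 else 0) := by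
        refine mul_le_mul_of_nonneg_left (Finset.sum_le_sum fun i _ => Finset.sum_le_sum
          fun j _ => ?_) (by positivity)
        by_cases hw : w i = true ∧ w j = false
        swap
        · simp [hw]
        by_cases hl : ⌊|overlap X i j|⌋₊ = l
        swap
        · simp [hw, hl, levelWeight]
        rw [if_pos hw, if_pos ⟨hw, hl⟩, levelWeight, if_pos ⟨hX, hl⟩, mul_pow, mul_pow]
        have h1 : |overlap X i j| ≤ l + 1 := by
          rw [← hl]; exact (Nat.lt_floor_add_one _).le
        have h2 : h (overlap X i j) ^ 2 ≤ A ^ 2 * Real.exp (2 * β * (l + 1)) := by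
          rw [← sq_abs]
          calc |h (overlap X i j)| ^ 2 ≤ (A * Real.exp (β * (l + 1))) ^ 2 := by
                refine pow_le_pow_left₀ (abs_nonneg _) ((hh _).trans ?_) 2
                gcongr
            _ = _ := by rw [mul_pow, ← Real.exp_nat_mul]; congr 2; push_cast; ring
        calc u i ^ 2 * v j ^ 2 * h (overlap X i j) ^ 2
            ≤ u i ^ 2 * v j ^ 2 * (A ^ 2 * Real.exp (2 * β * (l + 1))) := by gcongr
          _ = _ := mul_comm _ _
    _ = C₁ * (Fintype.card κ + Fintype.card ι) * (A ^ 2 * Real.exp (2 * β * (l + 1)) * ∑ i, ∑ j,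
        (if (w i = true ∧ w j = false) ∧ ⌊|overlap X i j|⌋₊ = l then
          u i ^ 2 * v j ^ 2 else 0)) := by simp_rw [Finset.mul_sum]
    _ ≤ _ := by gcongr; exact hτ w X hX

end Level

section LevelTail

variable {κ ι : Type*} [Fintype κ] [Fintype ι]

/-- The matrix of half-turn means, normalized so that the weight `h (overlap X i j)` gives the
kernel matrix of the odd primitive of `h`. -/
noncomputable def halfTurnMatrix (a : (ι → EuclideanSpace ℝ κ) → ι → ι → ℝ)
    (Z : (ι → EuclideanSpace ℝ κ) × (ι → EuclideanSpace ℝ κ)) : Matrix ι ι ℝ :=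
  Matrix.of fun i j => -(2 * Real.pi / Fintype.card κ) * halfTurnMean a Z i j

lemma measurable_halfTurnMatrix {a : (ι → EuclideanSpace ℝ κ) → ι → ι → ℝ}
    (ha : ∀ i j, Measurable fun X => a X i j) (i j : ι) :
    Measurable fun Z => halfTurnMatrix a Z i j := by
  have h := (measurable_crossTerm_halfTurn ha i j).stronglyMeasurable.integral_prod_left'
    (μ := halfTurnMeasure ι)
  exact h.measurable.const_mul _

open Matrix in
lemma dotProduct_halfTurnMatrix (a : (ι → EuclideanSpace ℝ κ) → ι → ι → ℝ)
    (Z : (ι → EuclideanSpace ℝ κ) × (ι → EuclideanSpace ℝ κ)) (u v : ι → ℝ) :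
    u ⬝ᵥ halfTurnMatrix a Z *ᵥ v =
      -(2 * Real.pi / Fintype.card κ) * ∑ i, ∑ j, u i * v j * halfTurnMean a Z i j := by
  simp only [dotProduct, mulVec, halfTurnMatrix, Matrix.of_apply, Finset.mul_sum]
  exact Finset.sum_congr rfl fun i _ => Finset.sum_congr rfl fun j _ => by ring

/-- The variance scale `4 π² C₁ A² (n + p) / n²` of bilinear forms in `halfTurnMatrix`. -/
noncomputable def varianceScale (κ ι : Type*) [Fintype κ] [Fintype ι] (A C₁ : ℝ) : ℝ :=
  4 * Real.pi ^ 2 * C₁ * A ^ 2 * (Fintype.card κ + Fintype.card ι) / (Fintype.card κ : ℝ) ^ 2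

lemma abs_levelWeight_le {h : ℝ → ℝ} {M : ℝ} (hM : ∀ x, |h x| ≤ M) (C₁ C₂ γ : ℝ) (l : ℕ)
    (X : ι → EuclideanSpace ℝ κ) (i j : ι) : |levelWeight h C₁ C₂ γ l X i j| ≤ M := by
  rw [levelWeight]
  split_ifs
  · exact hM _
  · rw [abs_zero]; exact (abs_nonneg _).trans (hM 0)

lemma abs_irregularWeight_le {h : ℝ → ℝ} {M : ℝ} (hM : ∀ x, |h x| ≤ M) (C₁ C₂ γ : ℝ)
    (X : ι → EuclideanSpace ℝ κ) (i j : ι) : |irregularWeight h C₁ C₂ γ X i j| ≤ M := by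
  rw [irregularWeight]
  split_ifs
  · rw [abs_zero]; exact (abs_nonneg _).trans (hM 0)
  · exact hM _

open Matrix in
/-- A bilinear form in one level is sub-Gaussian; its variance is reduced by the mass `τ` that
`u² ⊗ v²` gives to the overlaps of that level. -/
lemma lintegral_exp_levelMatrix_le {h : ℝ → ℝ} (hm : Measurable h)
    {A β M C₁ C₂ γ : ℝ} (hA : 0 ≤ A) (hβ : 0 ≤ β) (hC₁ : 0 ≤ C₁)
    (hh : ∀ x, |h x| ≤ A * Real.exp (β * |x|)) (hM : ∀ x, |h x| ≤ M) {l : ℕ} {u v : ι → ℝ} {τ : ℝ}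
    (hτ0 : 0 ≤ τ)
    (hτ : ∀ (w : ι → Bool), ∀ X ∈ regularSet κ ι C₁ C₂ γ, ∑ i, ∑ j,
      (if (w i = true ∧ w j = false) ∧ ⌊|overlap X i j|⌋₊ = l then u i ^ 2 * v j ^ 2 else 0) ≤ τ)
    (b : ℝ) :
    ∫⁻ Z, ENNReal.ofReal (Real.exp
        (b * (u ⬝ᵥ halfTurnMatrix (levelWeight h C₁ C₂ γ l) Z *ᵥ v)))
        ∂((Measure.pi fun _ : ι => stdGaussian (EuclideanSpace ℝ κ)).prod
          (Measure.pi fun _ : ι => stdGaussian (EuclideanSpace ℝ κ))) ≤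
      ENNReal.ofReal (Real.exp
        (b ^ 2 * (varianceScale κ ι A C₁ * Real.exp (2 * β * (l + 1)) * τ) / 2)) := by
  have h1 := lintegral_exp_halfTurnMean_le (u := u) (v := v)
    (fun i j => measurable_levelWeight (κ := κ) hm C₁ C₂ γ l i j)
    (abs_levelWeight_le hM C₁ C₂ γ l)
    (sum_norm_sq_levelWeight_le hA hβ hC₁ hh hτ0 hτ) (b * -(2 * Real.pi / Fintype.card κ))
  simp_rw [dotProduct_halfTurnMatrix, ← mul_assoc]
  refine h1.trans (le_of_eq ?_)
  congr 3
  rw [varianceScale]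
  ring

open Matrix in
/-- Tail bound for one level. With `y = γ l / 4`, vectors are called sparse if they have at most
`s = p exp (-2 y)` nonzero coordinates. A bilinear form in which one vector is flat at this scale
has its variance reduced by `exp (-2 y)`, which pays for the full entropy `O (p)`; on pairs of
sparse vectors the variance is not reduced, but the entropy is of order
`p exp (-2 y) (1 + y) = O (p exp (-y))`. -/
lemma measure_not_level_bilin_le_le [Nonempty κ] [Nonempty ι] {h : ℝ → ℝ} (hm : Measurable h)
    {A β M C₁ C₂ γ : ℝ} (hA : 0 < A) (hβ : 0 ≤ β) (hC₁ : 0 < C₁) (hC₂ : 1 ≤ C₂)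
    (hγ : γ = 8 + 8 * β)
    (hh : ∀ x, |h x| ≤ A * Real.exp (β * |x|)) (hM : ∀ x, |h x| ≤ M) {l : ℕ}
    (hl : Real.exp (γ * l) ≤ C₂ * Fintype.card ι) {t : ℝ} (ht : 0 < t)
    (htsq : t ^ 2 = 2 * varianceScale κ ι A C₁ * Fintype.card ι *
      (Real.exp (2 * β) * (26 + 11 * C₂)) * Real.exp (-(2 * l))) :
    ((Measure.pi fun _ : ι => stdGaussian (EuclideanSpace ℝ κ)).prod
      (Measure.pi fun _ : ι => stdGaussian (EuclideanSpace ℝ κ)))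
      {Z | ¬ ∀ u ∈ flatBall ι 1, ∀ v ∈ flatBall ι 1,
        u ⬝ᵥ halfTurnMatrix (levelWeight h C₁ C₂ γ l) Z *ᵥ v ≤ 3 * (4 * t)} ≤
      ENNReal.ofReal (3 * Real.exp (-√(Fintype.card ι))) := by
  have hp : (0 : ℝ) < Fintype.card ι := by exact_mod_cast Fintype.card_pos
  have hp1 : (1 : ℝ) ≤ Fintype.card ι := by exact_mod_cast Fintype.card_pos
  set p : ℝ := (Fintype.card ι : ℝ)
  set S := varianceScale κ ι A C₁ with hS
  have hS0 : 0 < S := by rw [hS, varianceScale]; positivity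
  set y : ℝ := (2 + 2 * β) * l with hy
  have hy0 : 0 ≤ y := by positivity
  have hγ0 : 0 ≤ γ := by rw [hγ]; positivity
  have hγy : γ * l = 4 * y := by rw [hγ, hy]; ring
  set s : ℝ := p * Real.exp (-(2 * y)) with hs
  have hs0 : 0 < s := by positivity
  have hsp : s ≤ p := by
    rw [hs]; exact mul_le_of_le_one_right hp.le (Real.exp_le_one_iff.2 (by linarith))
  set ν := (Measure.pi fun _ : ι => stdGaussian (EuclideanSpace ℝ κ)).prod
      (Measure.pi fun _ : ι => stdGaussian (EuclideanSpace ℝ κ))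
  set W := halfTurnMatrix (κ := κ) (levelWeight (ι := ι) h C₁ C₂ γ l)
  have hWm : ∀ i j, Measurable fun Z => W Z i j :=
    measurable_halfTurnMatrix fun i j => measurable_levelWeight hm C₁ C₂ γ l i j
  have hδ : 1 / √p ≤ 1 / √s := by gcongr
  have hδsq : (1 / √s) ^ 2 * (C₂ * p * Real.exp (-(γ * l))) = C₂ * Real.exp (-(2 * y)) := by
    rw [div_pow, Real.sq_sqrt hs0.le, hs, hγy, one_pow]
    have : Real.exp (-(4 * y)) = Real.exp (-(2 * y)) * Real.exp (-(2 * y)) := by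
      rw [← Real.exp_add]; congr 1; ring
    rw [this]
    field_simp
  have hexp1 : Real.exp (2 * β * (l + 1)) = Real.exp (2 * β) * Real.exp (2 * β * l) := by
    rw [← Real.exp_add]; congr 1; ring
  -- exponent of the Chernoff bound at variance reduction `τ`
  have hexpo : ∀ τ, 0 < τ → t ^ 2 / (2 * (S * Real.exp (2 * β * (l + 1)) * τ)) =
      (26 + 11 * C₂) * (p * Real.exp (-y)) / τ := by
    intro τ hτ
    rw [htsq, hexp1]
    have h2 : Real.exp (-(2 * (l : ℝ))) = Real.exp (-y) * Real.exp (2 * β * l) := by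
      rw [← Real.exp_add]; congr 1; rw [hy]; ring
    rw [h2]
    field_simp
  have hpp : √p ≤ p := by
    have := Real.mul_self_sqrt hp.le
    nlinarith [Real.sqrt_nonneg p, Real.one_le_sqrt.2 hp1]
  -- pairs with a flat vector
  have hflat : ∀ τ, τ = C₂ * Real.exp (-(2 * y)) → Real.exp (5 * p) * (Real.exp (5 * p) *
      Real.exp (-(t ^ 2 / (2 * (S * Real.exp (2 * β * (l + 1)) * τ))))) ≤ Real.exp (-√p) := by
    rintro τ rfl
    rw [hexpo _ (by positivity), ← Real.exp_add, ← Real.exp_add]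
    refine Real.exp_le_exp.2 ?_
    have h1 : (26 + 11 * C₂) * (p * Real.exp (-y)) / (C₂ * Real.exp (-(2 * y))) =
        (26 + 11 * C₂) / C₂ * p * Real.exp y := by
      have : Real.exp (-y) = Real.exp (-(2 * y)) * Real.exp y := by
        rw [← Real.exp_add]; congr 1; ring
      rw [this]; field_simp
    have h2 : 11 ≤ (26 + 11 * C₂) / C₂ := by
      rw [le_div_iff₀ (by positivity)]; linarith
    have h3 : 11 * p * 1 ≤ (26 + 11 * C₂) / C₂ * p * Real.exp y := by
      gcongr
      exact Real.one_le_exp hy0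
    rw [h1]
    linarith
  -- pairs of sparse vectors
  have hsparse : Real.exp (s * (2 + 4 * Real.log (2 * p / s))) *
      (Real.exp (s * (2 + 4 * Real.log (2 * p / s))) *
      Real.exp (-(t ^ 2 / (2 * (S * Real.exp (2 * β * (l + 1)) * 1))))) ≤ Real.exp (-√p) := by
    rw [hexpo 1 one_pos, ← Real.exp_add, ← Real.exp_add]
    refine Real.exp_le_exp.2 ?_
    set x := p * Real.exp (-y) with hx
    have hx0 : 0 < x := by positivity
    have hlog : Real.log (2 * p / s) = Real.log 2 + 2 * y := by
      have : 2 * p / s = 2 * Real.exp (2 * y) := by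
        rw [hs, Real.exp_neg]; field_simp
      rw [this, Real.log_mul two_ne_zero (Real.exp_pos _).ne', Real.log_exp]
    have hent : s * (2 + 4 * Real.log (2 * p / s)) ≤ 13 * x := by
      rw [hlog]
      have h1 : s = x * Real.exp (-y) := by
        rw [hs, hx, mul_assoc, ← Real.exp_add]; congr 2; ring
      have h2 : Real.exp (-y) * (5 + 8 * y) ≤ 13 := by
        rw [Real.exp_neg, inv_mul_le_iff₀ (Real.exp_pos _)]
        nlinarith [Real.add_one_le_exp y]
      have h3 : 2 + 4 * (Real.log 2 + 2 * y) ≤ 5 + 8 * y := by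
        nlinarith [Real.log_two_lt_d9]
      calc _ ≤ s * (5 + 8 * y) := by gcongr
        _ = x * (Real.exp (-y) * (5 + 8 * y)) := by rw [h1]; ring
        _ ≤ x * 13 := by gcongr
        _ = _ := mul_comm _ _
    -- the number of levels is such that `x = p exp (-y)` is at least of the order `p ^ (3 / 4)`
    have hxp : √p ≤ 11 * C₂ * x := by
      rw [hγy] at hl
      have hx4 : p ^ 2 ≤ (11 * C₂ * x) ^ 4 := by
        have e1 : Real.exp (-y) ^ 4 = (Real.exp (4 * y))⁻¹ := by
          rw [← Real.exp_nat_mul, ← Real.exp_neg]; congr 1; push_cast; ring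
        have e2 : (C₂ * p)⁻¹ ≤ Real.exp (-y) ^ 4 := by
          rw [e1]; gcongr
        calc p ^ 2 = 1 * p ^ 2 * 1 := by ring
          _ ≤ (11 ^ 4 * C₂ ^ 3) * p ^ 2 * p := by
              have : 1 ≤ C₂ ^ 3 := one_le_pow₀ hC₂
              gcongr
              linarith
          _ = (11 * C₂) ^ 4 * (p ^ 4 * (C₂ * p)⁻¹) := by field_simp
          _ ≤ (11 * C₂) ^ 4 * (p ^ 4 * Real.exp (-y) ^ 4) := by gcongr
          _ = _ := by rw [hx]; ring
      have h5 : √p ^ 4 ≤ (11 * C₂ * x) ^ 4 := by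
        refine le_trans (le_of_eq ?_) hx4
        calc √p ^ 4 = (√p ^ 2) ^ 2 := by ring
          _ = _ := by rw [Real.sq_sqrt hp.le]
      exact le_of_pow_le_pow_left₀ (by norm_num) (by positivity) h5
    rw [div_one]
    linarith
  have hGfin : (gridNet ι p).Finite := (gridNet_finite_and_ncard_le ι hp le_rfl).1
  have hGcard : ((gridNet ι p).ncard : ℝ) ≤ Real.exp (5 * p) := gridNet_card_ncard_le ι
  have hSfin := gridNet_finite_and_ncard_le ι hs0 hsp
  have hσ : ∀ τ, 0 < τ → 0 < S * Real.exp (2 * β * (l + 1)) * τ := fun τ hτ => by positivity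
  have hτ₁ : 0 < C₂ * Real.exp (-(2 * y)) := by positivity
  have m₁ : ν {Z | ¬ ∀ u ∈ flatBall ι 1, ∀ v ∈ flatBall ι (1 / √s), u ⬝ᵥ W Z *ᵥ v ≤ 4 * t} ≤
      ENNReal.ofReal (Real.exp (-√p)) := by
    refine (measure_not_bilin_le_le hWm (isHalfNet_flatBall ι (one_div_sqrt_card_le_one ι))
      (isHalfNet_flatBall ι hδ) (fun u hu => hu.1) (fun u hu => hu.1) hGfin hGfin hGcard hGcard
      (hσ _ hτ₁) ht fun u hu v hv b => ?_).trans
      (ENNReal.ofReal_le_ofReal (hflat _ rfl))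
    refine lintegral_exp_levelMatrix_le hm hA.le hβ hC₁.le hh hM hτ₁.le (fun w X hX => ?_) b
    rw [← hδsq]
    exact sum_sq_mul_sq_large_overlap_le hX hγ0 (Or.inl ⟨hu, hv⟩)
  have m₂ : ν {Z | ¬ ∀ u ∈ flatBall ι (1 / √s), ∀ v ∈ flatBall ι 1, u ⬝ᵥ W Z *ᵥ v ≤ 4 * t} ≤
      ENNReal.ofReal (Real.exp (-√p)) := by
    refine (measure_not_bilin_le_le hWm (isHalfNet_flatBall ι hδ)
      (isHalfNet_flatBall ι (one_div_sqrt_card_le_one ι)) (fun u hu => hu.1) (fun u hu => hu.1)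
      hGfin hGfin hGcard hGcard (hσ _ hτ₁) ht fun u hu v hv b => ?_).trans
      (ENNReal.ofReal_le_ofReal (hflat _ rfl))
    refine lintegral_exp_levelMatrix_le hm hA.le hβ hC₁.le hh hM hτ₁.le (fun w X hX => ?_) b
    rw [← hδsq]
    exact sum_sq_mul_sq_large_overlap_le hX hγ0 (Or.inr ⟨hu, hv⟩)
  have m₃ : ν {Z | ¬ ∀ u ∈ sparseBall ι s, ∀ v ∈ sparseBall ι s, u ⬝ᵥ W Z *ᵥ v ≤ 4 * t} ≤
      ENNReal.ofReal (Real.exp (-√p)) := by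
    refine (measure_not_bilin_le_le hWm (isHalfNet_sparseBall ι hs0)
      (isHalfNet_sparseBall ι hs0) (fun u hu => hu.1) (fun u hu => hu.1)
      hSfin.1 hSfin.1 hSfin.2 hSfin.2 (hσ _ one_pos) ht fun u hu v hv b => ?_).trans
      (ENNReal.ofReal_le_ofReal hsparse)
    exact lintegral_exp_levelMatrix_le hm hA.le hβ hC₁.le hh hM zero_le_one (fun w X hX =>
      sum_sq_mul_sq_le_one (mem_flatBall_one.2 hu.1) (mem_flatBall_one.2 hv.1)) b
  have hsub : {Z | ¬ ∀ u ∈ flatBall ι 1, ∀ v ∈ flatBall ι 1, u ⬝ᵥ W Z *ᵥ v ≤ 3 * (4 * t)} ⊆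
      {Z | ¬ ∀ u ∈ flatBall ι 1, ∀ v ∈ flatBall ι (1 / √s), u ⬝ᵥ W Z *ᵥ v ≤ 4 * t} ∪
      {Z | ¬ ∀ u ∈ flatBall ι (1 / √s), ∀ v ∈ flatBall ι 1, u ⬝ᵥ W Z *ᵥ v ≤ 4 * t} ∪
      {Z | ¬ ∀ u ∈ sparseBall ι s, ∀ v ∈ sparseBall ι s, u ⬝ᵥ W Z *ᵥ v ≤ 4 * t} := by
    intro Z hZ
    by_contra hcon
    simp only [Set.mem_union, Set.mem_ofPred_eq, not_or, not_not] at hcon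
    exact hZ (bilin_le_of_flat_of_sparse hs0 hcon.1.1 hcon.1.2 hcon.2)
  calc _ ≤ _ := measure_mono hsub
    _ ≤ _ := (measure_union_le _ _).trans (add_le_add ((measure_union_le _ _).trans
        (add_le_add m₁ m₂)) m₃)
    _ = _ := by
        rw [← ENNReal.ofReal_add (Real.exp_pos _).le (Real.exp_pos _).le,
          ← ENNReal.ofReal_add (by positivity) (Real.exp_pos _).le]
        congr 1; ring

end LevelTail

/-! ### The truncated kernel matrix -/

section Truncated

variable {κ ι : Type*} [Fintype κ] [Fintype ι]

lemma halfTurnMean_self (a : (ι → EuclideanSpace ℝ κ) → ι → ι → ℝ)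
    (Z : (ι → EuclideanSpace ℝ κ) × (ι → EuclideanSpace ℝ κ)) (i : ι) :
    halfTurnMean a Z i i = 0 := by
  have : ∀ s : (ι → Bool) × ℝ, crossTerm a s.1 (halfTurn s Z) i i = 0 := fun s => by
    rw [crossTerm, if_neg]
    rintro ⟨h1, h2⟩
    rw [h1] at h2
    cases h2
  simp_rw [halfTurnMean, this, integral_zero]

open Classical in
/-- The matrix with off-diagonal entries `H (overlap X i j) / √n`, `H` the primitive of `h`. -/
noncomputable def primitiveMatrix (h : ℝ → ℝ) (X : ι → EuclideanSpace ℝ κ) : Matrix ι ι ℝ :=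
  Matrix.of fun i j =>
    if i = j then 0 else 1 / √(Fintype.card κ) * ∫ t in (0 : ℝ)..(overlap X i j), h t

lemma primitiveMatrix_eq_halfTurnMatrix [Nonempty κ] {h : ℝ → ℝ} (hm : Measurable h) {M : ℝ}
    (hM : ∀ x, |h x| ≤ M) (heven : ∀ x, h (-x) = h x)
    (Z : (ι → EuclideanSpace ℝ κ) × (ι → EuclideanSpace ℝ κ)) :
    primitiveMatrix h Z.1 = halfTurnMatrix (fun X i j => h (overlap X i j)) Z := by
  have hκ : (0 : ℝ) < Fintype.card κ := by exact_mod_cast Fintype.card_pos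
  have hr : √(Fintype.card κ : ℝ) ^ 2 = Fintype.card κ := Real.sq_sqrt hκ.le
  ext i j
  simp only [primitiveMatrix, halfTurnMatrix, Matrix.of_apply]
  by_cases hij : i = j
  · subst hij
    rw [if_pos rfl, halfTurnMean_self, mul_zero]
  · rw [if_neg hij, halfTurnMean_overlap hm hM heven Z hij]
    nth_rewrite 2 [← hr]
    field_simp

/-- If `h` vanishes outside `[-B, B]`, only the levels up to `⌊B⌋` contribute. -/
lemma weight_decomposition {h : ℝ → ℝ} {C₁ C₂ γ B : ℝ}
    (hsupp : ∀ x, B < |x| → h x = 0) (X : ι → EuclideanSpace ℝ κ) (i j : ι) :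
    h (overlap X i j) = ∑ l ∈ Finset.range (⌊B⌋₊ + 1), levelWeight h C₁ C₂ γ l X i j +
      irregularWeight h C₁ C₂ γ X i j := by
  by_cases hX : X ∈ regularSet κ ι C₁ C₂ γ
  · simp only [levelWeight, irregularWeight, hX, true_and, if_true, add_zero]
    rw [Finset.sum_ite_eq]
    split_ifs with hl
    · rfl
    · refine hsupp _ (lt_of_not_ge fun hle => hl ?_)
      rw [Finset.mem_range, Nat.lt_succ_iff]
      exact Nat.floor_le_floor hle
  · simp [levelWeight, irregularWeight, hX]

open Matrix in
lemma halfTurnMatrix_decomposition {h : ℝ → ℝ} (hm : Measurable h) {M : ℝ}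
    (hM : ∀ x, |h x| ≤ M) {C₁ C₂ γ B : ℝ} (hsupp : ∀ x, B < |x| → h x = 0)
    (Z : (ι → EuclideanSpace ℝ κ) × (ι → EuclideanSpace ℝ κ)) :
    halfTurnMatrix (fun X i j => h (overlap X i j)) Z =
      ∑ l ∈ Finset.range (⌊B⌋₊ + 1), halfTurnMatrix (levelWeight h C₁ C₂ γ l) Z +
        halfTurnMatrix (irregularWeight h C₁ C₂ γ) Z := by
  ext i j
  have hI := fun l => integrable_crossTerm_halfTurn
    (fun i j => measurable_levelWeight (κ := κ) hm C₁ C₂ γ l i j)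
    (abs_levelWeight_le hM C₁ C₂ γ l) Z i j
  have hJ := integrable_crossTerm_halfTurn
    (fun i j => measurable_irregularWeight (κ := κ) hm C₁ C₂ γ i j)
    (abs_irregularWeight_le hM C₁ C₂ γ) Z i j
  rw [Matrix.add_apply, Matrix.sum_apply]
  simp only [halfTurnMatrix, Matrix.of_apply]
  rw [← Finset.mul_sum, ← mul_add]
  congr 1
  simp only [halfTurnMean]
  rw [← integral_finsetSum _ fun l _ => hI l, ← integral_add
    (integrable_finsetSum _ fun l _ => hI l) hJ]
  congr 1
  ext s
  simp only [crossTerm]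
  split_ifs
  · rw [weight_decomposition (C₁ := C₁) (C₂ := C₂) (γ := γ) hsupp, add_mul, Finset.sum_mul]
  · simp

lemma sum_exp_neg_le_two (N : ℕ) : ∑ l ∈ Finset.range N, Real.exp (-(l : ℝ)) ≤ 2 := by
  have h1 : ∀ l : ℕ, Real.exp (-(l : ℝ)) = Real.exp (-1) ^ l := fun l => by
    rw [← Real.exp_nat_mul]; congr 1; ring
  have h2 : Real.exp (-1) ≤ 1 / 2 := by
    rw [Real.exp_neg, one_div]
    exact inv_anti₀ two_pos (by linarith [Real.add_one_le_exp (1 : ℝ)])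
  simp_rw [h1]
  calc _ ≤ ∑ l ∈ Finset.range N, (1 / 2 : ℝ) ^ l :=
        Finset.sum_le_sum fun l _ => pow_le_pow_left₀ (Real.exp_pos _).le h2 l
    _ ≤ 2 := sum_geometric_two_le N

open Matrix in
lemma dotProduct_mulVec_le_sum_abs {R : Matrix ι ι ℝ} {u v : ι → ℝ} (hu : u ∈ flatBall ι 1)
    (hv : v ∈ flatBall ι 1) : u ⬝ᵥ R *ᵥ v ≤ ∑ i, ∑ j, |R i j| := by
  simp only [dotProduct, mulVec, Finset.mul_sum]
  refine Finset.sum_le_sum fun i _ => Finset.sum_le_sum fun j _ => (le_abs_self _).trans ?_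
  rw [abs_mul, abs_mul]
  have h1 := hu.2 i
  have h2 := hv.2 j
  have h3 := abs_nonneg (R i j)
  have : |R i j| * |v j| ≤ |R i j| := mul_le_of_le_one_right h3 h2
  calc _ ≤ 1 * (|R i j| * |v j|) := by gcongr
    _ ≤ _ := by linarith

/-- Markov's inequality for the contribution of the irregular configurations, entry by entry. -/
lemma measure_sum_abs_irregular_gt_le [Nonempty κ] {h : ℝ → ℝ} (hm : Measurable h) {M : ℝ}
    (hM : ∀ x, |h x| ≤ M) {C₁ C₂ γ η T : ℝ} (hη : 0 < η) (hT : 0 < T)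
    (hreg : (Measure.pi fun _ : ι => stdGaussian (EuclideanSpace ℝ κ))
      (regularSet κ ι C₁ C₂ γ)ᶜ ≤ ENNReal.ofReal (η ^ 2)) :
    ((Measure.pi fun _ : ι => stdGaussian (EuclideanSpace ℝ κ)).prod
      (Measure.pi fun _ : ι => stdGaussian (EuclideanSpace ℝ κ)))
      {Z | T ≤ ∑ i, ∑ j, |halfTurnMatrix (irregularWeight h C₁ C₂ γ) Z i j|} ≤
      ENNReal.ofReal ((Fintype.card ι : ℝ) ^ 2 * (2 * Real.pi * M * η) /
        (√(Fintype.card κ) * T)) := by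
  have hκ : (0 : ℝ) < Fintype.card κ := by exact_mod_cast Fintype.card_pos
  set r := √(Fintype.card κ : ℝ) with hr
  have hrr : r ^ 2 = Fintype.card κ := Real.sq_sqrt hκ.le
  set ν := (Measure.pi fun _ : ι => stdGaussian (EuclideanSpace ℝ κ)).prod
      (Measure.pi fun _ : ι => stdGaussian (EuclideanSpace ℝ κ))
  set R := halfTurnMatrix (κ := κ) (irregularWeight (ι := ι) h C₁ C₂ γ) with hR
  have hwm : ∀ i j, Measurable fun X : ι → EuclideanSpace ℝ κ => irregularWeight h C₁ C₂ γ X i j :=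
    fun i j => measurable_irregularWeight hm C₁ C₂ γ i j
  have hRm : ∀ i j, Measurable fun Z => ENNReal.ofReal |R Z i j| := fun i j =>
    (measurable_halfTurnMatrix hwm i j).abs.ennreal_ofReal
  have hentry : ∀ i j, ∫⁻ Z, ENNReal.ofReal |R Z i j| ∂ν ≤
      ENNReal.ofReal (2 * Real.pi * M * η / r) := by
    intro i j
    have h1 := lintegral_abs_halfTurnMean_le hwm (abs_irregularWeight_le hM C₁ C₂ γ)
      (measurableSet_regularSet C₁ C₂ γ).compl (fun X hX i j => by
        rw [irregularWeight, if_pos (not_not.1 hX)]) hη hreg i j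
    have h2 : ∀ Z, ENNReal.ofReal |R Z i j| = ENNReal.ofReal (2 * Real.pi / Fintype.card κ) *
        ENNReal.ofReal |halfTurnMean (irregularWeight h C₁ C₂ γ) Z i j| := fun Z => by
      rw [← ENNReal.ofReal_mul (by positivity), hR, halfTurnMatrix, Matrix.of_apply, abs_mul,
        abs_neg, abs_of_nonneg (by positivity : 0 ≤ 2 * Real.pi / (Fintype.card κ : ℝ))]
    simp_rw [h2]
    rw [lintegral_const_mul' _ _ ENNReal.ofReal_ne_top]
    refine (mul_le_mul_right h1 _).trans ?_
    rw [← ENNReal.ofReal_mul (by positivity)]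
    refine ENNReal.ofReal_le_ofReal (le_of_eq ?_)
    rw [← hr, ← hrr]
    field_simp
  have hsum : ∫⁻ Z, ∑ i, ∑ j, ENNReal.ofReal |R Z i j| ∂ν ≤
      ENNReal.ofReal ((Fintype.card ι : ℝ) ^ 2 * (2 * Real.pi * M * η / r)) := by
    rw [lintegral_finsetSum _ fun i _ => Finset.measurable_fun_sum _ fun j _ => hRm i j]
    calc _ ≤ ∑ _i : ι, ∑ _j : ι, ENNReal.ofReal (2 * Real.pi * M * η / r) := by
          refine Finset.sum_le_sum fun i _ => ?_
          rw [lintegral_finsetSum _ fun j _ => hRm i j]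
          exact Finset.sum_le_sum fun j _ => hentry i j
      _ = _ := by
          simp only [Finset.sum_const, Finset.card_univ, nsmul_eq_mul]
          rw [← ENNReal.ofReal_natCast, ← ENNReal.ofReal_mul (by positivity),
            ← ENNReal.ofReal_mul (by positivity)]
          congr 1; ring
  have hmk := meas_ge_le_lintegral_div (μ := ν)
    (f := fun Z => ∑ i, ∑ j, ENNReal.ofReal |R Z i j|) (ε := ENNReal.ofReal T)
    (Finset.measurable_fun_sum _ fun i _ => Finset.measurable_fun_sum _ fun j _ =>
      hRm i j).aemeasurable (by simpa using hT) ENNReal.ofReal_ne_top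
  have hsub : {Z | T ≤ ∑ i, ∑ j, |R Z i j|} ⊆
      {Z | ENNReal.ofReal T ≤ ∑ i, ∑ j, ENNReal.ofReal |R Z i j|} := by
    intro Z hZ
    have hZ' : T ≤ ∑ i, ∑ j, |R Z i j| := hZ
    have hs : ∀ F : ι → ι → ℝ,
        ENNReal.ofReal (∑ i, ∑ j, |F i j|) = ∑ i, ∑ j, ENNReal.ofReal |F i j| := fun F => by
      rw [ENNReal.ofReal_sum_of_nonneg fun i _ => Finset.sum_nonneg fun j _ => abs_nonneg _]
      exact Finset.sum_congr rfl fun i _ => ENNReal.ofReal_sum_of_nonneg fun j _ => abs_nonneg _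
    exact (ENNReal.ofReal_le_ofReal hZ').trans (hs (R Z)).le
  refine (measure_mono hsub).trans (hmk.trans ((ENNReal.div_le_div_right hsum _).trans ?_))
  rw [← ENNReal.ofReal_div_of_pos hT]
  refine ENNReal.ofReal_le_ofReal (le_of_eq ?_)
  field_simp

open Matrix in
/-- Spectral bound for the matrix of the odd primitive of a bounded density with compact support:
the bounds `t exp (-l)` on the levels sum to a multiple of `t`, and `T` is left for the irregular
configurations. -/
lemma measure_not_primitiveMatrix_le [Nonempty κ] [Nonempty ι] {h : ℝ → ℝ} (hm : Measurable h)
    (heven : ∀ x, h (-x) = h x) {A β M B C₁ C₂ γ η t T : ℝ} (hA : 0 < A) (hβ : 0 ≤ β)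
    (hC₁ : 0 < C₁) (hC₂ : 1 ≤ C₂) (hγ : γ = 8 + 8 * β) (hB : 0 ≤ B)
    (hh : ∀ x, |h x| ≤ A * Real.exp (β * |x|)) (hM : ∀ x, |h x| ≤ M)
    (hsupp : ∀ x, B < |x| → h x = 0) (hBexp : Real.exp (γ * B) ≤ C₂ * Fintype.card ι)
    (ht : 0 < t) (htsq : t ^ 2 = 2 * varianceScale κ ι A C₁ * Fintype.card ι *
      (Real.exp (2 * β) * (26 + 11 * C₂))) (hη : 0 < η) (hT : 0 < T)
    (hreg : (Measure.pi fun _ : ι => stdGaussian (EuclideanSpace ℝ κ))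
      (regularSet κ ι C₁ C₂ γ)ᶜ ≤ ENNReal.ofReal (η ^ 2)) :
    (Measure.pi fun _ : ι => stdGaussian (EuclideanSpace ℝ κ))
      {X | ¬ ∀ u ∈ flatBall ι 1, ∀ v ∈ flatBall ι 1,
        u ⬝ᵥ primitiveMatrix h X *ᵥ v ≤ 24 * t + T} ≤
      ENNReal.ofReal ((B + 1) * (3 * Real.exp (-√(Fintype.card ι))) +
        (Fintype.card ι : ℝ) ^ 2 * (2 * Real.pi * M * η) / (√(Fintype.card κ) * T)) := by
  set μ := Measure.pi fun _ : ι => stdGaussian (EuclideanSpace ℝ κ)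
  have hM0 : 0 ≤ M := (abs_nonneg _).trans (hM 0)
  have hγ0 : 0 ≤ γ := by rw [hγ]; positivity
  set L := ⌊B⌋₊ + 1 with hL
  set S := {X : ι → EuclideanSpace ℝ κ | ¬ ∀ u ∈ flatBall ι 1, ∀ v ∈ flatBall ι 1,
        u ⬝ᵥ primitiveMatrix h X *ᵥ v ≤ 24 * t + T}
  set E : ℕ → Set ((ι → EuclideanSpace ℝ κ) × (ι → EuclideanSpace ℝ κ)) := fun l =>
    {Z | ¬ ∀ u ∈ flatBall ι 1, ∀ v ∈ flatBall ι 1,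
        u ⬝ᵥ halfTurnMatrix (levelWeight h C₁ C₂ γ l) Z *ᵥ v ≤
          3 * (4 * (t * Real.exp (-(l : ℝ))))} with hE
  -- the auxiliary copy of the configuration, which sets the velocities, does not enter `S`
  have hprod : μ S = (μ.prod μ) (S ×ˢ Set.univ) := by
    rw [Measure.prod_prod, measure_univ, mul_one]
  have hsub : S ×ˢ Set.univ ⊆ (⋃ l ∈ Finset.range L, E l) ∪
      {Z | T ≤ ∑ i, ∑ j, |halfTurnMatrix (irregularWeight h C₁ C₂ γ) Z i j|} := by
    rintro Z ⟨hZ, -⟩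
    by_contra hcon
    simp only [Set.mem_union, Set.mem_iUnion, Set.mem_ofPred_eq, not_or, not_exists, not_le, hE,
      not_not] at hcon
    refine hZ fun u hu v hv => ?_
    rw [primitiveMatrix_eq_halfTurnMatrix hm hM heven Z,
      halfTurnMatrix_decomposition (C₁ := C₁) (C₂ := C₂) (γ := γ) hm hM hsupp,
      add_mulVec, dotProduct_add, sum_mulVec, dotProduct_sum]
    refine add_le_add ?_ ((dotProduct_mulVec_le_sum_abs hu hv).trans hcon.2.le)
    calc _ ≤ ∑ l ∈ Finset.range L, 3 * (4 * (t * Real.exp (-(l : ℝ)))) :=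
          Finset.sum_le_sum fun l hl => hcon.1 l hl u hu v hv
      _ = 12 * t * ∑ l ∈ Finset.range L, Real.exp (-(l : ℝ)) := by
          rw [Finset.mul_sum]; exact Finset.sum_congr rfl fun l _ => by ring
      _ ≤ 12 * t * 2 := by gcongr; exact sum_exp_neg_le_two L
      _ = _ := by ring
  have hEl : ∀ l ∈ Finset.range L, (μ.prod μ) (E l) ≤
      ENNReal.ofReal (3 * Real.exp (-√(Fintype.card ι))) := by
    intro l hl
    have hlB : (l : ℝ) ≤ B := by
      rw [Finset.mem_range, hL, Nat.lt_succ_iff] at hl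
      exact (Nat.cast_le.2 hl).trans (Nat.floor_le hB)
    refine measure_not_level_bilin_le_le hm hA hβ hC₁ hC₂ hγ hh hM
      (le_trans (Real.exp_le_exp.2 (by gcongr)) hBexp) (by positivity) ?_
    rw [mul_pow, htsq, ← Real.exp_nat_mul]
    congr 2
    push_cast
    ring
  rw [hprod, ENNReal.ofReal_add (by positivity) (by positivity)]
  refine (measure_mono hsub).trans ((measure_union_le _ _).trans (add_le_add ?_
    (measure_sum_abs_irregular_gt_le hm hM hη hT hreg)))
  refine (measure_biUnion_finset_le _ _).trans ((Finset.sum_le_sum hEl).trans ?_)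
  rw [Finset.sum_const, Finset.card_range, nsmul_eq_mul, ← ENNReal.ofReal_natCast,
    ← ENNReal.ofReal_mul (by positivity)]
  refine ENNReal.ofReal_le_ofReal ?_
  have : (L : ℝ) ≤ B + 1 := by
    rw [hL]; push_cast; linarith [Nat.floor_le hB]
  gcongr

end Truncated

/-! ### The spectral norm and the law of the rows -/

open Matrix in
lemma matrixSpectralNorm_le {p : ℕ} {M : Matrix (Fin p) (Fin p) ℝ} {c : ℝ} (hc : 0 ≤ c)
    (h : ∀ u ∈ flatBall (Fin p) 1, ∀ v ∈ flatBall (Fin p) 1, u ⬝ᵥ M *ᵥ v ≤ c) :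
    matrixSpectralNorm M ≤ c := by
  refine ContinuousLinearMap.opNorm_le_of_unit_norm hc fun v hv => ?_
  set w := Matrix.toEuclideanCLM (n := Fin p) (𝕜 := ℝ) M v with hw
  have hwM : w.ofLp = M *ᵥ v.ofLp := by
    rw [hw, Matrix.ofLp_toEuclideanCLM]
  rcases eq_or_ne w 0 with h0 | h0
  · rw [h0, norm_zero]; exact hc
  have hw0 : 0 < ‖w‖ := norm_pos_iff.2 h0
  have hwsq : ∑ i, w.ofLp i ^ 2 = ‖w‖ ^ 2 := (EuclideanSpace.real_norm_sq_eq w).symm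
  have h1 : ‖w‖⁻¹ • w.ofLp ∈ flatBall (Fin p) 1 := by
    refine mem_flatBall_one.2 (le_of_eq ?_)
    simp only [Pi.smul_apply, smul_eq_mul, mul_pow]
    rw [← Finset.mul_sum, hwsq]
    field_simp
  have h2 : v.ofLp ∈ flatBall (Fin p) 1 :=
    mem_flatBall_one.2 (by rw [← EuclideanSpace.real_norm_sq_eq v, hv, one_pow])
  have h3 := h _ h1 _ h2
  rw [← hwM, smul_dotProduct, smul_eq_mul] at h3
  have h4 : w.ofLp ⬝ᵥ w.ofLp = ‖w‖ ^ 2 := by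
    rw [← hwsq]; exact Finset.sum_congr rfl fun i _ => (sq _).symm
  rw [h4] at h3
  calc ‖w‖ = ‖w‖⁻¹ * ‖w‖ ^ 2 := by field_simp
    _ ≤ c := h3

/-- The rows of `X` are independent standard Gaussian vectors. -/
lemma map_rows_eq_pi_stdGaussian {Ω : Type*} [MeasurableSpace Ω] {P : Measure Ω}
    [IsProbabilityMeasure P] {p n : ℕ} {X : Ω → Matrix (Fin p) (Fin n) ℝ}
    (hX : HasIIDStandardGaussianEntries X P) :
    AEMeasurable (fun ω i => (WithLp.toLp 2 (X ω i) : EuclideanSpace ℝ (Fin n))) P ∧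
    P.map (fun ω i => (WithLp.toLp 2 (X ω i) : EuclideanSpace ℝ (Fin n))) =
      Measure.pi fun _ : Fin p => stdGaussian (EuclideanSpace ℝ (Fin n)) := by
  have hm : ∀ ij : Fin p × Fin n, AEMeasurable (fun ω => X ω ij.1 ij.2) P :=
    fun ij => (hX.2 ij.1 ij.2).aemeasurable
  have h1 : P.map (fun ω (ij : Fin p × Fin n) => X ω ij.1 ij.2) =
      Measure.pi fun _ : Fin p × Fin n => gaussianReal 0 1 := by
    rw [(iIndepFun_iff_map_fun_eq_pi_map hm).1 hX.1]
    congr 1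
    ext1 ij
    exact (hX.2 ij.1 ij.2).map_eq
  have h2 : (Measure.pi fun _ : Fin p × Fin n => gaussianReal 0 1).map
      (MeasurableEquiv.curry (Fin p) (Fin n) ℝ) =
      Measure.pi fun _ : Fin p => Measure.pi fun _ : Fin n => gaussianReal 0 1 := by
    have := Measure.infinitePi_map_curry (X := ℝ) (fun (_ : Fin p) (_ : Fin n) => gaussianReal 0 1)
    simpa only [Measure.infinitePi_eq_pi] using this
  have h3 : (Measure.pi fun _ : Fin p => Measure.pi fun _ : Fin n => gaussianReal 0 1).map
      (fun x i => (WithLp.toLp 2 (x i) : EuclideanSpace ℝ (Fin n))) =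
      Measure.pi fun _ : Fin p => stdGaussian (EuclideanSpace ℝ (Fin n)) := by
    rw [Measure.pi_map_pi (fun _ => by fun_prop)]
    simp_rw [map_pi_eq_stdGaussian]
  have hm' : AEMeasurable (fun ω (ij : Fin p × Fin n) => X ω ij.1 ij.2) P :=
    aemeasurable_pi_lambda _ hm
  have htm : Measurable fun (x : Fin p → Fin n → ℝ) i =>
      (WithLp.toLp 2 (x i) : EuclideanSpace ℝ (Fin n)) :=
    measurable_pi_lambda _ fun i => by fun_prop
  have hcm := htm.comp (MeasurableEquiv.curry (Fin p) (Fin n) ℝ).measurable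
  refine ⟨hcm.comp_aemeasurable hm', ?_⟩
  rw [← h3, ← h2, ← h1, Measure.map_map htm (MeasurableEquiv.measurable _),
    AEMeasurable.map_map_of_aemeasurable hcm.aemeasurable hm']
  rfl

lemma kernelMatrix_eq_primitiveMatrix {p n : ℕ} {k h : ℝ → ℝ}
    (hk : ∀ x, ∫ t in (0 : ℝ)..x, h t = k x) (X : Matrix (Fin p) (Fin n) ℝ) :
    kernelMatrix k X = primitiveMatrix h fun i =>
      (WithLp.toLp 2 (X i) : EuclideanSpace ℝ (Fin n)) := by
  ext i j
  simp only [kernelMatrix, primitiveMatrix, Matrix.of_apply, Fintype.card_fin]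
  congr 1
  rw [hk]
  congr 2
  rw [overlap, sampleCovariance, Matrix.smul_apply, Matrix.mul_apply, smul_eq_mul,
    Fintype.card_fin, PiLp.inner_apply, Finset.mul_sum, Finset.mul_sum, Finset.sum_div]
  refine Finset.sum_congr rfl fun l _ => ?_
  simp only [Matrix.transpose_apply, RCLike.inner_apply, conj_trivial]
  rw [← mul_assoc, ← div_eq_mul_inv, Real.sqrt_div_self', one_div, mul_comm (X j l)]
  ring

/-! ### Removing the truncation -/

section Tail

variable {κ ι : Type*} [Fintype κ] [Fintype ι]

lemma primitiveMatrix_congr_of_mem_regularSet {C₁ C₂ γ B : ℝ} (hγ : 0 < γ)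
    (hB : Real.exp (γ * B) = C₂ * Fintype.card ι) {X : ι → EuclideanSpace ℝ κ}
    (hX : X ∈ regularSet κ ι C₁ C₂ γ) (h : ℝ → ℝ) :
    primitiveMatrix (fun x => if |x| ≤ B then h x else 0) X = primitiveMatrix h X := by
  classical
  ext i j
  simp only [primitiveMatrix, Matrix.of_apply]
  split_ifs with hij
  · rfl
  congr 1
  have h1 : Real.exp (γ * |overlap X i j|) ≤ Real.exp (γ * B) := by
    rw [hB]
    exact (Finset.single_le_sum (f := fun j => Real.exp (γ * |overlap X i j|))
      (fun _ _ => (Real.exp_pos _).le)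
      (Finset.mem_erase.2 ⟨Ne.symm hij, Finset.mem_univ j⟩)).trans (hX.2 i)
  have h2 : |overlap X i j| ≤ B := le_of_mul_le_mul_left (Real.exp_le_exp.1 h1) hγ
  refine intervalIntegral.integral_congr fun t ht => if_pos ?_
  have h3 := Set.abs_sub_left_of_mem_uIcc ht
  rw [sub_zero, sub_zero] at h3
  exact h3.trans h2

open Matrix in
/-- The density is cut off at the level `B` with `exp (γ B) = C₂ p`, which no overlap of a regular
configuration exceeds; since `β ≤ γ`, the truncated density is at most `A C₂ p`. -/
lemma measure_not_primitiveMatrix_le_of_exp_growth [Nonempty κ] [Nonempty ι] {h : ℝ → ℝ}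
    (hm : Measurable h) (heven : ∀ x, h (-x) = h x) {A β C₁ C₂ γ η t T : ℝ} (hA : 0 < A)
    (hβ : 0 ≤ β) (hC₁ : 0 < C₁) (hC₂ : 1 ≤ C₂) (hγ : γ = 8 + 8 * β)
    (hh : ∀ x, |h x| ≤ A * Real.exp (β * |x|))
    (ht : 0 < t) (htsq : t ^ 2 = 2 * varianceScale κ ι A C₁ * Fintype.card ι *
      (Real.exp (2 * β) * (26 + 11 * C₂))) (hη : 0 < η) (hT : 0 < T)
    (hreg : (Measure.pi fun _ : ι => stdGaussian (EuclideanSpace ℝ κ))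
      (regularSet κ ι C₁ C₂ γ)ᶜ ≤ ENNReal.ofReal (η ^ 2)) :
    (Measure.pi fun _ : ι => stdGaussian (EuclideanSpace ℝ κ))
      {X | ¬ ∀ u ∈ flatBall ι 1, ∀ v ∈ flatBall ι 1,
        u ⬝ᵥ primitiveMatrix h X *ᵥ v ≤ 24 * t + T} ≤
      ENNReal.ofReal ((2 * C₂ * Fintype.card ι) * (3 * Real.exp (-√(Fintype.card ι))) +
        (Fintype.card ι : ℝ) ^ 2 * (2 * Real.pi * (A * (C₂ * Fintype.card ι)) * η) /
          (√(Fintype.card κ) * T) + η ^ 2) := by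
  have hp : (1 : ℝ) ≤ Fintype.card ι := by exact_mod_cast Fintype.card_pos
  have hCp : 1 ≤ C₂ * Fintype.card ι := one_le_mul_of_one_le_of_one_le hC₂ hp
  have hγ1 : 1 ≤ γ := by rw [hγ]; linarith
  have hγ0 : 0 < γ := by linarith
  have hβγ : β ≤ γ := by rw [hγ]; linarith
  obtain ⟨B, hB⟩ : ∃ B, B = Real.log (C₂ * Fintype.card ι) / γ := ⟨_, rfl⟩
  have hB0 : 0 ≤ B := by rw [hB]; exact div_nonneg (Real.log_nonneg hCp) hγ0.le
  have hγB : γ * B = Real.log (C₂ * Fintype.card ι) := by rw [hB]; field_simp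
  have hexp : Real.exp (γ * B) = C₂ * Fintype.card ι := by
    rw [hγB, Real.exp_log (by linarith)]
  have hB1 : B + 1 ≤ 2 * C₂ * Fintype.card ι := by
    have h1 : B ≤ γ * B := le_mul_of_one_le_left hB0 hγ1
    have h2 : γ * B + 1 ≤ Real.exp (γ * B) := Real.add_one_le_exp _
    rw [hexp] at h2
    linarith
  set g : ℝ → ℝ := fun x => if |x| ≤ B then h x else 0 with hg
  have hgm : Measurable g :=
    Measurable.ite (measurableSet_le measurable_id.abs measurable_const) hm measurable_const
  have hgeven : ∀ x, g (-x) = g x := fun x => by simp only [hg, abs_neg, heven]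
  have hgh : ∀ x, |g x| ≤ |h x| := fun x => by
    simp only [hg]
    split_ifs
    · exact le_rfl
    · rw [abs_zero]; exact abs_nonneg _
  have hgM : ∀ x, |g x| ≤ A * (C₂ * Fintype.card ι) := fun x => by
    simp only [hg]
    split_ifs with hx
    · refine (hh x).trans ?_
      rw [← hexp]
      gcongr
    · rw [abs_zero]; positivity
  have hmain := measure_not_primitiveMatrix_le hgm hgeven hA hβ hC₁ hC₂ hγ hB0
    (fun x => (hgh x).trans (hh x)) hgM (fun x hx => if_neg (not_le.2 hx)) hexp.le ht htsq hη hT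
    hreg
  rw [ENNReal.ofReal_add (by positivity) (by positivity)]
  refine (measure_mono (t := _ ∪ (regularSet κ ι C₁ C₂ γ)ᶜ) fun X hX => ?_).trans
    ((measure_union_le _ _).trans (add_le_add (hmain.trans (ENNReal.ofReal_le_ofReal ?_)) hreg))
  · by_cases hr : X ∈ regularSet κ ι C₁ C₂ γ
    · left
      rw [Set.mem_ofPred_eq] at hX ⊢
      rwa [primitiveMatrix_congr_of_mem_regularSet hγ0 hexp hr]
    · exact Or.inr hr
  · gcongr

/-! ### Choice of the parameters -/

lemma exp_neg_sqrt_le (m : ℕ) {x : ℝ} (hx : 0 < x) :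
    Real.exp (-√x) ≤ (2 * m).factorial * (x ^ m)⁻¹ := by
  have h1 := Real.pow_div_factorial_le_exp (√x) (Real.sqrt_nonneg _) (2 * m)
  rw [pow_mul, Real.sq_sqrt hx.le] at h1
  rw [Real.exp_neg]
  calc _ ≤ (x ^ m / (2 * m).factorial)⁻¹ := inv_anti₀ (by positivity) h1
    _ = _ := by rw [inv_div, div_eq_mul_inv]

/-- The tail of the regular set in the form of a square, as its square root is what enters the
contribution of irregular configurations. -/
lemma measure_compl_regularSet_le_sq [Nonempty κ] [Nonempty ι] (m : ℕ) (γ : ℝ) {c : ℝ}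
    (hc : c = (2 * (2 * m)).factorial +
      2 * Real.exp (2 * (2 * m : ℝ) ^ 2 * γ ^ 2 * (8 * (5 + 2 * m)))) :
    (Measure.pi fun _ : ι => stdGaussian (EuclideanSpace ℝ κ))
      (regularSet κ ι (32 * (5 + 2 * m)) (6 * Real.exp (γ ^ 2 * (8 * (5 + 2 * m)) / 2)) γ)ᶜ ≤
      ENNReal.ofReal ((2 * Fintype.card ι * Real.exp (-(m * Fintype.card κ)) +
        c * Fintype.card ι * ((Fintype.card ι : ℝ) ^ m)⁻¹) ^ 2) := by
  refine (measure_compl_regularSet_le (q := 2 * m) (by positivity)).trans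
    (ENNReal.ofReal_le_ofReal ?_)
  have hp : (1 : ℝ) ≤ Fintype.card ι := by exact_mod_cast Fintype.card_pos
  have h4 := exp_neg_sqrt_le (2 * m) (zero_lt_one.trans_le hp)
  have hf : (1 : ℝ) ≤ (2 * (2 * m)).factorial := by exact_mod_cast Nat.factorial_pos _
  set p : ℝ := (Fintype.card ι : ℝ)
  set n : ℝ := (Fintype.card κ : ℝ)
  set f : ℝ := ((2 * (2 * m)).factorial : ℝ)
  set E : ℝ := Real.exp (2 * (2 * m : ℝ) ^ 2 * γ ^ 2 * (8 * (5 + 2 * m)))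
  set x : ℝ := Real.exp (-(m * n)) with hx
  set y : ℝ := (p ^ m)⁻¹ with hy
  have hp0 : 0 < p := by linarith
  have hE : 0 < E := Real.exp_pos _
  have hx0 : 0 < x := Real.exp_pos _
  have hy0 : 0 < y := by positivity
  have hxx : Real.exp (-(2 * m * n)) = x ^ 2 := by
    rw [hx, ← Real.exp_nat_mul]; congr 1; push_cast; ring
  have hxp : Real.exp (-(2 * m * (n + p))) ≤ x ^ 2 := by
    rw [← hxx]
    refine Real.exp_le_exp.2 ?_
    have : 0 ≤ 2 * (m : ℝ) * p := by positivity
    linarith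
  have hyp : p ^ (-(2 * m : ℝ)) = y ^ 2 := by
    rw [Real.rpow_neg hp0.le, hy, inv_pow, ← pow_mul, ← Real.rpow_natCast]
    congr 2
    push_cast
    ring
  have hyy : (p ^ (2 * m))⁻¹ = y ^ 2 := by rw [hy, inv_pow, ← pow_mul, mul_comm]
  rw [hyy] at h4
  rw [hxx, hyp]
  have hc1 : 1 ≤ c := by rw [hc]; linarith
  have hpp : p ≤ p ^ 2 := le_self_pow₀ hp two_ne_zero
  calc _ ≤ x ^ 2 + p * (x ^ 2 + (f * y ^ 2 + p * (2 * E * y ^ 2))) := by gcongr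
    _ = (1 + p) * x ^ 2 + (f * p + 2 * E * p ^ 2) * y ^ 2 := by ring
    _ ≤ (p ^ 2 + p ^ 2) * x ^ 2 + (f * p ^ 2 + 2 * E * p ^ 2) * y ^ 2 := by
        gcongr
        exact hp.trans hpp
    _ = 2 * (p * x) ^ 2 + c * (p * y) ^ 2 := by rw [hc]; ring
    _ ≤ 4 * (p * x) ^ 2 + c ^ 2 * (p * y) ^ 2 := by
        gcongr
        · norm_num
        · exact le_self_pow₀ hc1 two_ne_zero
    _ ≤ _ := by
        have : 0 ≤ 4 * c * (p * x) * (p * y) := by positivity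
        linarith

/-- All the contributions to the failure probability, with `m` so large that every power of `p`
is absorbed: below `exp (α n)` the powers of `p` are absorbed by `exp (-m n)`, and by `p ^ (-m)`
in any case. -/
lemma tail_terms_le {α A C₂ c p n S e : ℝ} {m : ℕ} (hA : 0 < A) (hC₂ : 0 < C₂)
    (hc : 0 < c) (hp : 1 ≤ p) (hn : 0 ≤ n) (hS : 1 ≤ S) (hm : 4 * α ≤ m) (hm' : 4 + α ≤ m)
    (hpn : p ≤ Real.exp (α * n)) (he : e ≤ c * (p ^ m)⁻¹) :
    2 * C₂ * p * (3 * e) + p ^ 2 * (2 * Real.pi * (A * (C₂ * p)) *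
        (2 * p * Real.exp (-(m * n)) + c * p * (p ^ m)⁻¹)) / S +
        (2 * p * Real.exp (-(m * n)) + c * p * (p ^ m)⁻¹) ^ 2 ≤
      (6 * C₂ * c + 2 * Real.pi * A * C₂ * (2 + c) + 8 + 2 * c ^ 2) *
        (p ^ (-α) + p * Real.exp (-α * n)) := by
  have hp0 : 0 < p := by linarith
  have hpi := Real.pi_pos
  have hxα : p ^ 4 * Real.exp (-(m * n)) ≤ p * Real.exp (-α * n) := by
    calc _ = p * (p ^ 3 * Real.exp (-(m * n))) := by ring
      _ ≤ p * (Real.exp (α * n) ^ 3 * Real.exp (-(4 * α * n))) := by gcongr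
      _ = _ := by
          rw [← Real.exp_nat_mul, ← Real.exp_add]
          congr 2
          push_cast
          ring
  have hyα : p ^ 4 * (p ^ m)⁻¹ ≤ p ^ (-α) := by
    rw [← Real.rpow_natCast p m, ← Real.rpow_neg hp0.le, ← Real.rpow_natCast p 4,
      ← Real.rpow_add hp0]
    refine Real.rpow_le_rpow_of_exponent_le hp ?_
    push_cast
    linarith
  set x := Real.exp (-(m * n)) with hx
  set y := (p ^ m)⁻¹ with hy
  have hx0 : 0 < x := Real.exp_pos _
  have hy0 : 0 < y := by positivity
  have hx1 : x ≤ 1 := Real.exp_le_one_iff.2 (by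
    have : 0 ≤ (m : ℝ) * n := by positivity
    linarith)
  have hy1 : y ≤ 1 := inv_le_one_of_one_le₀ (one_le_pow₀ hp)
  have h1 : p ≤ p ^ 4 := le_self_pow₀ hp (by norm_num)
  have h2 : p ^ 2 ≤ p ^ 4 := pow_le_pow_right₀ hp (by norm_num)
  have hT1 : 2 * C₂ * p * (3 * e) ≤ 6 * C₂ * c * (p ^ 4 * x + p ^ 4 * y) := by
    calc _ ≤ 2 * C₂ * p * (3 * (c * y)) := by gcongr
      _ ≤ 2 * C₂ * p ^ 4 * (3 * (c * y)) := by gcongr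
      _ ≤ 2 * C₂ * p ^ 4 * (3 * (c * y)) + 6 * C₂ * c * (p ^ 4 * x) :=
          le_add_of_nonneg_right (by positivity)
      _ = _ := by ring
  have hT2 : p ^ 2 * (2 * Real.pi * (A * (C₂ * p)) * (2 * p * x + c * p * y)) / S ≤
      2 * Real.pi * A * C₂ * (2 + c) * (p ^ 4 * x + p ^ 4 * y) := by
    calc _ ≤ p ^ 2 * (2 * Real.pi * (A * (C₂ * p)) * (2 * p * x + c * p * y)) :=
          div_le_self (by positivity) hS
      _ = 2 * Real.pi * A * C₂ * (2 * (p ^ 4 * x) + c * (p ^ 4 * y)) := by ring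
      _ ≤ 2 * Real.pi * A * C₂ * (2 * (p ^ 4 * x) + c * (p ^ 4 * y)) +
          2 * Real.pi * A * C₂ * (c * (p ^ 4 * x) + 2 * (p ^ 4 * y)) :=
          le_add_of_nonneg_right (by positivity)
      _ = _ := by ring
  have hT3 : (2 * p * x + c * p * y) ^ 2 ≤ (8 + 2 * c ^ 2) * (p ^ 4 * x + p ^ 4 * y) := by
    have hxx : x ^ 2 ≤ x := pow_le_of_le_one hx0.le hx1 two_ne_zero
    have hyy : y ^ 2 ≤ y := pow_le_of_le_one hy0.le hy1 two_ne_zero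
    calc _ ≤ 2 * ((2 * p * x) ^ 2 + (c * p * y) ^ 2) := add_sq_le
      _ = 8 * (p ^ 2 * x ^ 2) + 2 * c ^ 2 * (p ^ 2 * y ^ 2) := by ring
      _ ≤ 8 * (p ^ 4 * x) + 2 * c ^ 2 * (p ^ 4 * y) := by gcongr
      _ ≤ 8 * (p ^ 4 * x) + 2 * c ^ 2 * (p ^ 4 * y) +
          (2 * c ^ 2 * (p ^ 4 * x) + 8 * (p ^ 4 * y)) :=
          le_add_of_nonneg_right (by positivity)
      _ = _ := by ring
  calc _ ≤ (6 * C₂ * c + 2 * Real.pi * A * C₂ * (2 + c) + 8 + 2 * c ^ 2) *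
        (p ^ 4 * x + p ^ 4 * y) := by linarith
    _ ≤ _ := by
        gcongr ?_ * ?_
        linarith

end Tail

/-- The scale `√(p (n + p)) / n` of the Gaussian fluctuations is at most
`√2 max (p / n, √(p / n))`. -/
lemma sqrt_varianceScale_le {p n : ℕ} (hn : 0 < n) {A C₁ D : ℝ} (hA : 0 < A)
    (hC₁ : 0 < C₁) (hD : 0 < D) :
    √(2 * varianceScale (Fin n) (Fin p) A C₁ * p * D) ≤
      4 * Real.pi * A * √(C₁ * D) * max ((p : ℝ) / n) (√((p : ℝ) / n)) := by
  have hpi := Real.pi_pos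
  have hn' : (0 : ℝ) < n := by exact_mod_cast hn
  set r : ℝ := p / n with hr
  set s := max r (√r) with hs
  have hr0 : 0 ≤ r := by positivity
  have hs0 : 0 ≤ s := hr0.trans (le_max_left _ _)
  have h1 : r ≤ s ^ 2 := by
    rw [← Real.sqrt_le_left hs0]; exact le_max_right _ _
  have h2 : r ^ 2 ≤ s ^ 2 := pow_le_pow_left₀ hr0 (le_max_left _ _) 2
  refine Real.sqrt_le_iff.2 ⟨by positivity, ?_⟩
  rw [mul_pow, mul_pow, Real.sq_sqrt (by positivity), varianceScale, Fintype.card_fin,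
    Fintype.card_fin]
  calc _ = 8 * Real.pi ^ 2 * A ^ 2 * (C₁ * D) * (r + r ^ 2) := by
        rw [hr]; field_simp; ring
    _ ≤ 8 * Real.pi ^ 2 * A ^ 2 * (C₁ * D) * (s ^ 2 + s ^ 2) := by gcongr
    _ = _ := by ring

theorem theorem1p5 (A β α : ℝ) (hA : 0 < A) (hβ : 0 < β) (hα : 0 < α) :
    ∃ C C' : ℝ, 0 < C ∧ 0 < C' ∧
      ∀ k : ℝ → ℝ, Function.Odd k → LocallyAbsolutelyContinuous k →
        (∀ᵐ x : ℝ, DifferentiableAt ℝ k x ∧ |deriv k x| ≤ A * Real.exp (β * |x|)) →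
        ∀ (p n : ℕ), 0 < p → 0 < n →
          ∀ {Ω : Type*} [MeasurableSpace Ω] (P : Measure Ω) [IsProbabilityMeasure P]
            (X : Ω → Matrix (Fin p) (Fin n) ℝ), HasIIDStandardGaussianEntries X P →
            P.real {ω | matrixSpectralNorm (kernelMatrix k (X ω)) >
                C * max ((p : ℝ) / n) (√((p : ℝ) / n))}
              ≤ C' * ((p : ℝ) ^ (-α) + p * Real.exp (-α * n)) := by
  have hpi := Real.pi_pos
  -- large enough for `4 + α ≤ m` and `4 α ≤ m`
  obtain ⟨m, hm⟩ := exists_nat_ge (4 * α + 4)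
  obtain ⟨γ, hγ⟩ : ∃ γ, γ = 8 + 8 * β := ⟨_, rfl⟩
  obtain ⟨C₁, hC₁⟩ : ∃ C₁ : ℝ, C₁ = 32 * (5 + 2 * m) := ⟨_, rfl⟩
  obtain ⟨C₂, hC₂⟩ : ∃ C₂ : ℝ, C₂ = 6 * Real.exp (γ ^ 2 * (8 * (5 + 2 * m)) / 2) := ⟨_, rfl⟩
  obtain ⟨c, hc⟩ : ∃ c : ℝ, c = (2 * (2 * m)).factorial +
      2 * Real.exp (2 * (2 * m : ℝ) ^ 2 * γ ^ 2 * (8 * (5 + 2 * m))) := ⟨_, rfl⟩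
  obtain ⟨D, hD⟩ : ∃ D, D = Real.exp (2 * β) * (26 + 11 * C₂) := ⟨_, rfl⟩
  have hC₁0 : 0 < C₁ := by rw [hC₁]; positivity
  have hC₂1 : 1 ≤ C₂ := by
    have : 1 ≤ Real.exp (γ ^ 2 * (8 * (5 + 2 * m)) / 2) := Real.one_le_exp (by positivity)
    rw [hC₂]; linarith
  have hD0 : 0 < D := by rw [hD]; positivity
  have hc0 : 0 < c := by rw [hc]; positivity
  -- `24 t + T` with `t` the fluctuation scale and `T = max (p / n) √(p / n)`
  refine ⟨24 * (4 * Real.pi * A * √(C₁ * D)) + 1,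
    6 * C₂ * c + 2 * Real.pi * A * C₂ * (2 + c) + 8 + 2 * c ^ 2, by positivity, by positivity, ?_⟩
  intro k hodd hac hk p n hp hn Ω _ P _ X hX
  have hp1 : (1 : ℝ) ≤ p := by exact_mod_cast hp
  have hn1 : (1 : ℝ) ≤ n := by exact_mod_cast hn
  rcases le_or_gt (Real.exp (α * n)) p with hpn | hpn
  -- for `p ≥ exp (α n)` the right-hand side is at least `1`
  · have h1 : 1 ≤ p * Real.exp (-α * n) := by
      calc (1 : ℝ) = Real.exp (α * n) * Real.exp (-α * n) := by
            rw [← Real.exp_add, neg_mul, add_neg_cancel, Real.exp_zero]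
        _ ≤ _ := by gcongr
    have h2 : 0 ≤ (p : ℝ) ^ (-α) := by positivity
    refine measureReal_le_one.trans (one_le_mul_of_one_le_of_one_le ?_ (by linarith))
    have : 0 ≤ 6 * C₂ * c + 2 * Real.pi * A * C₂ * (2 + c) + 2 * c ^ 2 := by positivity
    linarith
  have : Nonempty (Fin p) := ⟨⟨0, hp⟩⟩
  have : Nonempty (Fin n) := ⟨⟨0, hn⟩⟩
  obtain ⟨h, hhm, hheven, hh, hprim⟩ := exists_even_density hA.le hodd hac hk
  obtain ⟨hXm, hXlaw⟩ := map_rows_eq_pi_stdGaussian hX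
  set T := max ((p : ℝ) / n) (√((p : ℝ) / n)) with hT
  have hT0 : 0 < T := lt_max_of_lt_left (by positivity)
  have hV : 0 < varianceScale (Fin n) (Fin p) A C₁ := by
    rw [varianceScale, Fintype.card_fin, Fintype.card_fin]; positivity
  set t := √(2 * varianceScale (Fin n) (Fin p) A C₁ * p * D) with ht
  have ht0 : 0 < t := Real.sqrt_pos.2 (by positivity)
  have htT : t ≤ 4 * Real.pi * A * √(C₁ * D) * T := sqrt_varianceScale_le hn hA hC₁0 hD0
  have htsq : t ^ 2 = 2 * varianceScale (Fin n) (Fin p) A C₁ * Fintype.card (Fin p) *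
      (Real.exp (2 * β) * (26 + 11 * C₂)) := by
    rw [ht, Real.sq_sqrt (by positivity), Fintype.card_fin, hD]
  have hreg := measure_compl_regularSet_le_sq (κ := Fin n) (ι := Fin p) m γ hc
  rw [← hC₁, ← hC₂] at hreg
  have hbound := measure_not_primitiveMatrix_le_of_exp_growth hhm hheven hA hβ.le hC₁0 hC₂1 hγ hh
    ht0 htsq (by positivity) hT0 hreg
  simp only [Fintype.card_fin] at hbound
  have hS : 1 ≤ √(n : ℝ) * T := by
    calc (1 : ℝ) ≤ √p := Real.one_le_sqrt.2 hp1
      _ = √(n : ℝ) * √((p : ℝ) / n) := by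
          rw [← Real.sqrt_mul (by positivity)]; congr 1; field_simp
      _ ≤ _ := by gcongr; exact le_max_right _ _
  have he : Real.exp (-√(p : ℝ)) ≤ c * ((p : ℝ) ^ m)⁻¹ := by
    refine (exp_neg_sqrt_le m (by linarith)).trans ?_
    gcongr
    have h1 : ((2 * m).factorial : ℝ) ≤ (2 * (2 * m)).factorial := by
      exact_mod_cast Nat.factorial_le (by omega)
    rw [hc]
    exact h1.trans (le_add_of_nonneg_right (by positivity))
  refine ENNReal.toReal_le_of_le_ofReal (by positivity) ?_
  refine (measure_mono (t := (fun ω i => (WithLp.toLp 2 (X ω i) : EuclideanSpace ℝ (Fin n))) ⁻¹' _)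
    fun ω hω => ?_).trans ((Measure.le_map_apply hXm _).trans ((hXlaw ▸ hbound).trans
      (ENNReal.ofReal_le_ofReal (tail_terms_le hA (by linarith) hc0 hp1 (by linarith) hS
        (by linarith) (by linarith) hpn.le he))))
  intro hcon
  rw [Set.mem_ofPred_eq, kernelMatrix_eq_primitiveMatrix hprim] at hω
  have hnorm := matrixSpectralNorm_le (by positivity) hcon
  linarith
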